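/- Let $p\ge 5$ be a prime and let $\lambda$ be a partition of $3p$ whose $p$-core is empty (the $p$-core is obtained by successively removing rim $p$-hooks as long as possible). For a node $(i,j)$ of the Young diagram of $\lambda$ let $h_\lambda(i,j)$ be its hook length and $\nu_p(h_\lambda(i,j))$ the exponent of $p$ in it. Call $\lambda$ a $p$-JM partition if, whenever $\nu_p(h_\lambda(i,j))>0$, either the numbers $\nu_p(h_\lambda(i,j'))$ over all nodes $(i,j')$ of row $i$ are all equal, or the numbers $\nu_p(h_\lambda(i',j))$ over all nodes $(i',j)$ of column $j$ are all equal. Then 1. $\lambda$ is a $p$-JM partition if and only if $\lambda=(3p)$ or $\lambda=(1^{3p})$. Moreover, let $F$ be any field of characteristic $p$, and let $S^\lambda$ be the Specht module of $F\Sigma_{3p}$, i.e. the submodule of the permutation module $M^\lambda$ on $\lambda$-tabloids generated by the polytabloids. Let the Loewy length of a module $M$ be the least $k$ with $\operatorname{rad}^k M=0$. Then 2. $S^\lambda$ is irreducible if and only if $\lambda=(3p)$ or $\lambda=(1^{3p})$; 3. $S^\lambda$ has Loewy length $1$ if and only if $\lambda=(3p)$ or $\lambda=(1^{3p})$; 4.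 if $\lambda=(3p)$, then $S^\lambda$ is isomorphic to the trivial module $F$, and if $\lambda=(1^{3p})$, then $S^\lambda$ is isomorphic to the sign module. -/

import Mathlib

/-! Partitions are identified with their Young diagrams (`YoungDiagram`); nodes `(i, j)` are
indexed from `0`, with `i` the row and `j` the column. -/

/-! ### Hook lengths and `p`-JM partitions -/

/-- The hook length at the node `(i, j)`: arm plus leg plus one. -/
def YoungDiagram.hookLength (lam : YoungDiagram) (i j : ℕ) : ℕ :=
  (lam.rowLen i - (j + 1)) + (lam.colLen j - (i + 1)) + 1

/-- The `(i, j)` entry of the `p`-power diagram: the exponent of `p` in the hook length. -/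
def YoungDiagram.powerEntry (p : ℕ) (lam : YoungDiagram) (i j : ℕ) : ℕ :=
  padicValNat p (lam.hookLength i j)

/-- `p`-JM partitions: whenever the entry of the `p`-power diagram at a node is positive, the
entries of its row are all equal or the entries of its column are all equal. -/
def YoungDiagram.IsJM (p : ℕ) (lam : YoungDiagram) : Prop :=
  ∀ i j : ℕ, (i, j) ∈ lam → 0 < lam.powerEntry p i j →
    (∀ j' : ℕ, (i, j') ∈ lam → lam.powerEntry p i j' = lam.powerEntry p i j) ∨
    (∀ i' : ℕ, (i', j) ∈ lam → lam.powerEntry p i' j = lam.powerEntry p i j)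

/-! ### Rim hooks and `p`-cores -/

/-- The rim of a partition: the nodes `(i, j)` such that `(i + 1, j + 1)` is not a node. -/
def YoungDiagram.rim (lam : YoungDiagram) : Finset (ℕ × ℕ) :=
  lam.cells.filter fun c => (c.1 + 1, c.2 + 1) ∉ lam.cells

/-- Two nodes are adjacent if they share an edge. -/
def NodeAdj (a b : ℕ × ℕ) : Prop :=
  (a.1 = b.1 ∧ (a.2 + 1 = b.2 ∨ b.2 + 1 = a.2)) ∨
  (a.2 = b.2 ∧ (a.1 + 1 = b.1 ∨ b.1 + 1 = a.1))

/-- Any two nodes of `h` are joined by a path of adjacent nodes inside `h`. -/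
def NodesConnected (h : Finset (ℕ × ℕ)) : Prop :=
  ∀ a ∈ h, ∀ b ∈ h,
    Relation.ReflTransGen (fun x y => x ∈ h ∧ y ∈ h ∧ NodeAdj x y) a b

/-- The partition `mu` is obtained from `lam` by removing one rim `p`-hook. -/
def RemovesRimHook (p : ℕ) (lam mu : YoungDiagram) : Prop :=
  ∃ h : Finset (ℕ × ℕ), h ⊆ lam.rim ∧ h.card = p ∧ NodesConnected h ∧
    mu.cells = lam.cells \ h

/-- `mu` is the `p`-core of `lam`: it is reached from `lam` by repeatedly removing rim `p`-hooks
and has no removable rim `p`-hook. -/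
def IsPCore (p : ℕ) (lam mu : YoungDiagram) : Prop :=
  Relation.ReflTransGen (RemovesRimHook p) lam mu ∧ ∀ nu, ¬ RemovesRimHook p mu nu

/-! ### Specht modules -/

/-- A tableau of shape `lam` with entries `Fin n`, each used exactly once. -/
@[ext]
structure Tableau (lam : YoungDiagram) (n : ℕ) where
  /-- the entry at each node -/
  entry : lam.cells ≃ Fin n

namespace Tableau

variable {lam : YoungDiagram} {n : ℕ}

/-- The row of the tableau that contains the entry `a`. -/
def rowOf (t : Tableau lam n) (a : Fin n) : ℕ := (t.entry.symm a).1.1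

/-- The column of the tableau that contains the entry `a`. -/
def colOf (t : Tableau lam n) (a : Fin n) : ℕ := (t.entry.symm a).1.2

/-- Permutations act on tableaux by permuting the entries. -/
instance : MulAction (Equiv.Perm (Fin n)) (Tableau lam n) where
  smul s t := ⟨t.entry.trans s⟩
  one_smul _ := rfl
  mul_smul _ _ _ := rfl

theorem rowOf_smul (s : Equiv.Perm (Fin n)) (t : Tableau lam n) (a : Fin n) :
    (s • t).rowOf a = t.rowOf (s⁻¹ a) := rfl

/-- Row equivalence: every entry lies in the same row of both tableaux. -/
instance rowSetoid (lam : YoungDiagram) (n : ℕ) : Setoid (Tableau lam n) where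
  r t u := ∀ a, t.rowOf a = u.rowOf a
  iseqv :=
    { refl := fun _ _ => rfl
      symm := fun h a => (h a).symm
      trans := fun h k a => (h a).trans (k a) }

/-- The column stabilizer of a tableau. -/
def colStab (t : Tableau lam n) : Subgroup (Equiv.Perm (Fin n)) where
  carrier := {s | ∀ a, t.colOf (s a) = t.colOf a}
  one_mem' := fun _ => rfl
  mul_mem' := fun {s u} hs hu a => (hs (u a)).trans (hu a)
  inv_mem' := fun {s} hs a => by
    have h := hs (s⁻¹ a)
    have e : s (s⁻¹ a) = a := s.apply_symm_apply a
    rw [e] at h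
    exact h.symm

end Tableau

/-- Tabloids of shape `lam`: row equivalence classes of tableaux. -/
def Tabloid (lam : YoungDiagram) (n : ℕ) : Type := Quotient (Tableau.rowSetoid lam n)

/-- The induced action of permutations on tabloids. -/
instance (lam : YoungDiagram) (n : ℕ) : MulAction (Equiv.Perm (Fin n)) (Tabloid lam n) where
  smul s := Quotient.map (fun t => s • t) fun _ _ h a => h (s⁻¹ a)
  one_smul x := Quotient.inductionOn x fun _ => rfl
  mul_smul _ _ x := Quotient.inductionOn x fun _ => rfl

/-- The tabloid of a tableau. -/
def Tableau.tabloid {lam : YoungDiagram} {n : ℕ} (t : Tableau lam n) : Tabloid lam n :=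
  Quotient.mk _ t

/-- The permutation module `M^lam` on the tabloids, as a module over the group algebra of the
symmetric group on `n` letters. -/
noncomputable abbrev TabloidModule (F : Type*) [Field F] (lam : YoungDiagram) (n : ℕ) : Type _ :=
  (Representation.ofMulAction F (Equiv.Perm (Fin n)) (Tabloid lam n)).asModule

open Classical in
/-- The polytabloid `e_t`: the signed sum of the tabloids of `s • t`, for `s` in the column
stabilizer of `t`. -/
noncomputable def polytabloid (F : Type*) [Field F] {lam : YoungDiagram} {n : ℕ}
    (t : Tableau lam n) : TabloidModule F lam n :=
  (Representation.asModuleEquiv _).symm <|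
    ∑ s : Equiv.Perm (Fin n) with s ∈ t.colStab,
      MonoidAlgebra.single (s • t).tabloid ((Equiv.Perm.sign s : ℤ) : F)

/-- The Specht module `S^lam`: the submodule of `M^lam` generated by the polytabloids. -/
noncomputable def spechtModule (F : Type*) [Field F] (lam : YoungDiagram) (n : ℕ) :
    Submodule (MonoidAlgebra F (Equiv.Perm (Fin n))) (TabloidModule F lam n) :=
  Submodule.span _ (Set.range (polytabloid F (lam := lam) (n := n)))

/-- The sign representation of the symmetric group on `n` letters. -/
noncomputable def signRepresentation (F : Type*) [Field F] (n : ℕ) :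
    Representation F (Equiv.Perm (Fin n)) F where
  toFun s := ((Equiv.Perm.sign s : ℤ) : F) • LinearMap.id
  map_one' := by ext; simp
  map_mul' s u := by ext; simp [mul_comm]

/-! ### Loewy length -/

/-- The radical series of a module: `rad^0 M = M` and `rad^(k+1) M = rad (rad^k M)`. -/
def radicalSeries (R M : Type*) [Ring R] [AddCommGroup M] [Module R M] : ℕ → Submodule R M
  | 0 => ⊤
  | k + 1 => (Module.jacobson R (radicalSeries R M k)).map (radicalSeries R M k).subtype

/-- The Loewy length of a module (of finite length): the least `k` with `rad^k M = 0`. -/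
noncomputable def loewyLength (R M : Type*) [Ring R] [AddCommGroup M] [Module R M] : ℕ :=
  sInf {k | radicalSeries R M k = ⊥}

/-! The Specht module is modelled as `garnir F l n`: functions on row assignments, supported on
content `l`, that satisfy Garnir relations. Away from characteristic 2 this space is exactly the
span of the polytabloids (`garnir_le_polySpan`, `nonempty_equiv_garnirRep`).

Simplicity forces self-duality. Every endomorphism of the Specht module is a scalar
(`exists_scalar_of_commute`), so if the module is simple, Jacobson density makes the group algebra
surject onto all linear endomorphisms. A permutation is conjugate to its inverse, so the module and
its dual have the same traces. Together these give an invariant nondegenerate bilinear form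
(`exists_invariant_form`).

Such a form descends along the branching rule. Filter the module by the row of the letter `0`: the
graded pieces embed in the Specht modules of the diagrams with one corner removed, and the
Jucys–Murphy element acts on each piece by the content of that corner. If the residue of this
content is shared by no other removable node, a polynomial in the Jucys–Murphy element cuts out the
piece as an eigenspace, and the form stays nondegenerate on it (`IsForm.comp_lift`). If two such
corners have adjacent residues and can be removed in either order, the swap of the two removed
letters relates the two orders by a degenerate Hecke relation. Eigenvalue orthogonality then makes
the restricted form vanish identically, a contradiction (`not_isForm_of_adjacent`).

It remains to reach such a pair of corners. In bead language, removing a node moves a bead down by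
one. An empty core and size `3 * p` leave three families of bead configurations (`exists_shape`),
and for all members except those of the one-row and one-column partitions an explicit chain of
unique moves leads to an obstruction (`Shape.bad`). The same list refutes the JM condition directly,
because hook lengths are differences between occupied and vacant positions
(`exists_column_of_vacant`).

For the two exceptional partitions the module is a line. Loewy length one means semisimple and
nonzero, which is simple because endomorphisms are scalars. -/

/-! ### Functions on row assignments -/

namespace RowFun

open Finset Equiv

/-- Functions on the maps that assign a row to every letter. -/
abbrev Fn (F : Type*) (n : ℕ) : Type _ := (Fin n → ℕ) → F

/-! ### Garnir relations and the action on row assignments -/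

section Basic

variable {F : Type*} [Field F] {n : ℕ}

/-- The action of a permutation of the letters. -/
def permMap (F : Type*) [Field F] {n : ℕ} (g : Perm (Fin n)) : Fn F n →ₗ[F] Fn F n :=
  LinearMap.funLeft F F fun r => r ∘ g

@[simp] theorem permMap_apply (g : Perm (Fin n)) (x : Fn F n) (r : Fin n → ℕ) :
    permMap F g x r = x (r ∘ g) := rfl

theorem permMap_mul (g h : Perm (Fin n)) (x : Fn F n) :
    permMap F (g * h) x = permMap F g (permMap F h x) := rfl

theorem permMap_one (x : Fn F n) : permMap F 1 x = x := rfl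

theorem permMap_swap_swap (a b : Fin n) (x : Fn F n) :
    permMap F (swap a b) (permMap F (swap a b) x) = x := by
  rw [← permMap_mul, swap_mul_self, permMap_one]

/-- Redistribute the letters of `P`: those of `Z` go to row `j`, the others to row `i`. -/
def spread (r : Fin n → ℕ) (i j : ℕ) (P Z : Finset (Fin n)) : Fin n → ℕ :=
  fun a => if a ∈ P then (if a ∈ Z then j else i) else r a

/-- The functions supported on the row assignments of content `l` that satisfy the Garnir
relations: more letters than fit into row `i` cannot be distributed over the rows `i` and `j`. -/
def garnir (F : Type*) [Field F] (l : ℕ → ℕ) (n : ℕ) : Submodule F (Fn F n) where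
  carrier := {x | (∀ r, x r ≠ 0 → ∀ i, #{a | r a = i} = l i) ∧
    ∀ i j, i < j → ∀ P : Finset (Fin n), #P = l i + 1 → ∀ r,
      ∑ Z ∈ P.powerset, x (spread r i j P Z) = 0}
  zero_mem' := by simp
  add_mem' := by
    rintro x y ⟨hx, hx'⟩ ⟨hy, hy'⟩
    refine ⟨fun r h => ?_, fun i j hij P hP r => ?_⟩
    · by_cases h0 : x r = 0
      · refine hy r fun h1 => h ?_
        simp [h0, h1]
      · exact hx r h0
    · simp only [Pi.add_apply, sum_add_distrib, hx' i j hij P hP r, hy' i j hij P hP r, add_zero]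
  smul_mem' := by
    rintro c x ⟨hx, hx'⟩
    refine ⟨fun r h => hx r fun h0 => h (by simp [h0]), fun i j hij P hP r => ?_⟩
    simp only [Pi.smul_apply, ← smul_sum, hx' i j hij P hP r, smul_zero]

variable {l : ℕ → ℕ}

theorem content_eq {x : Fn F n} (hx : x ∈ garnir F l n) {r : Fin n → ℕ} (h : x r ≠ 0) (i : ℕ) :
    #{a | r a = i} = l i := hx.1 r h i

theorem spread_comp (r : Fin n → ℕ) (i j : ℕ) (P Z : Finset (Fin n)) (g : Perm (Fin n)) :
    spread r i j P Z ∘ g =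
      spread (r ∘ g) i j (P.map g⁻¹.toEmbedding) (Z.map g⁻¹.toEmbedding) := by
  funext a
  have h (Q : Finset (Fin n)) : a ∈ Q.map g⁻¹.toEmbedding ↔ g a ∈ Q := by
    simp only [mem_map_equiv, ← Perm.inv_def, inv_inv]
  simp only [spread, Function.comp_apply, h]

theorem sum_powerset_map {M : Type*} [AddCommMonoid M] {α β : Type*} (e : α ↪ β) (P : Finset α)
    (f : Finset β → M) :
    ∑ Z ∈ (P.map e).powerset, f Z = ∑ Z ∈ P.powerset, f (Z.map e) := by
  classical
  have : (P.map e).powerset = P.powerset.map (mapEmbedding e).toEmbedding := by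
    ext Z
    simp only [mem_powerset, mem_map, RelEmbedding.coe_toEmbedding, mapEmbedding_apply]
    constructor
    · intro h
      obtain ⟨t, ht, rfl⟩ := subset_map_iff.mp h
      exact ⟨t, ht, rfl⟩
    · rintro ⟨t, ht, rfl⟩
      exact map_subset_map.mpr ht
  rw [this, sum_map]
  rfl

theorem permMap_mem (g : Perm (Fin n)) {x : Fn F n} (hx : x ∈ garnir F l n) :
    permMap F g x ∈ garnir F l n := by
  refine ⟨fun r h i => ?_, fun i j hij P hP r => ?_⟩
  · rw [← content_eq hx h i]
    refine (card_equiv g ?_).symm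
    simp
  · simp only [permMap_apply, spread_comp]
    rw [← sum_powerset_map g⁻¹.toEmbedding P fun Z => x (spread (r ∘ g) i j _ Z)]
    exact hx.2 i j hij _ (by simpa using hP) _

end Basic

/-! ### The filtration by the row of the letter `0` -/

section Corner

variable {F : Type*} [Field F] {n : ℕ} {l : ℕ → ℕ}

/-- The elements supported where the letter `0` is in a row above row `k`. -/
def above (F : Type*) [Field F] (l : ℕ → ℕ) (n k : ℕ) : Submodule F (Fn F (n + 1)) where
  carrier := {x | x ∈ garnir F l (n + 1) ∧ ∀ r, k ≤ r 0 → x r = 0}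
  zero_mem' := ⟨zero_mem _, fun _ _ => rfl⟩
  add_mem' := fun {x y} hx hy => ⟨add_mem hx.1 hy.1, fun r h => by simp [hx.2 r h, hy.2 r h]⟩
  smul_mem' := fun c x hx => ⟨Submodule.smul_mem _ c hx.1, fun r h => by simp [hx.2 r h]⟩

theorem above_zero {x : Fn F (n + 1)} (hx : x ∈ above F l n 0) : x = 0 :=
  funext fun r => hx.2 r (Nat.zero_le _)

theorem mem_above_of_eq_zero {M : ℕ} (hM : ∀ i, M ≤ i → l i = 0) {x : Fn F (n + 1)}
    (hx : x ∈ garnir F l (n + 1)) : x ∈ above F l n M := by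
  refine ⟨hx, fun r h => ?_⟩
  by_contra h0
  have h1 := content_eq hx h0 (r 0)
  rw [hM _ h, card_eq_zero] at h1
  exact (notMem_empty (0 : Fin (n + 1))) (h1 ▸ mem_filter.mpr ⟨mem_univ _, rfl⟩)

/-- Row lengths after removal of the last node of row `k`. -/
def cut (l : ℕ → ℕ) (k : ℕ) : ℕ → ℕ := Function.update l k (l k - 1)

/-- Restriction to the row assignments with the letter `0` in row `k`. -/
def corner (F : Type*) [Field F] (n k : ℕ) : Fn F (n + 1) →ₗ[F] Fn F n :=
  LinearMap.funLeft F F fun r => Fin.cons k r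

@[simp] theorem corner_apply (k : ℕ) (x : Fn F (n + 1)) (r : Fin n → ℕ) :
    corner F n k x r = x (Fin.cons k r) := rfl

theorem mem_above_of_corner_eq_zero {k : ℕ} {x : Fn F (n + 1)} (hx : x ∈ above F l n (k + 1))
    (h : corner F n k x = 0) : x ∈ above F l n k := by
  refine ⟨hx.1, fun r hr => ?_⟩
  rcases hr.eq_or_lt with h0 | h0
  · have := congrFun h (Fin.tail r)
    rwa [corner_apply, h0, Fin.cons_self_tail] at this
  · exact hx.2 r h0

theorem spread_cons (k : ℕ) (r : Fin n → ℕ) (i j : ℕ) (P Z : Finset (Fin n)) :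
    spread (Fin.cons k r : Fin (n + 1) → ℕ) i j (P.map (Fin.succEmb n)) (Z.map (Fin.succEmb n)) =
      Fin.cons k (spread r i j P Z) := by
  funext a
  refine Fin.cases ?_ (fun b => ?_) a
  · simp [spread]
  · simp [spread]

theorem spread_insert_zero (k : ℕ) (r : Fin n → ℕ) (i j : ℕ) (P Z : Finset (Fin n)) :
    spread (Fin.cons k r : Fin (n + 1) → ℕ) i j (insert 0 (P.map (Fin.succEmb n)))
      (Z.map (Fin.succEmb n)) = Fin.cons i (spread r i j P Z) := by
  funext a
  refine Fin.cases ?_ (fun b => ?_) a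
  · simp [spread]
  · simp [spread]

/-- A Garnir relation for the shortened row `k` comes from one for the full row by adding the letter
`0` to `P`. The extra terms put `0` below row `k`, where `x` vanishes. Relations for the other rows
lift unchanged. -/
theorem corner_mem {k : ℕ} (hk : 0 < l k) {x : Fn F (n + 1)} (hx : x ∈ above F l n (k + 1)) :
    corner F n k x ∈ garnir F (cut l k) n := by
  refine ⟨fun r h i => ?_, fun i j hij P hP r => ?_⟩
  · have h1 := content_eq hx.1 h i
    rw [Fin.card_filter_univ_succ] at h1
    simp only [Fin.cons_zero, Fin.cons_succ] at h1
    by_cases hi : i = k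
    · subst hi
      simp only [cut, Function.update_self]
      simp only [if_true] at h1
      omega
    · rw [if_neg (Ne.symm hi)] at h1
      simpa [cut, hi] using h1
  · by_cases hi : i = k
    · subst hi
      have h0 : (0 : Fin (n + 1)) ∉ P.map (Fin.succEmb n) := by simp
      have hc : #(insert 0 (P.map (Fin.succEmb n))) = l i + 1 := by
        rw [card_insert_of_notMem h0, card_map, hP]
        simp only [cut, Function.update_self]
        omega
      have h1 := hx.1.2 i j hij _ hc (Fin.cons i r)
      rw [sum_powerset_insert h0, sum_powerset_map, sum_powerset_map,
        sum_eq_zero (s := P.powerset) (f := fun Z => x (spread (Fin.cons i r) i j _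
          (insert 0 (Z.map (Fin.succEmb n))))), add_zero] at h1
      · simpa only [spread_insert_zero, corner_apply] using h1
      · intro Z _
        refine hx.2 _ ?_
        simp only [spread, mem_insert, true_or, if_true]
        omega
    · have hc : #(P.map (Fin.succEmb n)) = l i + 1 := by
        rw [card_map, hP]
        simp [cut, hi]
      have h1 := hx.1.2 i j hij _ hc (Fin.cons k r)
      rw [sum_powerset_map] at h1
      simpa only [spread_cons, corner_apply] using h1

/-- If `0` lies in row `k`, apply the relation for rows `k` and `k + 1` to `0` together with the
letters of row `k + 1`. Terms moving `0` down vanish by the filtration, and among the others the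
content leaves only the original assignment. So row `k` contributes no graded piece. -/
theorem mem_above_of_not_removable {k : ℕ} (hk : l (k + 1) = l k) {x : Fn F (n + 1)}
    (hx : x ∈ above F l n (k + 1)) : x ∈ above F l n k := by
  refine ⟨hx.1, fun r hr => ?_⟩
  rcases hr.eq_or_lt with h0 | h0
  swap
  · exact hx.2 r h0
  by_contra hne
  have hcont := content_eq hx.1 hne
  set Q : Finset (Fin (n + 1)) := univ.filter fun a => r a = k + 1 with hQ
  have hQ0 : (0 : Fin (n + 1)) ∉ Q := by simp [hQ, ← h0]
  have h1 := hx.1.2 k (k + 1) (Nat.lt_succ_self k) (insert 0 Q)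
    (by rw [card_insert_of_notMem hQ0, hcont, hk]) r
  rw [sum_powerset_insert hQ0] at h1
  have h2 : ∑ Z ∈ Q.powerset, x (spread r k (k + 1) (insert 0 Q) (insert 0 Z)) = 0 :=
    sum_eq_zero fun Z _ => hx.2 _ (by simp [spread])
  rw [h2, add_zero, sum_eq_single_of_mem Q (by simp)] at h1
  · refine hne ?_
    rw [← h1]
    congr 1
    funext a
    simp only [spread, mem_insert]
    by_cases ha : a ∈ Q
    · simp [ha, (mem_filter.mp ha).2]
    · by_cases ha0 : a = 0
      · simp [ha0, hQ0, ← h0]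
      · simp [ha, ha0]
  · intro Z hZ hZQ
    by_contra h3
    have h4 := content_eq hx.1 h3 (k + 1)
    have h5 : (univ.filter fun a => spread r k (k + 1) (insert 0 Q) Z a = k + 1) = Z := by
      have hZ' := mem_powerset.mp hZ
      ext a
      simp only [mem_filter, mem_univ, true_and, spread, mem_insert]
      by_cases ha : a ∈ Z
      · simp [ha, hZ' ha]
      · by_cases haQ : a = 0 ∨ a ∈ Q
        · simp [ha, haQ]
        · have : r a ≠ k + 1 := fun h => haQ (Or.inr (by simp [hQ, h]))
          simp [ha, haQ, this]
    rw [h5, ← hcont (k + 1)] at h4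
    exact hZQ (eq_of_subset_of_card_le (mem_powerset.mp hZ) h4.ge)

end Corner

end RowFun

namespace RowFun

open Finset Equiv

/-! ### The Jucys–Murphy element is triangular with the contents as eigenvalues -/

section JucysMurphy

variable {F : Type*} [Field F] {n : ℕ} {l : ℕ → ℕ}

/-- The Jucys–Murphy element of the letter `0`. -/
def jm (F : Type*) [Field F] (n : ℕ) : Fn F (n + 1) →ₗ[F] Fn F (n + 1) :=
  ∑ a : Fin n, permMap F (swap 0 a.succ)

theorem jm_apply (x : Fn F (n + 1)) (r : Fin (n + 1) → ℕ) :
    jm F n x r = ∑ a : Fin n, x (r ∘ swap 0 a.succ) := by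
  simp [jm, LinearMap.sum_apply, Finset.sum_apply]

theorem jm_mem {x : Fn F (n + 1)} (hx : x ∈ garnir F l (n + 1)) :
    jm F n x ∈ garnir F l (n + 1) := by
  rw [jm, LinearMap.sum_apply]
  exact sum_mem fun a _ => permMap_mem _ hx

/-- The bead of row `k`, which is the content of the last node of the row. -/
def bead (l : ℕ → ℕ) (k : ℕ) : ℤ := (l k : ℤ) - k - 1

theorem card_row_comp (r : Fin n → ℕ) (g : Perm (Fin n)) (i : ℕ) :
    #{a | (r ∘ g) a = i} = #{a | r a = i} :=
  card_equiv g (by simp)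

/-- This is the Garnir relation for `0` together with the letters of row `i`. The content forces
exactly one letter to leave for the row of `0`: either `0` itself, giving `x r`, or a letter `b`,
giving the swap of `0` and `b`. -/
theorem sum_swap_row {x : Fn F (n + 1)} (hx : x ∈ garnir F l (n + 1)) {r : Fin (n + 1) → ℕ}
    (hr : ∀ i, #{a | r a = i} = l i) {i : ℕ} (hi : i < r 0) :
    ∑ a : Fin n with r a.succ = i, x (r ∘ swap 0 a.succ) = -x r := by
  set Q : Finset (Fin (n + 1)) := univ.filter fun a => r a = i with hQ
  have hQ0 : (0 : Fin (n + 1)) ∉ Q := by simp [hQ, hi.ne']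
  have hP : #(insert 0 Q) = l i + 1 := by rw [card_insert_of_notMem hQ0, hr]
  have h1 := hx.2 i (r 0) hi (insert 0 Q) hP r
  have h2 : ∑ Z ∈ (insert 0 Q).powersetCard 1, x (spread r i (r 0) (insert 0 Q) Z) = 0 := by
    rw [← h1]
    refine sum_subset (fun Z hZ => mem_powerset.mpr (mem_powersetCard.mp hZ).1) fun Z hZ hZ1 => ?_
    by_contra h3
    have hZP := mem_powerset.mp hZ
    have h4 := content_eq hx h3 i
    have h5 : (univ.filter fun a => spread r i (r 0) (insert 0 Q) Z a = i) = insert 0 Q \ Z := by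
      ext a
      rw [mem_filter, mem_sdiff, spread]
      by_cases ha : a ∈ insert 0 Q
      · rw [if_pos ha]
        by_cases haZ : a ∈ Z
        · rw [if_pos haZ]
          exact ⟨fun h => absurd h.2 hi.ne', fun h => absurd haZ h.2⟩
        · rw [if_neg haZ]
          exact ⟨fun _ => ⟨ha, haZ⟩, fun _ => ⟨mem_univ _, rfl⟩⟩
      · rw [if_neg ha]
        exact ⟨fun h => absurd (mem_insert_of_mem (by simp [hQ, h.2])) ha, fun h => absurd h.1 ha⟩
    rw [h5, card_sdiff_of_subset hZP, hP] at h4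
    have := card_le_card hZP
    exact hZ1 (mem_powersetCard.mpr ⟨hZP, by omega⟩)
  rw [powersetCard_one, sum_map] at h2
  have h3 (b) (hb : b ∈ insert 0 Q) :
      spread r i (r 0) (insert 0 Q) {b} = r ∘ swap 0 b := by
    funext a
    simp only [spread, Function.comp_apply, mem_singleton]
    by_cases hab : a = b
    · subst hab
      simp [hb]
    · by_cases ha0 : a = 0
      · subst ha0
        have : r b = i := by
          rcases mem_insert.mp hb with h | h
          · exact absurd h.symm hab
          · simpa [hQ] using h
        simp [hab, this]
      · rw [swap_apply_of_ne_of_ne ha0 hab]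
        by_cases haQ : a ∈ Q
        · have : r a = i := by simpa [hQ] using haQ
          simp [haQ, hab, this]
        · simp [haQ, ha0]
  simp only [Function.Embedding.coeFn_mk] at h2
  rw [sum_congr rfl fun b hb => by rw [h3 b hb], sum_insert hQ0, hQ, sum_filter,
    Fin.sum_univ_succ] at h2
  rw [sum_filter]
  simp only [hi.ne', if_false, swap_self, zero_add] at h2
  exact eq_neg_of_add_eq_zero_right h2

/-- With `0` in row `k`, swaps with the other `l k - 1` letters of the row fix the assignment, each
of the `k` rows above contributes `-1` by `sum_swap_row`, and rows below contribute nothing. The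
total is the content `l k - 1 - k`. -/
theorem jm_sub_mem_above {k : ℕ} {x : Fn F (n + 1)} (hx : x ∈ above F l n (k + 1)) :
    jm F n x - (bead l k : F) • x ∈ above F l n k := by
  refine ⟨sub_mem (jm_mem hx.1) (Submodule.smul_mem _ _ hx.1), fun r hr => ?_⟩
  rw [Pi.sub_apply, Pi.smul_apply, jm_apply, smul_eq_mul, sub_eq_zero]
  by_cases hc : ∀ i, #{a | r a = i} = l i
  swap
  · push Not at hc
    obtain ⟨i, hi⟩ := hc
    have h0 (g : Perm (Fin (n + 1))) : x (r ∘ g) = 0 := by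
      by_contra h
      exact hi (by rw [← content_eq hx.1 h i, card_row_comp])
    have h1 : x r = 0 := h0 1
    rw [h1, mul_zero]
    exact sum_eq_zero fun a _ => h0 _
  have h1 : ∑ a : Fin n, x (r ∘ swap 0 a.succ) =
      ∑ a : Fin n with r a.succ < k + 1, x (r ∘ swap 0 a.succ) := by
    rw [sum_filter]
    refine sum_congr rfl fun a _ => ?_
    split_ifs with h
    · rfl
    · exact hx.2 _ (by simpa using h)
  rw [h1, ← sum_fiberwise_of_maps_to (t := range (k + 1)) (g := fun a : Fin n => r a.succ)
    (by simp)]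
  have h2 (i) (hi : i ∈ range (k + 1)) :
      ∑ a ∈ univ.filter (fun a : Fin n => r a.succ < k + 1) with r a.succ = i,
        x (r ∘ swap 0 a.succ) = ∑ a : Fin n with r a.succ = i, x (r ∘ swap 0 a.succ) := by
    rw [filter_filter]
    congr 1
    ext a
    have := mem_range.mp hi
    simp only [mem_filter, mem_univ, true_and]
    constructor
    · exact fun h => h.2
    · exact fun h => ⟨by omega, h⟩
  rw [sum_congr rfl h2]
  rcases hr.eq_or_lt with h0 | h0
  · rw [sum_range_succ, sum_congr rfl fun i hi => sum_swap_row hx.1 hc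
      (h0 ▸ mem_range.mp hi : i < r 0)]
    have h3 : ∑ a : Fin n with r a.succ = k, x (r ∘ swap 0 a.succ) = ((l k - 1 : ℤ) : F) * x r := by
      rw [sum_congr rfl fun a ha => ?_, sum_const, nsmul_eq_mul]
      rotate_left
      · exact x r
      · congr 1
        have h4 := (mem_filter.mp ha).2
        funext b
        simp only [Function.comp_apply]
        by_cases hb0 : b = 0
        · rw [hb0, swap_apply_left, h4, h0]
        · by_cases hba : b = a.succ
          · rw [hba, swap_apply_right, h4, h0]
          · rw [swap_apply_of_ne_of_ne hb0 hba]
      · congr 1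
        have h5 := hc k
        rw [Fin.card_filter_univ_succ, if_pos h0.symm] at h5
        have h6 : (l k : ℤ) - 1 = #{a : Fin n | r a.succ = k} := by
          rw [← h5]
          push_cast
          simp
        rw [h6, Int.cast_natCast]
    rw [h3, sum_const, card_range, bead]
    push_cast
    rw [nsmul_eq_mul]
    ring
  · rw [hx.2 r h0, mul_zero]
    refine sum_eq_zero fun i hi => ?_
    have := mem_range.mp hi
    rw [sum_swap_row hx.1 hc (by omega), hx.2 r h0, neg_zero]

end JucysMurphy

/-! ### Polytabloids span the solutions of the Garnir relations -/

section Polytabloid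

variable {F : Type*} [Field F] {n : ℕ} {l : ℕ → ℕ}

/-- `R` and `C` are the row and the column of the letters of a tableau with row lengths `l`. -/
structure IsTableau (l : ℕ → ℕ) {n : ℕ} (R C : Fin n → ℕ) : Prop where
  inj : ∀ a b, R a = R b → C a = C b → a = b
  lt : ∀ a, C a < l (R a)
  surj : ∀ i j, j < l i → ∃ a, R a = i ∧ C a = j

/-- The polytabloid of a tableau, as a function on row assignments. -/
def polyFun (F : Type*) [Field F] (R C : Fin n → ℕ) : Fn F n := fun r =>
  ∑ s : Perm (Fin n), if (∀ a, C (s a) = C a) ∧ ∀ a, R (s a) = r a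
    then ((Perm.sign s : ℤ) : F) else 0

theorem permMap_polyFun (R C : Fin n → ℕ) (g : Perm (Fin n)) :
    permMap F g (polyFun F R C) = polyFun F (R ∘ ⇑g⁻¹) (C ∘ ⇑g⁻¹) := by
  funext r
  rw [permMap_apply]
  refine sum_equiv (MulAut.conj g).toEquiv (by simp) fun s _ => ?_
  have h1 : Perm.sign ((MulAut.conj g).toEquiv s) = Perm.sign s := by
    change Perm.sign (g * s * g⁻¹) = _
    rw [Perm.sign_mul, Perm.sign_mul, Perm.sign_inv, mul_right_comm, Int.units_mul_self, one_mul]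
  rw [h1]
  have h2 (a : Fin n) : (MulAut.conj g).toEquiv s a = g (s (g⁻¹ a)) := rfl
  refine if_congr (and_congr ?_ ?_) rfl rfl
  · simp only [h2, Function.comp_apply, Perm.coe_inv, symm_apply_apply]
    exact ⟨fun h a => h _, fun h a => by simpa using h (g a)⟩
  · simp only [h2, Function.comp_apply, Perm.coe_inv, symm_apply_apply]
    exact ⟨fun h a => by simpa using h (g⁻¹ a), fun h a => by simpa using h (g a)⟩

theorem polyFun_comp {R C : Fin n → ℕ} {c : Perm (Fin n)} (hc : ∀ a, C (c a) = C a)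
    (r : Fin n → ℕ) : polyFun F R C (r ∘ c) = ((Perm.sign c : ℤ) : F) * polyFun F R C r := by
  rw [polyFun, polyFun, mul_sum]
  refine sum_equiv (Equiv.mulRight c⁻¹) (by simp) fun s _ => ?_
  have h3 (a) : C (c⁻¹ a) = C a := by
    have := hc (c⁻¹ a)
    rw [Perm.coe_inv, apply_symm_apply] at this
    exact this.symm
  rw [mul_ite, mul_zero]
  refine if_congr (and_congr ?_ ?_) ?_ rfl
  · simp only [coe_mulRight, Perm.mul_apply]
    exact ⟨fun h a => by rw [h, h3], fun h a => by simpa [hc] using h (c a)⟩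
  · simp only [coe_mulRight, Perm.mul_apply, Function.comp_apply]
    exact ⟨fun h a => by simpa using h (c⁻¹ a), fun h a => by simpa using h (c a)⟩
  · simp only [coe_mulRight, Perm.sign_mul, Perm.sign_inv]
    rw [← Int.cast_mul, ← Units.val_mul, mul_comm (Perm.sign s), ← mul_assoc, Int.units_mul_self,
      one_mul]

theorem exists_of_polyFun_ne_zero {R C r : Fin n → ℕ} (h : polyFun F R C r ≠ 0) :
    ∃ s : Perm (Fin n), (∀ a, C (s a) = C a) ∧ ∀ a, R (s a) = r a := by
  obtain ⟨s, -, hs⟩ := exists_ne_zero_of_sum_ne_zero h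
  exact ⟨s, by by_contra h1; exact hs (if_neg h1)⟩

theorem IsTableau.polyFun_comp_self {R C : Fin n → ℕ} (h : IsTableau l R C) {s : Perm (Fin n)}
    (hs : ∀ a, C (s a) = C a) : polyFun F R C (R ∘ s) = ((Perm.sign s : ℤ) : F) := by
  rw [polyFun, sum_eq_single s]
  · rw [if_pos ⟨hs, fun a => rfl⟩]
  · intro u _ hu
    refine if_neg fun h1 => hu (Equiv.ext fun a => h.inj _ _ (h1.2 a) ?_)
    rw [h1.1, hs]
  · simp

theorem IsTableau.polyFun_self {R C : Fin n → ℕ} (h : IsTableau l R C) :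
    polyFun F R C R = 1 := by
  simpa using h.polyFun_comp_self (F := F) (s := 1) fun _ => rfl

theorem IsTableau.card_row {R C : Fin n → ℕ} (h : IsTableau l R C) (i : ℕ) :
    #{a | R a = i} = l i := by
  rw [← card_range (l i)]
  refine card_bij (fun a _ => C a) ?_ ?_ ?_
  · intro a ha
    rw [← (mem_filter.mp ha).2]
    exact mem_range.mpr (h.lt a)
  · intro a ha b hb hab
    exact h.inj a b ((mem_filter.mp ha).2.trans (mem_filter.mp hb).2.symm) hab
  · intro j hj
    obtain ⟨a, h1, h2⟩ := h.surj i j (mem_range.mp hj)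
    exact ⟨a, by simp [h1], h2⟩

/-- In a nonzero term the letters of `P` occupy columns among the first `l i`, so two of the `l i +
1` letters share a column. Swapping these two permutes the terms of the sum and changes its sign,
and 2 is invertible. -/
theorem IsTableau.polyFun_mem (h2 : (2 : F) ≠ 0) (hl : Antitone l) {R C : Fin n → ℕ}
    (h : IsTableau l R C) : polyFun F R C ∈ garnir F l n := by
  refine ⟨fun r hr i => ?_, fun i j hij P hP r => ?_⟩
  · obtain ⟨s, -, hs⟩ := exists_of_polyFun_ne_zero hr
    rw [← h.card_row i, ← card_row_comp R s]
    simp [hs]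
  · by_contra hne
    obtain ⟨Z, hZ, hZne⟩ := exists_ne_zero_of_sum_ne_zero hne
    obtain ⟨s, hs1, hs2⟩ := exists_of_polyFun_ne_zero hZne
    have hmaps : ∀ a ∈ P, C a ∈ range (l i) := by
      intro a ha
      rw [mem_range, ← hs1 a]
      refine (h.lt (s a)).trans_le (hl ?_)
      rw [hs2 a, spread, if_pos ha]
      split_ifs <;> omega
    obtain ⟨c, hc, d, hd, hcd, hcol⟩ :=
      exists_ne_map_eq_of_card_lt_of_maps_to (by rw [card_range, hP]; omega) hmaps
    have hsw (a) : C (swap c d a) = C a := by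
      by_cases h1 : a = c
      · rw [h1, swap_apply_left, hcol]
      · by_cases h2 : a = d
        · rw [h2, swap_apply_right, hcol]
        · rw [swap_apply_of_ne_of_ne h1 h2]
    have hPm : P.map (swap c d)⁻¹.toEmbedding = P := by
      ext a
      rw [mem_map_equiv, ← Perm.inv_def, inv_inv]
      by_cases h1 : a = c
      · rw [h1, swap_apply_left]; exact ⟨fun _ => hc, fun _ => hd⟩
      · by_cases h2 : a = d
        · rw [h2, swap_apply_right]; exact ⟨fun _ => hd, fun _ => hc⟩
        · rw [swap_apply_of_ne_of_ne h1 h2]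
    have hr (Z) : spread (r ∘ swap c d) i j P Z = spread r i j P Z := by
      funext a
      by_cases ha : a ∈ P
      · simp [spread, ha]
      · have h1 : a ≠ c := fun h => ha (h ▸ hc)
        have h2 : a ≠ d := fun h => ha (h ▸ hd)
        simp [spread, ha, swap_apply_of_ne_of_ne h1 h2]
    have h3 : ∑ Z ∈ P.powerset, polyFun F R C (spread r i j P Z) =
        -∑ Z ∈ P.powerset, polyFun F R C (spread r i j P Z) := by
      conv_lhs => rw [← hPm, sum_powerset_map, hPm]
      rw [← sum_neg_distrib]
      refine sum_congr rfl fun Z _ => ?_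
      have h4 := spread_comp r i j P Z (swap c d)
      rw [hPm, hr] at h4
      rw [← h4, polyFun_comp hsw, Perm.sign_swap hcd]
      simp
    refine hne ?_
    have h5 : (2 : F) * ∑ Z ∈ P.powerset, polyFun F R C (spread r i j P Z) = 0 := by
      rw [two_mul]
      nth_rewrite 1 [h3]
      exact neg_add_cancel _
    exact (mul_eq_zero.mp h5).resolve_left h2

theorem IsTableau.cons {k : ℕ} (hk : l (k + 1) < l k) {R C : Fin n → ℕ}
    (h : IsTableau (cut l k) R C) :
    IsTableau l (Fin.cons k R : Fin (n + 1) → ℕ) (Fin.cons (l k - 1) C : Fin (n + 1) → ℕ) := by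
  have hlt (a) : C a < l (R a) ∧ ¬ (R a = k ∧ C a = l k - 1) := by
    have := h.lt a
    by_cases hR : R a = k
    · rw [hR, cut, Function.update_self] at this
      rw [hR]
      omega
    · rw [cut, Function.update_of_ne hR] at this
      exact ⟨this, fun h => hR h.1⟩
  refine ⟨fun a b => ?_, fun a => ?_, fun i j hij => ?_⟩
  · refine Fin.cases ?_ (fun a => ?_) a <;> refine Fin.cases ?_ (fun b => ?_) b
    · simp
    · simp only [Fin.cons_zero, Fin.cons_succ]
      exact fun h1 h2 => absurd ⟨h1.symm, h2.symm⟩ (hlt b).2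
    · simp only [Fin.cons_zero, Fin.cons_succ]
      exact fun h1 h2 => absurd ⟨h1, h2⟩ (hlt a).2
    · simp only [Fin.cons_succ]
      exact fun h1 h2 => congrArg Fin.succ (h.inj a b h1 h2)
  · refine Fin.cases ?_ (fun a => ?_) a
    · simp only [Fin.cons_zero]
      omega
    · simp only [Fin.cons_succ]
      exact (hlt a).1
  · by_cases h1 : i = k ∧ j = l k - 1
    · exact ⟨0, by simp [h1]⟩
    · obtain ⟨a, ha⟩ := h.surj i j (by
        by_cases hi : i = k
        · subst hi
          rw [cut, Function.update_self]
          omega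
        · rwa [cut, Function.update_of_ne hi])
      exact ⟨a.succ, by simpa using ha⟩

/-- A column permutation that contributes with `0` in row `k` must send `0` to the node of `0`,
hence fix it. What remains is the column stabilizer of the smaller tableau. -/
theorem corner_polyFun {k : ℕ} (hk : l (k + 1) < l k) {R C : Fin n → ℕ}
    (h : IsTableau (cut l k) R C) :
    corner F n k (polyFun F (Fin.cons k R : Fin (n + 1) → ℕ)
      (Fin.cons (l k - 1) C : Fin (n + 1) → ℕ)) = polyFun F R C := by
  funext r
  rw [corner_apply, polyFun, polyFun, ← Perm.decomposeFin.symm.sum_comp, Fintype.sum_prod_type,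
    sum_eq_single 0]
  · refine sum_congr rfl fun s _ => ?_
    refine if_congr (and_congr ?_ ?_) (by simp) rfl
    · simp [Fin.forall_fin_succ]
    · simp [Fin.forall_fin_succ]
  · intro p _ hp
    refine sum_eq_zero fun s _ => if_neg fun h1 => hp ?_
    refine (h.cons hk).inj _ _ ?_ ?_
    · have := h1.2 0
      rwa [Perm.decomposeFin_symm_apply_zero] at this
    · have := h1.1 0
      rwa [Perm.decomposeFin_symm_apply_zero] at this
  · simp

theorem polyFun_cons_mem_above (h2 : (2 : F) ≠ 0) (hl : Antitone l) {k : ℕ} (hk : l (k + 1) < l k)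
    {R C : Fin n → ℕ} (h : IsTableau (cut l k) R C) :
    polyFun F (Fin.cons k R : Fin (n + 1) → ℕ) (Fin.cons (l k - 1) C : Fin (n + 1) → ℕ) ∈
      above F l n (k + 1) := by
  refine ⟨(h.cons hk).polyFun_mem h2 hl, fun r hr => ?_⟩
  by_contra hne
  obtain ⟨s, hs1, hs2⟩ := exists_of_polyFun_ne_zero hne
  have h3 := (h.cons hk).lt (s 0)
  rw [hs1 0, hs2 0, Fin.cons_zero] at h3
  have := hl hr
  omega

theorem antitone_cut (hl : Antitone l) {k : ℕ} (hk : l (k + 1) < l k) : Antitone (cut l k) := by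
  refine antitone_nat_of_succ_le fun i => ?_
  have h1 : l (i + 1) ≤ l i := hl (Nat.le_succ i)
  change cut l k (i + 1) ≤ cut l k i
  by_cases hi : i = k
  · subst hi
    simp only [cut, Function.update_self, Function.update_of_ne (Nat.succ_ne_self i : i + 1 ≠ i)]
    change l (i + 1) ≤ l i - 1
    omega
  · by_cases hi' : i + 1 = k
    · subst hi'
      simp only [cut, Function.update_self, Function.update_of_ne hi]
      omega
    · simpa only [cut, Function.update_of_ne hi, Function.update_of_ne hi'] using h1

theorem cut_eq_zero {M : ℕ} (hM : ∀ i, M ≤ i → l i = 0) (k : ℕ) :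
    ∀ i, M ≤ i → cut l k i = 0 := by
  intro i hi
  by_cases h : i = k
  · subst h
    simp [cut, hM i hi]
  · rw [cut, Function.update_of_ne h, hM i hi]

/-- The span of the polytabloids. -/
def polySpan (F : Type*) [Field F] (l : ℕ → ℕ) (n : ℕ) : Submodule F (Fn F n) :=
  Submodule.span F {x | ∃ R C, IsTableau l R C ∧ x = polyFun F R C}

theorem exists_lift_of_mem_polySpan (h2 : (2 : F) ≠ 0) (hl : Antitone l) {k : ℕ}
    (hk : l (k + 1) < l k) {z : Fn F n} (hz : z ∈ polySpan F (cut l k) n) :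
    ∃ y ∈ polySpan F l (n + 1), y ∈ above F l n (k + 1) ∧ corner F n k y = z := by
  induction hz using Submodule.span_induction with
  | mem z hz =>
    obtain ⟨R, C, h, rfl⟩ := hz
    exact ⟨_, Submodule.subset_span ⟨_, _, h.cons hk, rfl⟩, polyFun_cons_mem_above h2 hl hk h,
      corner_polyFun hk h⟩
  | zero => exact ⟨0, zero_mem _, zero_mem _, map_zero _⟩
  | add x y _ _ hx hy =>
    obtain ⟨x', h1, h3, rfl⟩ := hx
    obtain ⟨y', h4, h5, rfl⟩ := hy
    exact ⟨x' + y', add_mem h1 h4, add_mem h3 h5, map_add _ _ _⟩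
  | smul c x _ hx =>
    obtain ⟨x', h1, h3, rfl⟩ := hx
    exact ⟨c • x', Submodule.smul_mem _ _ h1, Submodule.smul_mem _ _ h3, map_smul _ _ _⟩

/-- Double induction on the number of letters and on the filtration. The corner of an element is a
combination of smaller polytabloids, which lift by placing `0` at the end of row `k`. Subtracting
the lift moves the element one step down the filtration. -/
theorem garnir_le_polySpan (h2 : (2 : F) ≠ 0) {M : ℕ} :
    ∀ {n : ℕ} {l : ℕ → ℕ}, Antitone l → (∀ i, M ≤ i → l i = 0) →
      garnir F l n ≤ polySpan F l n := by
  intro n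
  induction n with
  | zero =>
    intro l _ _ x hx
    by_cases h0 : x default = 0
    · have : x = 0 := funext fun r => by rw [Subsingleton.elim r default, h0]; rfl
      rw [this]
      exact zero_mem _
    · have hc := content_eq hx h0
      have ht : IsTableau l (default : Fin 0 → ℕ) (default : Fin 0 → ℕ) :=
        ⟨fun a => a.elim0, fun a => a.elim0, fun i j hij => by
          have := hc i
          simp at this
          omega⟩
      have : x = x default • polyFun F (default : Fin 0 → ℕ) (default : Fin 0 → ℕ) := by
        funext r
        rw [Subsingleton.elim r default, Pi.smul_apply, ht.polyFun_self, smul_eq_mul, mul_one]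
      rw [this]
      exact Submodule.smul_mem _ _ (Submodule.subset_span ⟨_, _, ht, rfl⟩)
  | succ n ih =>
    intro l hl hM x hx
    suffices H : ∀ k, ∀ x ∈ above F l n k, x ∈ polySpan F l (n + 1) from
      H M x (mem_above_of_eq_zero hM hx)
    intro k
    induction k with
    | zero =>
      intro x hx
      rw [above_zero hx]
      exact zero_mem _
    | succ k ihk =>
      intro x hx
      rcases (hl (Nat.le_succ k)).eq_or_lt with h | h
      · exact ihk x (mem_above_of_not_removable h hx)
      · obtain ⟨y, hy1, hy2, hy3⟩ := exists_lift_of_mem_polySpan h2 hl h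
          (ih (antitone_cut hl h) (cut_eq_zero hM k) (corner_mem (by omega) hx))
        have := ihk (x - y) (mem_above_of_corner_eq_zero (sub_mem hx hy2)
          (by rw [map_sub, hy3, sub_self]))
        simpa using add_mem this hy1

theorem exists_lift (h2 : (2 : F) ≠ 0) (hl : Antitone l) {M : ℕ} (hM : ∀ i, M ≤ i → l i = 0)
    {k : ℕ} (hk : l (k + 1) < l k) {z : Fn F n} (hz : z ∈ garnir F (cut l k) n) :
    ∃ y ∈ above F l n (k + 1), corner F n k y = z := by
  obtain ⟨y, -, h⟩ := exists_lift_of_mem_polySpan h2 hl hk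
    (garnir_le_polySpan h2 (antitone_cut hl hk) (cut_eq_zero hM k) hz)
  exact ⟨y, h⟩

end Polytabloid

end RowFun

namespace RowFun

open Finset Equiv Polynomial

/-! ### Splitting off the eigenspace of an isolated corner -/

section Eigen

variable {F : Type*} [Field F] {n : ℕ} {l : ℕ → ℕ}

/-- The Jucys–Murphy element as an endomorphism. -/
abbrev jmEnd (F : Type*) [Field F] (n : ℕ) : Module.End F (Fn F (n + 1)) := jm F n

theorem aeval_X_sub_C_mul {V : Type*} [AddCommGroup V] [Module F V] (T : Module.End F V)
    (c : F) (q : F[X]) (x : V) :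
    aeval T ((X - C c) * q) x = T (aeval T q x) - c • aeval T q x := by
  rw [map_mul, map_sub, aeval_X, aeval_C, Module.End.mul_apply, LinearMap.sub_apply,
    Module.algebraMap_end_apply]

theorem jm_mem_above {k : ℕ} {x : Fn F (n + 1)} (hx : x ∈ above F l n (k + 1)) :
    jm F n x ∈ above F l n (k + 1) := by
  have h1 := jm_sub_mem_above hx
  have h2 : jm F n x - (bead l k : F) • x ∈ above F l n (k + 1) :=
    ⟨h1.1, fun r hr => h1.2 r (by omega)⟩
  simpa using add_mem h2 (Submodule.smul_mem _ (bead l k : F) hx)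

theorem aeval_mem_of_stable {V : Type*} [AddCommGroup V] [Module F V] {T : Module.End F V}
    {W : Submodule F V} (hT : ∀ x ∈ W, T x ∈ W) (q : F[X]) {x : V} (hx : x ∈ W) :
    aeval T q x ∈ W := by
  induction q using Polynomial.induction_on' with
  | add p q hp hq =>
    rw [map_add, LinearMap.add_apply]
    exact add_mem hp hq
  | monomial m c =>
    rw [aeval_monomial, ← Algebra.smul_def, LinearMap.smul_apply]
    refine Submodule.smul_mem _ _ ?_
    induction m with
    | zero => simpa using hx
    | succ m ih =>
      rw [pow_succ']
      exact hT _ ih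

theorem aeval_apply_of_eigen {V : Type*} [AddCommGroup V] [Module F V] {T : Module.End F V}
    {x : V} {c : F} (h : T x = c • x) (q : F[X]) : aeval T q x = q.eval c • x := by
  induction q using Polynomial.induction_on' with
  | add p q hp hq => rw [map_add, LinearMap.add_apply, hp, hq, eval_add, add_smul]
  | monomial m a =>
    rw [aeval_monomial, ← Algebra.smul_def, LinearMap.smul_apply, eval_monomial, mul_smul]
    congr 1
    induction m with
    | zero => simp
    | succ m ih => rw [pow_succ', Module.End.mul_apply, ih, map_smul, h, smul_smul, pow_succ]

theorem aeval_sub_mem_above {k : ℕ} (q : F[X]) {x : Fn F (n + 1)} (hx : x ∈ above F l n (k + 1)) :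
    aeval (jmEnd F n) q x - q.eval (bead l k : F) • x ∈ above F l n k := by
  obtain ⟨g, hg⟩ := X_sub_C_dvd_sub_C_eval (a := (bead l k : F)) (p := q)
  have h1 : aeval (jmEnd F n) q x - q.eval (bead l k : F) • x =
      jm F n (aeval (jmEnd F n) g x) - (bead l k : F) • aeval (jmEnd F n) g x := by
    rw [← aeval_X_sub_C_mul (jmEnd F n), ← hg, map_sub, aeval_C, LinearMap.sub_apply,
      Module.algebraMap_end_apply]
  rw [h1]
  exact jm_sub_mem_above (aeval_mem_of_stable (fun _ => jm_mem_above) g hx)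

/-- The linear factor for the eigenvalue of the Jucys–Murphy element attached to row `j`. -/
noncomputable def factor (F : Type*) [Field F] (l : ℕ → ℕ) (j : ℕ) : F[X] :=
  open Classical in if l (j + 1) < l j then X - C (bead l j : F) else 1

/-- Each removable row costs one linear factor to descend one step of the filtration. A row that is
not removable costs nothing, which is why its factor is 1. -/
theorem aeval_prod_factor_mem (hl : Antitone l) (a d : ℕ) {x : Fn F (n + 1)}
    (hx : x ∈ above F l n (a + d)) :
    aeval (jmEnd F n) (∏ j ∈ Ico a (a + d), factor F l j) x ∈ above F l n a := by
  induction d generalizing x with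
  | zero => simpa using hx
  | succ d ih =>
    rw [← add_assoc, prod_Ico_succ_top (by omega), map_mul, Module.End.mul_apply]
    refine ih ?_
    rw [← add_assoc] at hx
    rw [factor]
    split_ifs with h
    · rw [← mul_one (X - C _), aeval_X_sub_C_mul, map_one, Module.End.one_apply]
      exact jm_sub_mem_above hx
    · have := hl (Nat.le_succ (a + d))
      rw [Nat.succ_eq_add_one] at this
      simpa using mem_above_of_not_removable (by omega) hx

/-- The row `k` has a removable node whose content differs in `F` from the contents of all other
removable nodes. -/
def Isolated (F : Type*) [Field F] (l : ℕ → ℕ) (k : ℕ) : Prop :=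
  l (k + 1) < l k ∧ ∀ j, l (j + 1) < l j → (bead l j : F) = bead l k → j = k

/-- Up to a nonzero scalar this polynomial projects onto the eigenspace of row `k`. It is the
product of the linear factors of all other rows: those below `k` push the module into `above F l n
(k + 1)`, and those above `k` kill `above F l n k`. Isolation keeps its value at the eigenvalue
nonzero. -/
theorem exists_projector (hl : Antitone l) {M : ℕ} (hM : ∀ i, M ≤ i → l i = 0) {k : ℕ}
    (hk : Isolated F l k) (n : ℕ) :
    ∃ q : F[X], q.eval (bead l k : F) ≠ 0 ∧
      (∀ y ∈ garnir F l (n + 1), aeval (jmEnd F n) q y ∈ above F l n (k + 1) ∧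
        jm F n (aeval (jmEnd F n) q y) = (bead l k : F) • aeval (jmEnd F n) q y) ∧
      ∀ y ∈ above F l n k, aeval (jmEnd F n) q y = 0 := by
  have hkM : k + 1 ≤ M := by
    by_contra h
    have := hM k (by omega)
    have := hk.1
    omega
  obtain ⟨d, rfl⟩ := Nat.exists_eq_add_of_le hkM
  set lo := ∏ j ∈ Ico 0 k, factor F l j with hlo
  set hi := ∏ j ∈ Ico (k + 1) (k + 1 + d), factor F l j with hhi
  have hlok : ∀ y ∈ above F l n k, aeval (jmEnd F n) lo y = 0 := fun y hy => by
    have := aeval_prod_factor_mem hl 0 k (x := y) (by rwa [zero_add])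
    rw [zero_add] at this
    exact above_zero this
  have hhiM (y) (hy : y ∈ garnir F l (n + 1)) : aeval (jmEnd F n) hi y ∈ above F l n (k + 1) :=
    aeval_prod_factor_mem hl (k + 1) d (mem_above_of_eq_zero hM hy)
  have hev (j) (hj : j ≠ k) : (factor F l j).eval (bead l k : F) ≠ 0 := by
    rw [factor]
    split_ifs with h
    · simp only [eval_sub, eval_X, eval_C]
      exact fun h1 => hj (hk.2 j h (sub_eq_zero.mp h1).symm)
    · simp
  refine ⟨lo * hi, ?_, fun y hy => ?_, fun y hy => ?_⟩
  · rw [eval_mul, hlo, hhi, eval_prod, eval_prod]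
    refine mul_ne_zero (prod_ne_zero_iff.mpr fun j hj => hev j ?_)
      (prod_ne_zero_iff.mpr fun j hj => hev j ?_)
    · have := mem_Ico.mp hj
      omega
    · have := mem_Ico.mp hj
      omega
  · rw [map_mul, Module.End.mul_apply]
    refine ⟨aeval_mem_of_stable (fun _ => jm_mem_above) lo (hhiM y hy), ?_⟩
    -- The Jucys–Murphy element minus its eigenvalue maps into `above F l n k`, which `lo`
    -- annihilates; the rest is commuting `lo` past it.
    rw [← sub_eq_zero, ← hlok _ (jm_sub_mem_above (hhiM y hy)), map_sub, map_smul]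
    congr 1
    have : (jm F n : Module.End F (Fn F (n + 1))) * aeval (jmEnd F n) lo =
        aeval (jmEnd F n) lo * jm F n := by
      have h1 : aeval (jmEnd F n) (X : F[X]) = jm F n := aeval_X _
      exact h1 ▸ (map_mul (aeval (jmEnd F n)) X lo).symm.trans
        ((congrArg _ (mul_comm X lo)).trans (map_mul (aeval (jmEnd F n)) lo X))
    exact congrArg (fun T : Module.End F (Fn F (n + 1)) => T _) this
  · rw [mul_comm, map_mul, Module.End.mul_apply, hlok y hy, map_zero]

theorem mem_above_of_eigen (hl : Antitone l) {M : ℕ} (hM : ∀ i, M ≤ i → l i = 0) {k : ℕ}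
    (hk : Isolated F l k) {x : Fn F (n + 1)} (hx : x ∈ garnir F l (n + 1))
    (he : jm F n x = (bead l k : F) • x) : x ∈ above F l n (k + 1) := by
  obtain ⟨q, hq, h1, -⟩ := exists_projector hl hM hk n
  have h2 := (h1 x hx).1
  rw [aeval_apply_of_eigen he] at h2
  exact (Submodule.smul_mem_iff _ hq).mp h2

/-- The corner map is injective on the eigenspace: an eigenvector with zero corner lies in `above F
l n k`, where the projector kills it, yet the projector scales it by a nonzero number. Later
identities between eigenvectors are checked on corners by this lemma. -/
theorem eq_zero_of_corner_eq_zero (hl : Antitone l) {M : ℕ} (hM : ∀ i, M ≤ i → l i = 0) {k : ℕ}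
    (hk : Isolated F l k) {x : Fn F (n + 1)} (hx : x ∈ garnir F l (n + 1))
    (he : jm F n x = (bead l k : F) • x) (hc : corner F n k x = 0) : x = 0 := by
  obtain ⟨q, hq, -, h1⟩ := exists_projector hl hM hk n
  have h2 := h1 x (mem_above_of_corner_eq_zero (mem_above_of_eigen hl hM hk hx he) hc)
  rw [aeval_apply_of_eigen he] at h2
  exact (smul_eq_zero.mp h2).resolve_left hq

theorem corner_of_mem_above {k : ℕ} {x : Fn F (n + 1)} (hx : x ∈ above F l n k) :
    corner F n k x = 0 :=
  funext fun r => hx.2 _ (by simp)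

/-- A linear section of `corner` with values in the eigenspace of the Jucys–Murphy element. -/
def IsEigenLift (l : ℕ → ℕ) (k : ℕ) (s : Fn F n →ₗ[F] Fn F (n + 1)) : Prop :=
  ∀ z ∈ garnir F (cut l k) n, s z ∈ above F l n (k + 1) ∧
    jm F n (s z) = (bead l k : F) • s z ∧ corner F n k (s z) = z

/-- Any preimage under the corner map becomes an eigenvector after applying the projector, and its
corner only gets multiplied by the value of the polynomial at the eigenvalue. Dividing by this value
gives surjectivity, hence a linear section. -/
theorem exists_isEigenLift (h2 : (2 : F) ≠ 0) (hl : Antitone l) {M : ℕ}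
    (hM : ∀ i, M ≤ i → l i = 0) {k : ℕ} (hk : Isolated F l k) (n : ℕ) :
    ∃ s : Fn F n →ₗ[F] Fn F (n + 1), IsEigenLift l k s := by
  obtain ⟨q, hq, h3, -⟩ := exists_projector hl hM hk n
  let E : Submodule F (Fn F (n + 1)) :=
    above F l n (k + 1) ⊓ LinearMap.ker (jm F n - (bead l k : F) • LinearMap.id)
  have hE (x) : x ∈ E ↔ x ∈ above F l n (k + 1) ∧ jm F n x = (bead l k : F) • x := by
    simp [E, sub_eq_zero]
  let f : E →ₗ[F] garnir F (cut l k) n := ((corner F n k).comp E.subtype).codRestrict _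
    fun x => corner_mem (Nat.zero_lt_of_lt hk.1) ((hE _).mp x.2).1
  have hf : Function.Surjective f := by
    rintro ⟨z, hz⟩
    obtain ⟨y, hy, rfl⟩ := exists_lift h2 hl hM hk.1 hz
    refine ⟨⟨(q.eval (bead l k : F))⁻¹ • aeval (jmEnd F n) q y, (hE _).mpr ⟨?_, ?_⟩⟩, ?_⟩
    · exact Submodule.smul_mem _ _ (h3 y hy.1).1
    · rw [map_smul, (h3 y hy.1).2, smul_comm]
    · refine Subtype.ext ?_
      have h4 := corner_of_mem_above (aeval_sub_mem_above q hy)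
      rw [map_sub, sub_eq_zero, map_smul] at h4
      change corner F n k ((q.eval (bead l k : F))⁻¹ • aeval (jmEnd F n) q y) = corner F n k y
      rw [map_smul, h4, smul_smul, inv_mul_cancel₀ hq, one_smul]
  obtain ⟨g, hg⟩ := f.exists_rightInverse_of_surjective (LinearMap.range_eq_top.mpr hf)
  obtain ⟨s, hs⟩ := LinearMap.exists_extend (E.subtype.comp g)
  refine ⟨s, fun z hz => ?_⟩
  have h4 : s z = (g ⟨z, hz⟩ : Fn F (n + 1)) := LinearMap.congr_fun hs ⟨z, hz⟩
  have h5 := (hE _).mp (g ⟨z, hz⟩).2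
  rw [h4]
  exact ⟨h5.1, h5.2, congrArg Subtype.val (LinearMap.congr_fun hg ⟨z, hz⟩)⟩

end Eigen

/-! ### Invariant forms, their descent, and the obstruction -/

section Forms

variable {F : Type*} [Field F] {n : ℕ} {l : ℕ → ℕ}

/-- A permutation of the letters other than `0`. -/
def hat (g : Perm (Fin n)) : Perm (Fin (n + 1)) := Perm.decomposeFin.symm (0, g)

@[simp] theorem hat_zero (g : Perm (Fin n)) : hat g 0 = 0 := by simp [hat]

@[simp] theorem hat_succ (g : Perm (Fin n)) (a : Fin n) : hat g a.succ = (g a).succ := by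
  simp [hat]

theorem corner_permMap_hat (k : ℕ) (g : Perm (Fin n)) (x : Fn F (n + 1)) :
    corner F n k (permMap F (hat g) x) = permMap F g (corner F n k x) := by
  funext r
  simp only [corner_apply, permMap_apply]
  congr 1
  funext a
  refine Fin.cases ?_ (fun b => ?_) a <;> simp

theorem jm_permMap_hat (g : Perm (Fin n)) (x : Fn F (n + 1)) :
    jm F n (permMap F (hat g) x) = permMap F (hat g) (jm F n x) := by
  simp only [jm, LinearMap.sum_apply, map_sum]
  refine (Equiv.sum_comp g fun a => permMap F (swap 0 a.succ) (permMap F (hat g) x)).symm.trans ?_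
  refine sum_congr rfl fun a _ => ?_
  rw [← permMap_mul, ← permMap_mul, mul_swap_eq_swap_mul, hat_zero, hat_succ]

/-- A bilinear form that is invariant and nondegenerate on the space `garnir F l n`. -/
structure IsForm (l : ℕ → ℕ) {n : ℕ} (B : Fn F n →ₗ[F] Fn F n →ₗ[F] F) : Prop where
  inv : ∀ g, ∀ x ∈ garnir F l n, ∀ y ∈ garnir F l n, B (permMap F g x) (permMap F g y) = B x y
  nondeg : ∀ x ∈ garnir F l n, (∀ y ∈ garnir F l n, B x y = 0) → x = 0

/-- The element is a sum of involutions, each self-adjoint for an invariant form. -/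
theorem IsForm.jm_left {B : Fn F (n + 1) →ₗ[F] Fn F (n + 1) →ₗ[F] F} (hB : IsForm l B)
    {x y : Fn F (n + 1)} (hx : x ∈ garnir F l (n + 1)) (hy : y ∈ garnir F l (n + 1)) :
    B (jm F n x) y = B x (jm F n y) := by
  simp only [jm, LinearMap.sum_apply, map_sum]
  refine sum_congr rfl fun a _ => ?_
  rw [← hB.inv (swap 0 a.succ) x hx _ (permMap_mem _ hy), permMap_swap_swap]

theorem IsForm.aeval_left {B : Fn F (n + 1) →ₗ[F] Fn F (n + 1) →ₗ[F] F} (hB : IsForm l B)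
    (q : F[X]) {x y : Fn F (n + 1)} (hx : x ∈ garnir F l (n + 1)) (hy : y ∈ garnir F l (n + 1)) :
    B (aeval (jmEnd F n) q x) y = B x (aeval (jmEnd F n) q y) := by
  induction q using Polynomial.induction_on' with
  | add p q hp hq => simp only [map_add, LinearMap.add_apply, hp, hq]
  | monomial m c =>
    simp only [aeval_monomial, ← Algebra.smul_def, LinearMap.smul_apply, map_smul]
    congr 1
    induction m generalizing x with
    | zero => simp
    | succ m ih =>
      rw [pow_succ, Module.End.mul_apply, ih (jm_mem hx), ← pow_succ, pow_succ',
        Module.End.mul_apply, hB.jm_left hx]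
      have h3 : (jm F n : Module.End F (Fn F (n + 1))) ^ m = aeval (jmEnd F n) (X ^ m : F[X]) := by
        simp
      rw [h3]
      exact aeval_mem_of_stable (fun _ => jm_mem) _ hy

/-- The lift is determined by its corner, so it commutes with permutations fixing `0`, which gives
invariance. For nondegeneracy, the projector is self-adjoint, so pairing `s x` with any `y` reduces
to pairing it with the projection of `y`, which lies in the image of `s`. -/
theorem IsForm.comp_lift {B : Fn F (n + 1) →ₗ[F] Fn F (n + 1) →ₗ[F] F} (hB : IsForm l B)
    (hl : Antitone l) {M : ℕ} (hM : ∀ i, M ≤ i → l i = 0) {k : ℕ}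
    (hk : Isolated F l k) {s : Fn F n →ₗ[F] Fn F (n + 1)} (hs : IsEigenLift l k s) :
    IsForm (cut l k) (B.compl₁₂ s s) := by
  refine ⟨fun g x hx y hy => ?_, fun x hx h => ?_⟩
  · have h1 (z) (hz : z ∈ garnir F (cut l k) n) : s (permMap F g z) = permMap F (hat g) (s z) := by
      have hz' := hs _ (permMap_mem g hz)
      have hz'' := hs _ hz
      refine sub_eq_zero.mp (eq_zero_of_corner_eq_zero hl hM hk
        (sub_mem hz'.1.1 (permMap_mem _ hz''.1.1)) ?_ ?_)
      · rw [map_sub, hz'.2.1, jm_permMap_hat, hz''.2.1, map_smul, smul_sub]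
      · rw [map_sub, hz'.2.2, corner_permMap_hat, hz''.2.2, sub_self]
    rw [LinearMap.compl₁₂_apply, LinearMap.compl₁₂_apply, h1 x hx, h1 y hy,
      hB.inv _ _ (hs x hx).1.1 _ (hs y hy).1.1]
  · obtain ⟨q, hq, h1, -⟩ := exists_projector hl hM hk n
    have hx' := hs x hx
    have h3 : s x = 0 := by
      refine hB.nondeg _ hx'.1.1 fun y hy => ?_
      have hy' := h1 y hy
      have h4 : aeval (jmEnd F n) q y = s (corner F n k (aeval (jmEnd F n) q y)) := by
        have h5 := hs _ (corner_mem (Nat.zero_lt_of_lt hk.1) hy'.1)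
        refine sub_eq_zero.mp (eq_zero_of_corner_eq_zero hl hM hk (sub_mem hy'.1.1 h5.1.1) ?_ ?_)
        · rw [map_sub, hy'.2, h5.2.1, smul_sub]
        · rw [map_sub, h5.2.2, sub_self]
      have h5 := hB.aeval_left q hx'.1.1 hy
      rw [aeval_apply_of_eigen hx'.2.1, h4, map_smul, LinearMap.smul_apply] at h5
      have h6 := h _ (corner_mem (Nat.zero_lt_of_lt hk.1) hy'.1)
      rw [LinearMap.compl₁₂_apply] at h6
      rw [h6] at h5
      exact (smul_eq_zero.mp h5).resolve_left hq
    rw [← hx'.2.2, h3, map_zero]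

/-- The Jucys–Murphy element of the letter `1` in the group of the letters other than `0`. -/
def jmOne (F : Type*) [Field F] (n : ℕ) : Fn F (n + 2) →ₗ[F] Fn F (n + 2) :=
  ∑ a : Fin n, permMap F (hat (swap 0 a.succ))

theorem jmOne_mem {x : Fn F (n + 2)} (hx : x ∈ garnir F l (n + 2)) :
    jmOne F n x ∈ garnir F l (n + 2) := by
  rw [jmOne, LinearMap.sum_apply]
  exact sum_mem fun a _ => permMap_mem _ hx

theorem corner_jmOne (k : ℕ) (x : Fn F (n + 2)) :
    corner F (n + 1) k (jmOne F n x) = jm F n (corner F (n + 1) k x) := by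
  simp only [jmOne, jm, LinearMap.sum_apply, map_sum, corner_permMap_hat]

theorem jm_jmOne (x : Fn F (n + 2)) : jm F (n + 1) (jmOne F n x) = jmOne F n (jm F (n + 1) x) := by
  simp only [jmOne, LinearMap.sum_apply, map_sum, jm_permMap_hat]

/-- The degenerate affine Hecke relation between two consecutive Jucys–Murphy elements and the swap
of their letters. The summand `x` comes from the transposition of `0` and `1` itself. -/
theorem jm_permMap_swap (x : Fn F (n + 2)) :
    jm F (n + 1) (permMap F (swap 0 1) x) = x + permMap F (swap 0 1) (jmOne F n x) := by
  simp only [jm, jmOne, LinearMap.sum_apply, map_sum]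
  rw [Fin.sum_univ_succ]
  congr 1
  · exact permMap_swap_swap _ _ _
  · refine sum_congr rfl fun a _ => ?_
    have h : swap 0 a.succ.succ * swap 0 1 = swap (0 : Fin (n + 2)) 1 * hat (swap 0 a.succ) := by
      refine Equiv.ext fun b => ?_
      refine Fin.cases ?_ (fun b => Fin.cases ?_ (fun b => ?_) b) b
      · rw [Perm.mul_apply, Perm.mul_apply, hat_zero, swap_apply_left,
          swap_apply_of_ne_of_ne (by simp) (by simp [Fin.ext_iff])]
      · rw [Perm.mul_apply, Perm.mul_apply, hat_succ, swap_apply_left]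
        change swap 0 a.succ.succ (swap 0 1 1) = swap 0 1 a.succ.succ
        rw [swap_apply_right, swap_apply_left,
          swap_apply_of_ne_of_ne (by simp [Fin.ext_iff]) (by simp [Fin.ext_iff])]
      · rw [Perm.mul_apply, Perm.mul_apply, hat_succ,
          swap_apply_of_ne_of_ne (x := b.succ.succ) (by simp [Fin.ext_iff])
            (by simp [Fin.ext_iff])]
        by_cases h : b = a
        · subst h
          rw [swap_apply_right, swap_apply_right]
          exact (swap_apply_right 0 1).symm
        · rw [swap_apply_of_ne_of_ne (x := b.succ.succ) (by simp) (by simpa using h),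
            swap_apply_of_ne_of_ne (x := b.succ) (by simp) (by simpa using h),
            swap_apply_of_ne_of_ne (by simp [Fin.ext_iff]) (by simp [Fin.ext_iff])]
    rw [← permMap_mul, ← permMap_mul, h]

theorem jmOne_permMap_swap (x : Fn F (n + 2)) :
    jmOne F n (permMap F (swap 0 1) x) = permMap F (swap 0 1) (jm F (n + 1) x) - x := by
  have h := jm_permMap_swap (permMap F (swap 0 1) x)
  rw [permMap_swap_swap] at h
  rw [h, map_add, permMap_swap_swap, permMap_swap_swap, add_sub_cancel_left]

theorem bead_cut_of_ne {k j : ℕ} (h : j ≠ k) : bead (cut l k) j = bead l j := by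
  rw [bead, cut, Function.update_of_ne h, bead]

/-- Let `u` be the lift that puts `0` in row `b` and `1` in row `a`. As the eigenvalues `α` and `β`
differ by a sign, `w = σ u + (α - β) u` is an eigenvector for the opposite order and is the lift
through `a`, then `b`. Moreover `σ w = (α - β) w`. Eigenvectors for different eigenvalues are
orthogonal, so `w` is orthogonal to `u`, then to `σ u`, then to every such `w`. The form pulled back
to the doubly cut diagram is thus both zero and nondegenerate, although that Specht module contains
a polytabloid. -/
theorem not_isForm_of_adjacent (h2 : (2 : F) ≠ 0) (hl : Antitone l) {M : ℕ}
    (hM : ∀ i, M ≤ i → l i = 0) {a b : ℕ} (hab : b < a) (ha : Isolated F l a)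
    (hb : Isolated F l b) (hab' : Isolated F (cut l a) b) (hba' : Isolated F (cut l b) a)
    (hadj : ((bead l a : F) - (bead l b : F)) * ((bead l a : F) - (bead l b : F)) = 1)
    {R C : Fin n → ℕ} (ht : IsTableau (cut (cut l a) b) R C)
    (B : Fn F (n + 2) →ₗ[F] Fn F (n + 2) →ₗ[F] F) : ¬ IsForm l B := by
  intro hB
  have hla := antitone_cut hl ha.1
  have hlb := antitone_cut hl hb.1
  have hMa := cut_eq_zero hM a
  have hMb := cut_eq_zero hM b
  have hν : cut (cut l a) b = cut (cut l b) a := by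
    simp only [cut, Function.update_of_ne hab.ne, Function.update_of_ne hab.ne']
    exact Function.update_comm hab.ne' _ _ _
  obtain ⟨sa, hsa⟩ := exists_isEigenLift h2 hl hM ha (n + 1)
  obtain ⟨sb, hsb⟩ := exists_isEigenLift h2 hl hM hb (n + 1)
  obtain ⟨sab, hsab⟩ := exists_isEigenLift h2 hla hMa hab' n
  obtain ⟨sba, hsba⟩ := exists_isEigenLift h2 hlb hMb hba' n
  have hB2 := (hB.comp_lift hl hM ha hsa).comp_lift hla hMa hab' hsab
  set α : F := ((bead l a : ℤ) : F) with hα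
  set β : F := ((bead l b : ℤ) : F) with hβ
  have hαβ : α ≠ β := fun h => by simp [h] at hadj
  have hβ' : (bead (cut l a) b : F) = β := by rw [bead_cut_of_ne hab.ne]
  have hα' : (bead (cut l b) a : F) = α := by rw [bead_cut_of_ne hab.ne']
  set σ : Fn F (n + 2) →ₗ[F] Fn F (n + 2) := permMap F (swap 0 1) with hσ
  have hσσ (x) : σ (σ x) = x := permMap_swap_swap _ _ x
  set u : Fn F n → Fn F (n + 2) := fun z => sb (sba z) with hu
  set w : Fn F n → Fn F (n + 2) := fun z => σ (u z) + (α - β) • u z with hw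
  have key (z) (hz : z ∈ garnir F (cut (cut l a) b) n) :
      u z ∈ garnir F l (n + 2) ∧ jm F (n + 1) (u z) = β • u z ∧
        jm F (n + 1) (w z) = α • w z ∧ w z = sa (sab z) := by
    rw [hν] at hz
    have h3 := hsba z hz
    have h4 := hsb _ h3.1.1
    have hL : jmOne F n (u z) = α • u z := by
      refine sub_eq_zero.mp (eq_zero_of_corner_eq_zero hl hM hb (sub_mem (jmOne_mem h4.1.1)
        (Submodule.smul_mem _ _ h4.1.1)) ?_ ?_)
      · rw [map_sub, jm_jmOne, h4.2.1, map_smul, map_smul, h4.2.1, smul_sub, smul_comm α]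
      · rw [map_sub, corner_jmOne, map_smul, h4.2.2, h3.2.1, hα', sub_self]
    have hwm : w z ∈ garnir F l (n + 2) :=
      add_mem (permMap_mem _ h4.1.1) (Submodule.smul_mem _ _ h4.1.1)
    have hwj : jm F (n + 1) (w z) = α • w z := by
      simp only [hw]
      rw [map_add, hσ, jm_permMap_swap, hL, map_smul, map_smul, h4.2.1]
      have h5 : u z = ((α - β) * (α - β)) • u z := by rw [hadj, one_smul]
      linear_combination (norm := module) h5
    have hwj1 : jmOne F n (w z) = β • w z := by
      simp only [hw]
      rw [map_add, hσ, jmOne_permMap_swap, map_smul, hL, h4.2.1, map_smul]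
      have h5 : u z = ((α - β) * (α - β)) • u z := by rw [hadj, one_smul]
      linear_combination (norm := module) -h5
    have hwa := mem_above_of_eigen hl hM ha hwm hwj
    have hca := corner_mem (Nat.zero_lt_of_lt ha.1) hwa
    have hcj : jm F n (corner F (n + 1) a (w z)) =
        (bead (cut l a) b : F) • corner F (n + 1) a (w z) := by
      rw [← corner_jmOne, hwj1, map_smul, hβ']
    -- Since `b < a`, the vector `u z` vanishes when `0` is in row `a`; only the swapped summand of
    -- `w z` contributes.
    have hcc : corner F n b (corner F (n + 1) a (w z)) = z := by
      funext r
      have h5 : u z (Fin.cons a (Fin.cons b r : Fin (n + 1) → ℕ)) = 0 :=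
        h4.1.2 _ (by simpa using hab)
      simp only [corner_apply, hw, Pi.add_apply, Pi.smul_apply, h5, smul_zero, add_zero, hσ,
        permMap_apply]
      have h6 : (Fin.cons a (Fin.cons b r : Fin (n + 1) → ℕ) : Fin (n + 2) → ℕ) ∘ swap 0 1 =
          Fin.cons b (Fin.cons a r : Fin (n + 1) → ℕ) := by
        funext c
        refine Fin.cases ?_ (fun c => Fin.cases ?_ (fun c => ?_) c) c
        · simp only [Function.comp_apply, swap_apply_left, Fin.cons_zero]
          exact Fin.cons_succ (α := fun _ : Fin (n + 2) => ℕ) a (Fin.cons b r : Fin (n + 1) → ℕ) 0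
        · have : (Fin.succ 0 : Fin (n + 2)) = 1 := rfl
          simp [this]
        · simp [swap_apply_of_ne_of_ne, Fin.ext_iff]
      rw [h6]
      have h7 := congrFun h4.2.2 (Fin.cons a r : Fin (n + 1) → ℕ)
      rw [corner_apply] at h7
      have h8 := congrFun h3.2.2 r
      rw [corner_apply] at h8
      rw [← h8, ← h7]
    rw [← hν] at hz
    have hc1 : corner F (n + 1) a (w z) = sab z := by
      have h5 := hsab z hz
      refine sub_eq_zero.mp (eq_zero_of_corner_eq_zero hla hMa hab' (sub_mem hca h5.1.1) ?_ ?_)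
      · rw [map_sub, hcj, h5.2.1, smul_sub]
      · rw [map_sub, hcc, h5.2.2, sub_self]
    refine ⟨h4.1.1, h4.2.1, hwj, ?_⟩
    have h5 := hsa _ (hsab z hz).1.1
    refine sub_eq_zero.mp (eq_zero_of_corner_eq_zero hl hM ha (sub_mem hwm h5.1.1) ?_ ?_)
    · rw [map_sub, hwj, h5.2.1, smul_sub]
    · rw [map_sub, hc1, h5.2.2, sub_self]
  have hx := ht.polyFun_mem h2 (antitone_cut hla hab'.1)
  have h0 : polyFun F R C = 0 := by
    refine hB2.nondeg _ hx fun y hy => ?_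
    obtain ⟨hxu, hxj, hxw, hx2⟩ := key _ hx
    obtain ⟨hyu, hyj, hyw, hy2⟩ := key y hy
    rw [LinearMap.compl₁₂_apply, LinearMap.compl₁₂_apply, ← hx2, ← hy2]
    set x := polyFun F R C
    have hwm : w x ∈ garnir F l (n + 2) := add_mem (permMap_mem _ hxu) (Submodule.smul_mem _ _ hxu)
    -- The two vectors are eigenvectors of a self-adjoint operator for the distinct eigenvalues `α`
    -- and `β`.
    have h3 : B (w x) (u y) = 0 := by
      have h4 := hB.jm_left hwm hyu
      rw [hxw, hyj, map_smul, map_smul, LinearMap.smul_apply, smul_eq_mul, smul_eq_mul] at h4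
      have h5 : (α - β) * B (w x) (u y) = 0 := by rw [sub_mul, h4, sub_self]
      exact (mul_eq_zero.mp h5).resolve_left (sub_ne_zero.mpr hαβ)
    have h4 : B (w x) (σ (u y)) = (α - β) * B (w x) (u y) := by
      rw [← hB.inv (swap 0 1) _ hwm _ (permMap_mem _ hyu)]
      change B (σ (w x)) (σ (σ (u y))) = _
      rw [hσσ]
      have h5 : σ (w x) = (α - β) • w x := by
        simp only [hw]
        rw [map_add, map_smul, hσσ, smul_add, smul_smul, hadj, one_smul]
        exact add_comm (u x) _
      rw [h5, map_smul, LinearMap.smul_apply, smul_eq_mul]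
    change B (w x) (σ (u y) + (α - β) • u y) = 0
    rw [map_add, map_smul, h4, h3, mul_zero, smul_zero, add_zero]
  have := ht.polyFun_self (F := F)
  rw [h0] at this
  exact zero_ne_one this

end Forms

end RowFun

/-! ### Bead configurations and the transfer to Specht modules -/

namespace RowFun

open Finset Equiv

/-- The bead `x` can be moved down, and is the only movable bead in its residue class. -/
structure Movable (p : ℤ) (X : ℤ → Prop) (x : ℤ) : Prop where
  mem : X x
  pred : ¬ X (x - 1)
  unique : ∀ z, X z → ¬ X (z - 1) → p ∣ z - x → z = x

/-- Bead configurations from which one can get, by moving down uniquely movable beads, to a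
configuration with two uniquely movable beads in adjacent residue classes that obstructs
self-duality. -/
inductive Bad (p : ℤ) : (ℤ → Prop) → Prop
  | top {X : ℤ → Prop} (x y : ℤ) (hx : Movable p X x) (hy : Movable p X y) (hx' : ¬ X (x + 1))
      (hy' : X (y - 2)) (hxy : p ∣ y - x - 1) : Bad p X
  | step {X Y : ℤ → Prop} (x : ℤ) (hx : Movable p X x) (hY : ∀ z, Y z ↔ (X z ∧ z ≠ x) ∨ z = x - 1)
      (h : Bad p Y) : Bad p X

section Bead

variable {F : Type*} [Field F] {l : ℕ → ℕ}

theorem bead_strictAnti (hl : Antitone l) : StrictAnti (bead l) := by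
  intro i j h
  have := hl h.le
  simp only [bead]
  omega

theorem cast_bead_eq {p : ℕ} [CharP F p] {x y : ℤ} : (x : F) = y ↔ (p : ℤ) ∣ x - y := by
  rw [← sub_eq_zero, ← Int.cast_sub, CharP.intCast_eq_zero_iff F p]

theorem removable_iff (hl : Antitone l) (k : ℕ) :
    l (k + 1) < l k ↔ ¬ ∃ j, bead l j = bead l k - 1 := by
  constructor
  · rintro h ⟨j, hj⟩
    have h1 : k < j := (bead_strictAnti hl).lt_iff_gt.mp (by omega)
    have h2 := (bead_strictAnti hl).antitone (show k + 1 ≤ j from h1)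
    simp only [bead] at hj h2
    push_cast at h2
    omega
  · intro h
    by_contra h1
    refine h ⟨k + 1, ?_⟩
    have := hl (Nat.le_succ k)
    rw [Nat.succ_eq_add_one] at this
    simp only [bead]
    push_cast
    omega

/-- Equality of contents in `F` is congruence modulo `p`, and a row is removable exactly when the
position below its bead is vacant. -/
theorem isolated_iff {p : ℕ} [CharP F p] (hl : Antitone l) (k : ℕ) :
    Isolated F l k ↔ Movable p (fun z => ∃ j, bead l j = z) (bead l k) := by
  constructor
  · rintro ⟨h1, h2⟩
    refine ⟨⟨k, rfl⟩, (removable_iff hl k).mp h1, ?_⟩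
    rintro _ ⟨j, rfl⟩ h3 h4
    rw [h2 j ((removable_iff hl j).mpr h3) (cast_bead_eq.mpr h4)]
  · rintro ⟨-, h1, h2⟩
    refine ⟨(removable_iff hl k).mpr h1, fun j hj h3 => ?_⟩
    exact (bead_strictAnti hl).injective
      (h2 _ ⟨j, rfl⟩ ((removable_iff hl j).mp hj) (cast_bead_eq.mp h3))

theorem exists_bead_cut_iff (hl : Antitone l) {k : ℕ} (hk : l (k + 1) < l k) (z : ℤ) :
    (∃ j, bead (cut l k) j = z) ↔ ((∃ j, bead l j = z) ∧ z ≠ bead l k) ∨ z = bead l k - 1 := by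
  have h1 : bead (cut l k) k = bead l k - 1 := by
    simp only [bead, cut, Function.update_self]
    omega
  constructor
  · rintro ⟨j, rfl⟩
    by_cases hj : j = k
    · subst hj
      exact Or.inr h1
    · rw [bead_cut_of_ne hj]
      exact Or.inl ⟨⟨j, rfl⟩, fun h => hj ((bead_strictAnti hl).injective h)⟩
  · rintro (⟨⟨j, rfl⟩, h⟩ | rfl)
    · refine ⟨j, bead_cut_of_ne ?_⟩
      rintro rfl
      exact h rfl
    · exact ⟨k, h1⟩

theorem sum_cut {M : ℕ} (hM : ∀ i, M ≤ i → l i = 0) {k : ℕ} (hk : l (k + 1) < l k) :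
    ∑ i ∈ range M, cut l k i + 1 = ∑ i ∈ range M, l i := by
  have hkM : k ∈ range M := by
    rw [mem_range]
    by_contra h
    have := hM k (by omega)
    omega
  rw [cut, sum_update_of_mem hkM, ← add_sum_erase _ l hkM, ← sdiff_singleton_eq_erase]
  omega

theorem exists_removable {M : ℕ} (hM : ∀ i, M ≤ i → l i = 0) (h : ∑ i ∈ range M, l i ≠ 0) :
    ∃ k, l (k + 1) < l k := by
  by_contra! h1
  refine h (sum_eq_zero fun i _ => ?_)
  have h2 : l i ≤ l (i + M) := monotone_nat_of_le_succ h1 (Nat.le_add_right i M)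
  rw [hM (i + M) (by omega)] at h2
  omega

theorem exists_isTableau {M : ℕ} (n : ℕ) (l : ℕ → ℕ) (hl : Antitone l)
    (hM : ∀ i, M ≤ i → l i = 0) (hn : ∑ i ∈ range M, l i = n) :
    ∃ R C : Fin n → ℕ, IsTableau l R C := by
  induction n generalizing l with
  | zero =>
    refine ⟨Fin.elim0, Fin.elim0, fun a => a.elim0, fun a => a.elim0, fun i j h => ?_⟩
    by_cases hi : i < M
    · have := (sum_eq_zero_iff.mp hn) i (mem_range.mpr hi)
      omega
    · have := hM i (by omega)
      omega
  | succ n ih =>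
    obtain ⟨k, hk⟩ := exists_removable hM (by omega)
    have := sum_cut hM hk
    obtain ⟨R, C, h⟩ := ih (cut l k) (antitone_cut hl hk) (cut_eq_zero hM k) (by omega)
    exact ⟨_, _, h.cons hk⟩

theorem Movable.congr {p : ℤ} {X Y : ℤ → Prop} (h : ∀ z, X z ↔ Y z) {x : ℤ}
    (hx : Movable p X x) : Movable p Y x := by
  have : X = Y := funext fun z => propext (h z)
  exact this ▸ hx

theorem Bad.congr {p : ℤ} {X Y : ℤ → Prop} (h : ∀ z, X z ↔ Y z) (hX : Bad p X) : Bad p Y := by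
  have : X = Y := funext fun z => propext (h z)
  exact this ▸ hX

/-- Vacating `x` could only free a bead at `x + 1`, which is in the class of `y`; that position is
vacant. The new bead `x - 1` is in the class of `y - 2`. -/
theorem Movable.of_move_left {p : ℤ} (h2 : ¬ p ∣ 2) (h1 : ¬ p ∣ 1) {X : ℤ → Prop} {x y : ℤ}
    (hy : Movable p X y) (hx' : ¬ X (x + 1)) (hxy : p ∣ y - x - 1) :
    Movable p (fun z => (X z ∧ z ≠ x) ∨ z = x - 1) y := by
  have hne : y ≠ x := by
    rintro rfl
    exact h1 (by simpa using hxy)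
  refine ⟨Or.inl ⟨hy.mem, hne⟩, ?_, ?_⟩
  · rintro (h | h)
    · exact hy.pred h.1
    · omega
  · rintro z (⟨hz, hzx⟩ | rfl) h3 h4
    · refine hy.unique z hz (fun h => h3 (Or.inl ⟨h, ?_⟩)) h4
      rintro rfl
      exact hx' (by simpa using hz)
    · have := dvd_add hxy h4
      rw [show y - x - 1 + (x - 1 - y) = -2 by ring, dvd_neg] at this
      exact absurd this h2

/-- The new bead `y - 1` is in the class of `x`, but the occupied position `y - 2` blocks it. A bead
freed at `y + 1` would be in the class of `x + 2`. -/
theorem Movable.of_move_right {p : ℤ} (h2 : ¬ p ∣ 2) (h1 : ¬ p ∣ 1) {X : ℤ → Prop} {x y : ℤ}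
    (hx : Movable p X x) (hy' : X (y - 2)) (hxy : p ∣ y - x - 1) :
    Movable p (fun z => (X z ∧ z ≠ y) ∨ z = y - 1) x := by
  have hne : x ≠ y := by
    rintro rfl
    exact h1 (by simpa using hxy)
  refine ⟨Or.inl ⟨hx.mem, hne⟩, ?_, ?_⟩
  · rintro (h | h)
    · exact hx.pred h.1
    · omega
  · rintro z (⟨hz, hzx⟩ | rfl) h3 h4
    · refine hx.unique z hz (fun h => h3 (Or.inl ⟨h, ?_⟩)) h4
      rintro rfl
      have := dvd_add hxy h4
      rw [show z - 1 - x - 1 + (z - x) = 2 * (z - x) - 2 by ring] at this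
      exact h2 ((dvd_sub_right (h4.mul_left 2)).mp this)
    · refine absurd (Or.inl ⟨?_, ?_⟩) h3
      · rwa [show y - 1 - 1 = y - 2 by ring]
      · omega

theorem not_isForm_of_bad {p : ℕ} [CharP F p] (hp : p.Prime) (hp2 : p ≠ 2) {M : ℕ}
    {X : ℤ → Prop} (hX : Bad p X) (n : ℕ) (l : ℕ → ℕ) (hl : Antitone l)
    (hM : ∀ i, M ≤ i → l i = 0) (hn : ∑ i ∈ range M, l i = n)
    (hXl : ∀ z, X z ↔ ∃ j, bead l j = z) (B : Fn F n →ₗ[F] Fn F n →ₗ[F] F) : ¬ IsForm l B := by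
  have hd1 : ¬ (p : ℤ) ∣ 1 := by
    intro h
    have := hp.one_lt
    exact absurd (Int.le_of_dvd one_pos h) (by omega)
  have hd2 : ¬ (p : ℤ) ∣ 2 := by
    intro h
    have := hp.two_le
    have h1 := Int.le_of_dvd two_pos h
    omega
  have h2 : (2 : F) ≠ 0 := by
    have := (CharP.intCast_eq_zero_iff F p 2).not.mpr hd2
    exact_mod_cast this
  induction hX generalizing n l with
  | @top X x y hx hy hx' hy' hxy =>
    have hXe : X = fun z => ∃ j, bead l j = z := funext fun z => propext (hXl z)
    obtain ⟨a, rfl⟩ := (hXl x).mp hx.mem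
    obtain ⟨b, rfl⟩ := (hXl y).mp hy.mem
    have hne : a ≠ b := by
      rintro rfl
      exact hd1 (by simpa using hxy)
    have hxa := hx
    have hyb := hy
    rw [hXe, ← isolated_iff (F := F) hl] at hxa hyb
    have hab : Isolated F (cut l a) b := by
      rw [isolated_iff (p := p) (antitone_cut hl hxa.1), bead_cut_of_ne hne.symm]
      refine (hy.of_move_left hd2 hd1 hx' hxy).congr fun z => ?_
      rw [exists_bead_cut_iff hl hxa.1, hXl]
    have hba : Isolated F (cut l b) a := by
      rw [isolated_iff (p := p) (antitone_cut hl hyb.1), bead_cut_of_ne hne]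
      refine (hx.of_move_right hd2 hd1 hy' hxy).congr fun z => ?_
      rw [exists_bead_cut_iff hl hyb.1, hXl]
    have hadj : ((bead l b : ℤ) : F) - ((bead l a : ℤ) : F) = 1 := by
      have := (CharP.intCast_eq_zero_iff F p _).mpr hxy
      push_cast at this
      exact sub_eq_zero.mp this
    have s1 := sum_cut hM hxa.1
    have s2 := sum_cut (cut_eq_zero hM a) hab.1
    obtain ⟨m, rfl⟩ : ∃ m, n = m + 2 := ⟨n - 2, by omega⟩
    -- Only the square of the content difference enters the obstruction, so either of the two
    -- corners may be the lower one.
    rcases lt_or_gt_of_ne hne with h | h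
    · obtain ⟨R, C, ht⟩ := exists_isTableau m _ (antitone_cut (antitone_cut hl hyb.1) hba.1)
        (cut_eq_zero (cut_eq_zero hM b) a) (by
          have := sum_cut hM hyb.1
          have := sum_cut (cut_eq_zero hM b) hba.1
          omega)
      exact not_isForm_of_adjacent h2 hl hM h hyb hxa hba hab (by rw [hadj, one_mul]) ht B
    · obtain ⟨R, C, ht⟩ := exists_isTableau m _ (antitone_cut (antitone_cut hl hxa.1) hab.1)
        (cut_eq_zero (cut_eq_zero hM a) b) (by omega)
      refine not_isForm_of_adjacent h2 hl hM h hxa hyb hab hba ?_ ht B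
      rw [← neg_sub, hadj]
      ring
  | @step X Y x hx hY _ ih =>
    intro hB
    have hXe : X = fun z => ∃ j, bead l j = z := funext fun z => propext (hXl z)
    obtain ⟨a, rfl⟩ := (hXl x).mp hx.mem
    rw [hXe, ← isolated_iff (F := F) hl] at hx
    have s1 := sum_cut hM hx.1
    obtain ⟨m, rfl⟩ : ∃ m, n = m + 1 := ⟨n - 1, by omega⟩
    obtain ⟨s, hs⟩ := exists_isEigenLift h2 hl hM hx m
    refine ih m (cut l a) (antitone_cut hl hx.1) (cut_eq_zero hM a) (by omega) (fun z => ?_) _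
      (hB.comp_lift hl hM hx hs)
    rw [hY, exists_bead_cut_iff hl hx.1, hXl]

end Bead

/-- Conjugating the partition exchanges beads and vacancies under `z ↦ -1 - z`. The move of `x` to
`x - 1` becomes the move of `-x` to `-x - 1`, and the two beads of an obstruction trade roles. This
halves the case analysis. -/
theorem Bad.conj {p : ℤ} {X : ℤ → Prop} (h : Bad p X) : Bad p fun z => ¬ X (-1 - z) := by
  have hm {X : ℤ → Prop} {x : ℤ} (hx : Movable p X x) : Movable p (fun z => ¬ X (-1 - z)) (-x) := by
    refine ⟨by simpa [sub_eq_add_neg, add_comm] using hx.pred, ?_, fun z h1 h2 h3 => ?_⟩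
    · rw [not_not, show -1 - (-x - 1) = x by ring]
      exact hx.mem
    · rw [not_not, show -1 - (z - 1) = -z by ring] at h2
      have := hx.unique (-z) h2 (by rwa [show -z - 1 = -1 - z by ring])
        (by rwa [← dvd_neg, show -(-z - x) = z - -x by ring])
      omega
  induction h with
  | @top X x y hx hy hx' hy' hxy =>
    refine Bad.top (-y) (-x) (hm hy) (hm hx) ?_ ?_ ?_
    · rw [not_not]
      convert hy' using 1
      ring
    · convert hx' using 2
      ring
    · convert hxy using 1
      ring
  | @step X Y x hx hY _ ih =>
    refine Bad.step (-x) (hm hx) (fun z => ?_) ih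
    rw [hY]
    have h1 := hx.mem
    have h2 := hx.pred
    have h3 : -1 - z = x ↔ z = -x - 1 := by omega
    have h4 : -1 - z = x - 1 ↔ z = -x := by omega
    rw [h4, ne_eq, h3]
    by_cases h5 : z = -x
    · subst h5
      simp
      omega
    · by_cases h6 : z = -x - 1
      · subst h6
        simp
      · tauto

end RowFun

/-! ### Explicit chains of moves for particles and holes -/

namespace RowFun

/-- The bead configuration with particles `U` and holes `V`. -/
def Config (U V : List ℤ) (z : ℤ) : Prop := (z < 0 ∧ z ∉ V) ∨ z ∈ U

variable {p : ℤ} {U V : List ℤ}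

/-- A number of absolute value less than `3 * p` that is not a nonzero multiple of `p`. -/
def Apart (p d : ℤ) : Prop := d < 3 * p ∧ -(3 * p) < d ∧ d ≠ p ∧ d ≠ -p ∧ d ≠ 2 * p ∧ d ≠ -(2 * p)

theorem Apart.eq_zero (hp : 0 < p) {d : ℤ} (h : Apart p d) (hd : p ∣ d) : d = 0 := by
  obtain ⟨k, rfl⟩ := hd
  obtain ⟨h1, h2, h3, h4, h5, h6⟩ := h
  have hk1 : k < 3 := by nlinarith
  have hk2 : -3 < k := by nlinarith
  interval_cases k <;> simp_all <;> omega

/-- A form of `Movable` for configurations that linear arithmetic can decide. -/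
def Free (p : ℤ) (U V : List ℤ) (x : ℤ) : Prop :=
  Config U V x ∧ ¬ Config U V (x - 1) ∧ ∀ z, (z ∈ U ∨ z - 1 ∈ V) → Config U V z →
    ¬ Config U V (z - 1) → Apart p (z - x)

/-- A movable bead is a particle or sits just above a hole, so uniqueness needs checking only at
those positions. `Apart` replaces divisibility by the symbolic `p` with finitely many linear
inequalities. -/
theorem Free.movable (hp : 0 < p) {x : ℤ} (h : Free p U V x) : Movable p (Config U V) x := by
  refine ⟨h.1, h.2.1, fun z hz hz' hd => ?_⟩
  have := (h.2.2 z ?_ hz hz').eq_zero hp hd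
  · omega
  · by_contra! h
    simp only [Config, h.1, h.2, not_false_eq_true, and_true, or_false] at hz hz'
    omega

/-- Quantifying over `t` with `t = x` makes the moved position a variable, so that the side
conditions become linear arithmetic after unfolding. -/
theorem Config.step (hp : 0 < p) (x : ℤ) (U V U' V' : List ℤ)
    (h : ∀ t, t = x → Free p U V t ∧
      ∀ z, Config U' V' z ↔ (Config U V z ∧ z ≠ t) ∨ z = t - 1)
    (h' : Bad p (Config U' V')) : Bad p (Config U V) :=
  Bad.step x ((h x rfl).1.movable hp) (h x rfl).2 h'

theorem Config.top (hp : 0 < p) (k x y : ℤ) (U V : List ℤ) (hk : y - x - 1 = p * k)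
    (h : ∀ t, t = x → ∀ s, s = y → Free p U V t ∧ Free p U V s ∧ ¬ Config U V (t + 1) ∧
      Config U V (s - 2)) :
    Bad p (Config U V) :=
  have h1 := h x rfl y rfl
  Bad.top x y (h1.1.movable hp) (h1.2.1.movable hp) h1.2.2.1 h1.2.2.2 ⟨k, hk⟩

theorem Config.conj (hU : ∀ u ∈ U, 0 ≤ u) (hV : ∀ v ∈ V, v < 0)
    (h : Bad p (Config (V.map (-1 - ·)) (U.map (-1 - ·)))) : Bad p (Config U V) := by
  refine h.conj.congr fun z => ?_
  have h1 (L : List ℤ) : -1 - z ∈ L.map (-1 - ·) ↔ z ∈ L := by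
    simp
  simp only [Config, h1]
  by_cases hz : z < 0
  · have : z ∉ U := fun h => absurd (hU z h) (by omega)
    simp [this, hz, show ¬ (-1 - z < 0) by omega]
  · have : z ∉ V := fun h => absurd (hV z h) (by omega)
    simp [this, hz, show -1 - z < 0 by omega]

/-- A hook partition with both arm and leg nonempty: its two corners have contents `u` and `u - 3 *
p + 1`, in adjacent classes, and are an obstruction at once. -/
theorem bad_one (hp : 5 ≤ p) {u : ℤ} (hu : 0 < u) (hu' : u < 3 * p - 1) :
    Bad p (Config [u] [u - 3 * p]) := by
  refine Config.top (by omega) (-3) (u) (u - 3 * p + 1) [u] [u - 3 * p] (by ring)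
      fun t ht s hs => ?_
  simp only [Free, Config, List.mem_cons, List.not_mem_nil, or_false, Apart]
  exact ⟨⟨by omega, by omega, fun z => by omega⟩, ⟨by omega, by omega, fun z => by omega⟩,
    by omega, by omega⟩

theorem bad_two_of_apart (hp : 5 ≤ p) {u w : ℤ} (hu : 0 < u) (hu' : u < p - 1) (hw : 0 ≤ w)
    (hw' : w < 2 * p)
    (h : w ≠ u ∧ w ≠ u + p ∧ w ≠ u + 1 ∧ w ≠ u - 1 ∧ w ≠ u + p + 1 ∧ w ≠ u + p - 1) :
    Bad p (Config [u, w] [u - p, w - 2 * p]) := by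
  refine Config.top (by omega) (-1) (u) (u - p + 1) [u, w] [u - p, w - 2 * p] (by ring)
      fun t ht s hs => ?_
  simp only [Free, Config, List.mem_cons, List.not_mem_nil, or_false, Apart]
  exact ⟨⟨by omega, by omega, fun z => by omega⟩, ⟨by omega, by omega, fun z => by omega⟩,
    by omega, by omega⟩

theorem bad_two_of_apart' (hp : 5 ≤ p) {u w : ℤ} (hu : u = 0 ∨ u = p - 1) (hw : 0 < w)
    (hw' : w < 2 * p - 1)
    (h : w ≠ u ∧ w ≠ u + p ∧ w ≠ u + 1 ∧ w ≠ u - 1 ∧ w ≠ u + p + 1 ∧ w ≠ u + p - 1) :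
    Bad p (Config [u, w] [u - p, w - 2 * p]) := by
  refine Config.top (by omega) (-2) (w) (w - 2 * p + 1) [u, w] [u - p, w - 2 * p] (by ring)
      fun t ht s hs => ?_
  simp only [Free, Config, List.mem_cons, List.not_mem_nil, or_false, Apart]
  exact ⟨⟨by omega, by omega, fun z => by omega⟩, ⟨by omega, by omega, fun z => by omega⟩,
    by omega, by omega⟩

theorem bad_two_outer (hp : 5 ≤ p) :
    Bad p (Config [0, 2 * p - 1] [-p, -1]) := by
  refine Config.top (by omega) (-1) (0) (1 - p) [0, 2 * p - 1] [-p, -1] (by ring)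
      fun t ht s hs => ?_
  simp only [Free, Config, List.mem_cons, List.not_mem_nil, or_false, Apart]
  exact ⟨⟨by omega, by omega, fun z => by omega⟩, ⟨by omega, by omega, fun z => by omega⟩,
    by omega, by omega⟩

theorem bad_two_inner (hp : 5 ≤ p) :
    Bad p (Config [p - 1, 0] [-1, -(2 * p)]) := by
  refine Config.top (by omega) (-2) (0) (1 - 2 * p) [p - 1, 0] [-1, -(2 * p)] (by ring)
      fun t ht s hs => ?_
  simp only [Free, Config, List.mem_cons, List.not_mem_nil, or_false, Apart]
  exact ⟨⟨by omega, by omega, fun z => by omega⟩, ⟨by omega, by omega, fun z => by omega⟩,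
    by omega, by omega⟩

/-- A particle in the next residue class spoils the direct obstruction at `u`. Three moves separate
the beads until `u + p` and `u - p + 1` form one. -/
theorem bad_two_succ (hp : 5 ≤ p) {u : ℤ} (hu : 0 < u) (hu' : u < p - 2) :
    Bad p (Config [u, u + p + 1] [u - p, u + 1 - p]) := by
  refine Config.step (by omega) (u) [u, u + p + 1] [u - p, u + 1 - p] [u - 1, u + p + 1]
      [u - p, u + 1 - p] (fun t ht => ?_) ?_
  · simp only [Free, Config, List.mem_cons, List.not_mem_nil, or_false, Apart]
    exact ⟨⟨by omega, by omega, fun z => by omega⟩, fun z => by omega⟩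
  refine Config.step (by omega) (u + p + 1) [u - 1, u + p + 1] [u - p, u + 1 - p] [u - 1, u + p]
      [u - p, u + 1 - p] (fun t ht => ?_) ?_
  · simp only [Free, Config, List.mem_cons, List.not_mem_nil, or_false, Apart]
    exact ⟨⟨by omega, by omega, fun z => by omega⟩, fun z => by omega⟩
  refine Config.step (by omega) (u + 2 - p) [u - 1, u + p] [u - p, u + 1 - p] [u - 1, u + p]
      [u - p, u + 2 - p] (fun t ht => ?_) ?_
  · simp only [Free, Config, List.mem_cons, List.not_mem_nil, or_false, Apart]
    exact ⟨⟨by omega, by omega, fun z => by omega⟩, fun z => by omega⟩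
  refine Config.top (by omega) (-2) (u + p) (u - p + 1) [u - 1, u + p] [u - p, u + 2 - p] (by ring)
      fun t ht s hs => ?_
  simp only [Free, Config, List.mem_cons, List.not_mem_nil, or_false, Apart]
  exact ⟨⟨by omega, by omega, fun z => by omega⟩, ⟨by omega, by omega, fun z => by omega⟩,
    by omega, by omega⟩

theorem bad_two_succ_zero (hp : 5 ≤ p) :
    Bad p (Config [0, p + 1] [-p, 1 - p]) := by
  refine Config.step (by omega) (p + 1) [0, p + 1] [-p, 1 - p] [0, p] [-p, 1 - p] (fun t ht => ?_)
      ?_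
  · simp only [Free, Config, List.mem_cons, List.not_mem_nil, or_false, Apart]
    exact ⟨⟨by omega, by omega, fun z => by omega⟩, fun z => by omega⟩
  refine Config.step (by omega) (2 - p) [0, p] [-p, 1 - p] [0, p] [-p, 2 - p] (fun t ht => ?_) ?_
  · simp only [Free, Config, List.mem_cons, List.not_mem_nil, or_false, Apart]
    exact ⟨⟨by omega, by omega, fun z => by omega⟩, fun z => by omega⟩
  refine Config.top (by omega) (-2) (p) (1 - p) [0, p] [-p, 2 - p] (by ring) fun t ht s hs => ?_
  simp only [Free, Config, List.mem_cons, List.not_mem_nil, or_false, Apart]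
  exact ⟨⟨by omega, by omega, fun z => by omega⟩, ⟨by omega, by omega, fun z => by omega⟩,
    by omega, by omega⟩

/-- The number of moves depends on `p`, hence the induction. The smaller particle slides down to
`0`; then the other drops by one and the particle at `0` fills the hole `-1`, leaving a hook of size
`2 * p`, which is an obstruction. -/
theorem bad_two_slide (hp : 5 ≤ p) (d : ℕ) (hd : (d : ℤ) ≤ p - 2) :
    Bad p (Config [(d : ℤ), 2 * p - 1] [-2, -1]) := by
  induction d with
  | zero =>
    refine Config.step (by omega) (2 * p - 1) [((0 : ℕ) : ℤ), 2 * p - 1] [-2, -1]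
        [((0 : ℕ) : ℤ), 2 * p - 2] [-2, -1] (fun t ht => ?_) ?_
    · simp only [Free, Config, List.mem_cons, List.not_mem_nil, or_false, Apart]
      exact ⟨⟨by omega, by omega, fun z => by omega⟩, fun z => by omega⟩
    refine Config.step (by omega) (0) [((0 : ℕ) : ℤ), 2 * p - 2] [-2, -1] [2 * p - 2] [-2]
        (fun t ht => ?_) ?_
    · simp only [Free, Config, List.mem_cons, List.not_mem_nil, or_false, Apart]
      exact ⟨⟨by omega, by omega, fun z => by omega⟩, fun z => by omega⟩
    refine Config.top (by omega) (-2) (2 * p - 2) (-1) [2 * p - 2] [-2] (by ring)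
      fun t ht s hs => ?_
    simp only [Free, Config, List.mem_cons, List.not_mem_nil, or_false, Apart]
    exact ⟨⟨by omega, by omega, fun z => by omega⟩, ⟨by omega, by omega, fun z => by omega⟩,
      by omega, by omega⟩
  | succ d ih =>
    push_cast at hd ⊢
    refine Config.step (by omega) ((d : ℤ) + 1) [(d : ℤ) + 1, 2 * p - 1] [-2, -1]
        [(d : ℤ), 2 * p - 1] [-2, -1] (fun t ht => ?_) ?_
    · simp only [Free, Config, List.mem_cons, List.not_mem_nil, or_false, Apart]
      exact ⟨⟨by omega, by omega, fun z => by omega⟩, fun z => by omega⟩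
    exact ih (by omega)

theorem bad_two_pred (hp : 5 ≤ p) {u : ℤ} (hu : 1 < u) (hu' : u < p - 1) :
    Bad p (Config [u, u + p - 1] [u - p, u - 1 - p]) := by
  refine Config.step (by omega) (u + p - 1) [u, u + p - 1] [u - p, u - 1 - p] [u, u + p - 2]
      [u - p, u - 1 - p] (fun t ht => ?_) ?_
  · simp only [Free, Config, List.mem_cons, List.not_mem_nil, or_false, Apart]
    exact ⟨⟨by omega, by omega, fun z => by omega⟩, fun z => by omega⟩
  refine Config.step (by omega) (u) [u, u + p - 2] [u - p, u - 1 - p] [u - 1, u + p - 2]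
      [u - p, u - 1 - p] (fun t ht => ?_) ?_
  · simp only [Free, Config, List.mem_cons, List.not_mem_nil, or_false, Apart]
    exact ⟨⟨by omega, by omega, fun z => by omega⟩, fun z => by omega⟩
  refine Config.step (by omega) (u - p + 1) [u - 1, u + p - 2] [u - p, u - 1 - p] [u - 1, u + p - 2]
      [u - p + 1, u - 1 - p] (fun t ht => ?_) ?_
  · simp only [Free, Config, List.mem_cons, List.not_mem_nil, or_false, Apart]
    exact ⟨⟨by omega, by omega, fun z => by omega⟩, fun z => by omega⟩
  refine Config.top (by omega) (-1) (u - 1) (u - p) [u - 1, u + p - 2] [u - p + 1, u - 1 - p]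
      (by ring) fun t ht s hs => ?_
  simp only [Free, Config, List.mem_cons, List.not_mem_nil, or_false, Apart]
  exact ⟨⟨by omega, by omega, fun z => by omega⟩, ⟨by omega, by omega, fun z => by omega⟩,
    by omega, by omega⟩

theorem bad_two_pred_zero (hp : 5 ≤ p) :
    Bad p (Config [0, p - 1] [-p, -1 - p]) := by
  refine Config.step (by omega) (1 - p) [0, p - 1] [-p, -1 - p] [0, p - 1] [1 - p, -1 - p]
      (fun t ht => ?_) ?_
  · simp only [Free, Config, List.mem_cons, List.not_mem_nil, or_false, Apart]
    exact ⟨⟨by omega, by omega, fun z => by omega⟩, fun z => by omega⟩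
  refine Config.top (by omega) (-2) (p - 1) (-p) [0, p - 1] [1 - p, -1 - p] (by ring) fun t ht s hs
      => ?_
  simp only [Free, Config, List.mem_cons, List.not_mem_nil, or_false, Apart]
  exact ⟨⟨by omega, by omega, fun z => by omega⟩, ⟨by omega, by omega, fun z => by omega⟩,
    by omega, by omega⟩

theorem bad_two_pred_one (hp : 5 ≤ p) :
    Bad p (Config [1, p] [1 - p, -p]) := by
  refine Config.top (by omega) (-1) (p) (1) [1, p] [1 - p, -p] (by ring) fun t ht s hs => ?_
  simp only [Free, Config, List.mem_cons, List.not_mem_nil, or_false, Apart]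
  exact ⟨⟨by omega, by omega, fun z => by omega⟩, ⟨by omega, by omega, fun z => by omega⟩,
    by omega, by omega⟩

/-- After the slide, four moves reduce the configuration to a hook with particle `p - 2` and hole
`-2`. -/
theorem bad_two_pred_slide (hp : 5 ≤ p) (d : ℕ) (hd : (d : ℤ) ≤ p - 2) :
    Bad p (Config [(d : ℤ) + 1, p] [-1, -2]) := by
  induction d with
  | zero =>
    push_cast
    refine Config.step (by omega) (p) [0 + 1, p] [-1, -2] [0 + 1, p - 1] [-1, -2] (fun t ht => ?_)
        ?_
    · simp only [Free, Config, List.mem_cons, List.not_mem_nil, or_false, Apart]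
      exact ⟨⟨by omega, by omega, fun z => by omega⟩, fun z => by omega⟩
    refine Config.step (by omega) (0 + 1) [0 + 1, p - 1] [-1, -2] [0, p - 1] [-1, -2]
        (fun t ht => ?_) ?_
    · simp only [Free, Config, List.mem_cons, List.not_mem_nil, or_false, Apart]
      exact ⟨⟨by omega, by omega, fun z => by omega⟩, fun z => by omega⟩
    refine Config.step (by omega) (p - 1) [0, p - 1] [-1, -2] [0, p - 2] [-1, -2] (fun t ht => ?_)
        ?_
    · simp only [Free, Config, List.mem_cons, List.not_mem_nil, or_false, Apart]
      exact ⟨⟨by omega, by omega, fun z => by omega⟩, fun z => by omega⟩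
    refine Config.step (by omega) (0) [0, p - 2] [-1, -2] [p - 2] [-2] (fun t ht => ?_) ?_
    · simp only [Free, Config, List.mem_cons, List.not_mem_nil, or_false, Apart]
      exact ⟨⟨by omega, by omega, fun z => by omega⟩, fun z => by omega⟩
    refine Config.top (by omega) (-1) (p - 2) (-1) [p - 2] [-2] (by ring) fun t ht s hs => ?_
    simp only [Free, Config, List.mem_cons, List.not_mem_nil, or_false, Apart]
    exact ⟨⟨by omega, by omega, fun z => by omega⟩, ⟨by omega, by omega, fun z => by omega⟩,
      by omega, by omega⟩
  | succ d ih =>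
    push_cast at hd ⊢
    refine Config.step (by omega) ((d : ℤ) + 1 + 1) [(d : ℤ) + 1 + 1, p] [-1, -2] [(d : ℤ) + 1, p]
        [-1, -2] (fun t ht => ?_) ?_
    · simp only [Free, Config, List.mem_cons, List.not_mem_nil, or_false, Apart]
      exact ⟨⟨by omega, by omega, fun z => by omega⟩, fun z => by omega⟩
    exact ih (by omega)

theorem bad_two_pred_last (hp : 5 ≤ p) (d : ℕ) (hd : (d : ℤ) ≤ p - 2) :
    Bad p (Config [p - 1, p + d] [-1, -2]) := by
  induction d with
  | zero =>
    have := bad_two_pred_slide hp (p - 2).toNat (by omega)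
    rw [Int.toNat_of_nonneg (by omega), show p - 2 + 1 = p - 1 by ring] at this
    simpa using this
  | succ d ih =>
    push_cast at hd ⊢
    refine Config.step (by omega) (p + ((d : ℤ) + 1)) [p - 1, p + ((d : ℤ) + 1)] [-1, -2]
        [p - 1, p + (d : ℤ)] [-1, -2] (fun t ht => ?_) ?_
    · simp only [Free, Config, List.mem_cons, List.not_mem_nil, or_false, Apart]
      exact ⟨⟨by omega, by omega, fun z => by omega⟩, fun z => by omega⟩
    exact ih (by omega)

/-- With no other particle next to `a`, the beads `a` and `a - p + 1` obstruct immediately. -/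
theorem bad_three_of_apart (hp : 5 ≤ p) {a b c : ℤ} (hb : 0 ≤ b) (hc : 0 ≤ c)
    (hb' : b < p) (hc' : c < p) (h0 : 0 < a) (h1 : a < p - 1)
    (h2 : b ≠ a + 1 ∧ b ≠ a - 1 ∧ c ≠ a + 1 ∧ c ≠ a - 1) :
    Bad p (Config [a, b, c] [a - p, b - p, c - p]) := by
  refine Config.top (by omega) (-1) (a) (a - p + 1) [a, b, c] [a - p, b - p, c - p] (by ring)
      fun t ht s hs => ?_
  simp only [Free, Config, List.mem_cons, List.not_mem_nil, or_false, Apart]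
  exact ⟨⟨by omega, by omega, fun z => by omega⟩, ⟨by omega, by omega, fun z => by omega⟩,
    by omega, by omega⟩

theorem bad_three_slide (hp : 5 ≤ p) {i : ℤ} (hi : 1 < i) (hi' : i < p - 1) (d : ℕ)
    (hd : (d : ℤ) ≤ p - 2 - i) : Bad p (Config [0, i, i + 1] [-p, i - p, -1 - d]) := by
  induction d with
  | zero =>
    rw [Nat.cast_zero, sub_zero]
    refine Config.top (by omega) (-1) (0) (1 - p) [0, i, i + 1] [-p, i - p, -1] (by ring)
      fun t ht s hs => ?_
    simp only [Free, Config, List.mem_cons, List.not_mem_nil, or_false, Apart]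
    exact ⟨⟨by omega, by omega, fun z => by omega⟩, ⟨by omega, by omega, fun z => by omega⟩,
      by omega, by omega⟩
  | succ d ih =>
    push_cast at hd ⊢
    refine Config.step (by omega) (-1 - (d : ℤ)) [0, i, i + 1] [-p, i - p, -1 - ((d : ℤ) + 1)]
        [0, i, i + 1] [-p, i - p, -1 - (d : ℤ)] (fun t ht => ?_) ?_
    · simp only [Free, Config, List.mem_cons, List.not_mem_nil, or_false, Apart]
      exact ⟨⟨by omega, by omega, fun z => by omega⟩, fun z => by omega⟩
    exact ih (by omega)

/-- Ten moves spread out the three adjacent particles and holes until `i` and `i - p + 1` obstruct.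
The bounds on `i` keep `i - 3` nonnegative and `i + 3 - p` negative throughout; the positions closer
to the ends need separate chains. -/
theorem bad_three_consec (hp : 5 ≤ p) {i : ℤ} (hi : 3 ≤ i) (hi' : i ≤ p - 4) :
    Bad p (Config [i, i + 1, i + 2] [i - p, i + 1 - p, i + 2 - p]) := by
  refine Config.step (by omega) (i) [i, i + 1, i + 2] [i - p, i + 1 - p, i + 2 - p]
      [i - 1, i + 1, i + 2] [i - p, i + 1 - p, i + 2 - p] (fun t ht => ?_) ?_
  · simp only [Free, Config, List.mem_cons, List.not_mem_nil, or_false, Apart]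
    exact ⟨⟨by omega, by omega, fun z => by omega⟩, fun z => by omega⟩
  refine Config.step (by omega) (i - 1) [i - 1, i + 1, i + 2] [i - p, i + 1 - p, i + 2 - p]
      [i - 2, i + 1, i + 2] [i - p, i + 1 - p, i + 2 - p] (fun t ht => ?_) ?_
  · simp only [Free, Config, List.mem_cons, List.not_mem_nil, or_false, Apart]
    exact ⟨⟨by omega, by omega, fun z => by omega⟩, fun z => by omega⟩
  refine Config.step (by omega) (i - 2) [i - 2, i + 1, i + 2] [i - p, i + 1 - p, i + 2 - p]
      [i - 3, i + 1, i + 2] [i - p, i + 1 - p, i + 2 - p] (fun t ht => ?_) ?_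
  · simp only [Free, Config, List.mem_cons, List.not_mem_nil, or_false, Apart]
    exact ⟨⟨by omega, by omega, fun z => by omega⟩, fun z => by omega⟩
  refine Config.step (by omega) (i + 1) [i - 3, i + 1, i + 2] [i - p, i + 1 - p, i + 2 - p]
      [i - 3, i, i + 2] [i - p, i + 1 - p, i + 2 - p] (fun t ht => ?_) ?_
  · simp only [Free, Config, List.mem_cons, List.not_mem_nil, or_false, Apart]
    exact ⟨⟨by omega, by omega, fun z => by omega⟩, fun z => by omega⟩
  refine Config.step (by omega) (i) [i - 3, i, i + 2] [i - p, i + 1 - p, i + 2 - p]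
      [i - 3, i - 1, i + 2] [i - p, i + 1 - p, i + 2 - p] (fun t ht => ?_) ?_
  · simp only [Free, Config, List.mem_cons, List.not_mem_nil, or_false, Apart]
    exact ⟨⟨by omega, by omega, fun z => by omega⟩, fun z => by omega⟩
  refine Config.step (by omega) (i - 1) [i - 3, i - 1, i + 2] [i - p, i + 1 - p, i + 2 - p]
      [i - 3, i - 2, i + 2] [i - p, i + 1 - p, i + 2 - p] (fun t ht => ?_) ?_
  · simp only [Free, Config, List.mem_cons, List.not_mem_nil, or_false, Apart]
    exact ⟨⟨by omega, by omega, fun z => by omega⟩, fun z => by omega⟩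
  refine Config.step (by omega) (i + 2) [i - 3, i - 2, i + 2] [i - p, i + 1 - p, i + 2 - p]
      [i - 3, i - 2, i + 1] [i - p, i + 1 - p, i + 2 - p] (fun t ht => ?_) ?_
  · simp only [Free, Config, List.mem_cons, List.not_mem_nil, or_false, Apart]
    exact ⟨⟨by omega, by omega, fun z => by omega⟩, fun z => by omega⟩
  refine Config.step (by omega) (i + 1) [i - 3, i - 2, i + 1] [i - p, i + 1 - p, i + 2 - p]
      [i - 3, i - 2, i] [i - p, i + 1 - p, i + 2 - p] (fun t ht => ?_) ?_
  · simp only [Free, Config, List.mem_cons, List.not_mem_nil, or_false, Apart]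
    exact ⟨⟨by omega, by omega, fun z => by omega⟩, fun z => by omega⟩
  refine Config.step (by omega) (i + 3 - p) [i - 3, i - 2, i] [i - p, i + 1 - p, i + 2 - p]
      [i - 3, i - 2, i] [i - p, i + 1 - p, i + 3 - p] (fun t ht => ?_) ?_
  · simp only [Free, Config, List.mem_cons, List.not_mem_nil, or_false, Apart]
    exact ⟨⟨by omega, by omega, fun z => by omega⟩, fun z => by omega⟩
  refine Config.step (by omega) (i + 2 - p) [i - 3, i - 2, i] [i - p, i + 1 - p, i + 3 - p]
      [i - 3, i - 2, i] [i - p, i + 2 - p, i + 3 - p] (fun t ht => ?_) ?_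
  · simp only [Free, Config, List.mem_cons, List.not_mem_nil, or_false, Apart]
    exact ⟨⟨by omega, by omega, fun z => by omega⟩, fun z => by omega⟩
  refine Config.top (by omega) (-1) (i) (i - p + 1) [i - 3, i - 2, i] [i - p, i + 2 - p, i + 3 - p]
      (by ring) fun t ht s hs => ?_
  simp only [Free, Config, List.mem_cons, List.not_mem_nil, or_false, Apart]
  exact ⟨⟨by omega, by omega, fun z => by omega⟩, ⟨by omega, by omega, fun z => by omega⟩,
    by omega, by omega⟩

theorem bad_three_consec_slide (hp : 7 ≤ p) (d : ℕ) (hd : (d : ℤ) ≤ p - 6) :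
    Bad p (Config [0, 1, 2] [2 - p, 4 - p, -1 - d]) := by
  induction d with
  | zero =>
    rw [Nat.cast_zero, sub_zero]
    refine Config.step (by omega) (0) [0, 1, 2] [2 - p, 4 - p, -1] [1, 2] [2 - p, 4 - p]
        (fun t ht => ?_) ?_
    · simp only [Free, Config, List.mem_cons, List.not_mem_nil, or_false, Apart]
      exact ⟨⟨by omega, by omega, fun z => by omega⟩, fun z => by omega⟩
    refine Config.step (by omega) (1) [1, 2] [2 - p, 4 - p] [0, 2] [2 - p, 4 - p] (fun t ht => ?_)
        ?_
    · simp only [Free, Config, List.mem_cons, List.not_mem_nil, or_false, Apart]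
      exact ⟨⟨by omega, by omega, fun z => by omega⟩, fun z => by omega⟩
    refine Config.top (by omega) (-1) (2) (3 - p) [0, 2] [2 - p, 4 - p] (by ring)
      fun t ht s hs => ?_
    simp only [Free, Config, List.mem_cons, List.not_mem_nil, or_false, Apart]
    exact ⟨⟨by omega, by omega, fun z => by omega⟩, ⟨by omega, by omega, fun z => by omega⟩,
      by omega, by omega⟩
  | succ d ih =>
    push_cast at hd ⊢
    refine Config.step (by omega) (-1 - (d : ℤ)) [0, 1, 2] [2 - p, 4 - p, -1 - ((d : ℤ) + 1)]
        [0, 1, 2] [2 - p, 4 - p, -1 - (d : ℤ)] (fun t ht => ?_) ?_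
    · simp only [Free, Config, List.mem_cons, List.not_mem_nil, or_false, Apart]
      exact ⟨⟨by omega, by omega, fun z => by omega⟩, fun z => by omega⟩
    exact ih (by omega)

theorem bad_three_consec_zero (hp : 7 ≤ p) :
    Bad p (Config [0, 1, 2] [-p, 1 - p, 2 - p]) := by
  refine Config.step (by omega) (3 - p) [0, 1, 2] [-p, 1 - p, 2 - p] [0, 1, 2] [-p, 1 - p, 3 - p]
      (fun t ht => ?_) ?_
  · simp only [Free, Config, List.mem_cons, List.not_mem_nil, or_false, Apart]
    exact ⟨⟨by omega, by omega, fun z => by omega⟩, fun z => by omega⟩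
  refine Config.step (by omega) (2 - p) [0, 1, 2] [-p, 1 - p, 3 - p] [0, 1, 2] [-p, 2 - p, 3 - p]
      (fun t ht => ?_) ?_
  · simp only [Free, Config, List.mem_cons, List.not_mem_nil, or_false, Apart]
    exact ⟨⟨by omega, by omega, fun z => by omega⟩, fun z => by omega⟩
  refine Config.step (by omega) (1 - p) [0, 1, 2] [-p, 2 - p, 3 - p] [0, 1, 2] [1 - p, 2 - p, 3 - p]
      (fun t ht => ?_) ?_
  · simp only [Free, Config, List.mem_cons, List.not_mem_nil, or_false, Apart]
    exact ⟨⟨by omega, by omega, fun z => by omega⟩, fun z => by omega⟩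
  refine Config.step (by omega) (4 - p) [0, 1, 2] [1 - p, 2 - p, 3 - p] [0, 1, 2]
      [1 - p, 2 - p, 4 - p] (fun t ht => ?_) ?_
  · simp only [Free, Config, List.mem_cons, List.not_mem_nil, or_false, Apart]
    exact ⟨⟨by omega, by omega, fun z => by omega⟩, fun z => by omega⟩
  refine Config.step (by omega) (3 - p) [0, 1, 2] [1 - p, 2 - p, 4 - p] [0, 1, 2]
      [1 - p, 3 - p, 4 - p] (fun t ht => ?_) ?_
  · simp only [Free, Config, List.mem_cons, List.not_mem_nil, or_false, Apart]
    exact ⟨⟨by omega, by omega, fun z => by omega⟩, fun z => by omega⟩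
  refine Config.step (by omega) (2 - p) [0, 1, 2] [1 - p, 3 - p, 4 - p] [0, 1, 2]
      [2 - p, 3 - p, 4 - p] (fun t ht => ?_) ?_
  · simp only [Free, Config, List.mem_cons, List.not_mem_nil, or_false, Apart]
    exact ⟨⟨by omega, by omega, fun z => by omega⟩, fun z => by omega⟩
  refine Config.step (by omega) (5 - p) [0, 1, 2] [2 - p, 3 - p, 4 - p] [0, 1, 2]
      [2 - p, 3 - p, 5 - p] (fun t ht => ?_) ?_
  · simp only [Free, Config, List.mem_cons, List.not_mem_nil, or_false, Apart]
    exact ⟨⟨by omega, by omega, fun z => by omega⟩, fun z => by omega⟩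
  refine Config.step (by omega) (4 - p) [0, 1, 2] [2 - p, 3 - p, 5 - p] [0, 1, 2]
      [2 - p, 4 - p, 5 - p] (fun t ht => ?_) ?_
  · simp only [Free, Config, List.mem_cons, List.not_mem_nil, or_false, Apart]
    exact ⟨⟨by omega, by omega, fun z => by omega⟩, fun z => by omega⟩
  have := bad_three_consec_slide hp (p - 6).toNat (by omega)
  rwa [Int.toNat_of_nonneg (by omega), show -1 - (p - 6) = 5 - p by ring] at this

theorem bad_three_consec_one (hp : 7 ≤ p) :
    Bad p (Config [1, 2, 3] [1 - p, 2 - p, 3 - p]) := by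
  refine Config.step (by omega) (4 - p) [1, 2, 3] [1 - p, 2 - p, 3 - p] [1, 2, 3]
      [1 - p, 2 - p, 4 - p] (fun t ht => ?_) ?_
  · simp only [Free, Config, List.mem_cons, List.not_mem_nil, or_false, Apart]
    exact ⟨⟨by omega, by omega, fun z => by omega⟩, fun z => by omega⟩
  refine Config.step (by omega) (3 - p) [1, 2, 3] [1 - p, 2 - p, 4 - p] [1, 2, 3]
      [1 - p, 3 - p, 4 - p] (fun t ht => ?_) ?_
  · simp only [Free, Config, List.mem_cons, List.not_mem_nil, or_false, Apart]
    exact ⟨⟨by omega, by omega, fun z => by omega⟩, fun z => by omega⟩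
  refine Config.step (by omega) (2 - p) [1, 2, 3] [1 - p, 3 - p, 4 - p] [1, 2, 3]
      [2 - p, 3 - p, 4 - p] (fun t ht => ?_) ?_
  · simp only [Free, Config, List.mem_cons, List.not_mem_nil, or_false, Apart]
    exact ⟨⟨by omega, by omega, fun z => by omega⟩, fun z => by omega⟩
  refine Config.step (by omega) (1) [1, 2, 3] [2 - p, 3 - p, 4 - p] [0, 2, 3] [2 - p, 3 - p, 4 - p]
      (fun t ht => ?_) ?_
  · simp only [Free, Config, List.mem_cons, List.not_mem_nil, or_false, Apart]
    exact ⟨⟨by omega, by omega, fun z => by omega⟩, fun z => by omega⟩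
  refine Config.step (by omega) (5 - p) [0, 2, 3] [2 - p, 3 - p, 4 - p] [0, 2, 3]
      [2 - p, 3 - p, 5 - p] (fun t ht => ?_) ?_
  · simp only [Free, Config, List.mem_cons, List.not_mem_nil, or_false, Apart]
    exact ⟨⟨by omega, by omega, fun z => by omega⟩, fun z => by omega⟩
  refine Config.step (by omega) (4 - p) [0, 2, 3] [2 - p, 3 - p, 5 - p] [0, 2, 3]
      [2 - p, 4 - p, 5 - p] (fun t ht => ?_) ?_
  · simp only [Free, Config, List.mem_cons, List.not_mem_nil, or_false, Apart]
    exact ⟨⟨by omega, by omega, fun z => by omega⟩, fun z => by omega⟩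
  refine Config.step (by omega) (3 - p) [0, 2, 3] [2 - p, 4 - p, 5 - p] [0, 2, 3]
      [3 - p, 4 - p, 5 - p] (fun t ht => ?_) ?_
  · simp only [Free, Config, List.mem_cons, List.not_mem_nil, or_false, Apart]
    exact ⟨⟨by omega, by omega, fun z => by omega⟩, fun z => by omega⟩
  refine Config.step (by omega) (2) [0, 2, 3] [3 - p, 4 - p, 5 - p] [0, 1, 3] [3 - p, 4 - p, 5 - p]
      (fun t ht => ?_) ?_
  · simp only [Free, Config, List.mem_cons, List.not_mem_nil, or_false, Apart]
    exact ⟨⟨by omega, by omega, fun z => by omega⟩, fun z => by omega⟩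
  refine Config.step (by omega) (6 - p) [0, 1, 3] [3 - p, 4 - p, 5 - p] [0, 1, 3]
      [3 - p, 4 - p, 6 - p] (fun t ht => ?_) ?_
  · simp only [Free, Config, List.mem_cons, List.not_mem_nil, or_false, Apart]
    exact ⟨⟨by omega, by omega, fun z => by omega⟩, fun z => by omega⟩
  refine Config.step (by omega) (5 - p) [0, 1, 3] [3 - p, 4 - p, 6 - p] [0, 1, 3]
      [3 - p, 5 - p, 6 - p] (fun t ht => ?_) ?_
  · simp only [Free, Config, List.mem_cons, List.not_mem_nil, or_false, Apart]
    exact ⟨⟨by omega, by omega, fun z => by omega⟩, fun z => by omega⟩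
  refine Config.top (by omega) (-1) (3) (4 - p) [0, 1, 3] [3 - p, 5 - p, 6 - p] (by ring)
      fun t ht s hs => ?_
  simp only [Free, Config, List.mem_cons, List.not_mem_nil, or_false, Apart]
  exact ⟨⟨by omega, by omega, fun z => by omega⟩, ⟨by omega, by omega, fun z => by omega⟩,
    by omega, by omega⟩

theorem bad_three_consec_two (hp : 7 ≤ p) :
    Bad p (Config [2, 3, 4] [2 - p, 3 - p, 4 - p]) := by
  refine Config.step (by omega) (2) [2, 3, 4] [2 - p, 3 - p, 4 - p] [1, 3, 4] [2 - p, 3 - p, 4 - p]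
      (fun t ht => ?_) ?_
  · simp only [Free, Config, List.mem_cons, List.not_mem_nil, or_false, Apart]
    exact ⟨⟨by omega, by omega, fun z => by omega⟩, fun z => by omega⟩
  refine Config.step (by omega) (1) [1, 3, 4] [2 - p, 3 - p, 4 - p] [0, 3, 4] [2 - p, 3 - p, 4 - p]
      (fun t ht => ?_) ?_
  · simp only [Free, Config, List.mem_cons, List.not_mem_nil, or_false, Apart]
    exact ⟨⟨by omega, by omega, fun z => by omega⟩, fun z => by omega⟩
  refine Config.step (by omega) (3) [0, 3, 4] [2 - p, 3 - p, 4 - p] [0, 2, 4] [2 - p, 3 - p, 4 - p]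
      (fun t ht => ?_) ?_
  · simp only [Free, Config, List.mem_cons, List.not_mem_nil, or_false, Apart]
    exact ⟨⟨by omega, by omega, fun z => by omega⟩, fun z => by omega⟩
  refine Config.step (by omega) (4) [0, 2, 4] [2 - p, 3 - p, 4 - p] [0, 2, 3] [2 - p, 3 - p, 4 - p]
      (fun t ht => ?_) ?_
  · simp only [Free, Config, List.mem_cons, List.not_mem_nil, or_false, Apart]
    exact ⟨⟨by omega, by omega, fun z => by omega⟩, fun z => by omega⟩
  refine Config.step (by omega) (5 - p) [0, 2, 3] [2 - p, 3 - p, 4 - p] [0, 2, 3]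
      [2 - p, 3 - p, 5 - p] (fun t ht => ?_) ?_
  · simp only [Free, Config, List.mem_cons, List.not_mem_nil, or_false, Apart]
    exact ⟨⟨by omega, by omega, fun z => by omega⟩, fun z => by omega⟩
  refine Config.step (by omega) (4 - p) [0, 2, 3] [2 - p, 3 - p, 5 - p] [0, 2, 3]
      [2 - p, 4 - p, 5 - p] (fun t ht => ?_) ?_
  · simp only [Free, Config, List.mem_cons, List.not_mem_nil, or_false, Apart]
    exact ⟨⟨by omega, by omega, fun z => by omega⟩, fun z => by omega⟩
  refine Config.step (by omega) (3 - p) [0, 2, 3] [2 - p, 4 - p, 5 - p] [0, 2, 3]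
      [3 - p, 4 - p, 5 - p] (fun t ht => ?_) ?_
  · simp only [Free, Config, List.mem_cons, List.not_mem_nil, or_false, Apart]
    exact ⟨⟨by omega, by omega, fun z => by omega⟩, fun z => by omega⟩
  refine Config.step (by omega) (2) [0, 2, 3] [3 - p, 4 - p, 5 - p] [0, 1, 3] [3 - p, 4 - p, 5 - p]
      (fun t ht => ?_) ?_
  · simp only [Free, Config, List.mem_cons, List.not_mem_nil, or_false, Apart]
    exact ⟨⟨by omega, by omega, fun z => by omega⟩, fun z => by omega⟩
  refine Config.step (by omega) (6 - p) [0, 1, 3] [3 - p, 4 - p, 5 - p] [0, 1, 3]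
      [3 - p, 4 - p, 6 - p] (fun t ht => ?_) ?_
  · simp only [Free, Config, List.mem_cons, List.not_mem_nil, or_false, Apart]
    exact ⟨⟨by omega, by omega, fun z => by omega⟩, fun z => by omega⟩
  refine Config.step (by omega) (5 - p) [0, 1, 3] [3 - p, 4 - p, 6 - p] [0, 1, 3]
      [3 - p, 5 - p, 6 - p] (fun t ht => ?_) ?_
  · simp only [Free, Config, List.mem_cons, List.not_mem_nil, or_false, Apart]
    exact ⟨⟨by omega, by omega, fun z => by omega⟩, fun z => by omega⟩
  refine Config.top (by omega) (-1) (3) (4 - p) [0, 1, 3] [3 - p, 5 - p, 6 - p] (by ring)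
      fun t ht s hs => ?_
  simp only [Free, Config, List.mem_cons, List.not_mem_nil, or_false, Apart]
  exact ⟨⟨by omega, by omega, fun z => by omega⟩, ⟨by omega, by omega, fun z => by omega⟩,
    by omega, by omega⟩

theorem bad_five_aux : Bad 5 (Config [1, 2] [-4, -3]) := by
  refine Config.step (by omega) (-2) [1, 2] [-4, -3] [1, 2] [-4, -2] (fun t ht => ?_) ?_
  · simp only [Free, Config, List.mem_cons, List.not_mem_nil, or_false, Apart]
    exact ⟨⟨by omega, by omega, fun z => by omega⟩, fun z => by omega⟩
  refine Config.step (by omega) (-3) [1, 2] [-4, -2] [1, 2] [-3, -2] (fun t ht => ?_) ?_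
  · simp only [Free, Config, List.mem_cons, List.not_mem_nil, or_false, Apart]
    exact ⟨⟨by omega, by omega, fun z => by omega⟩, fun z => by omega⟩
  refine Config.step (by omega) (1) [1, 2] [-3, -2] [0, 2] [-3, -2] (fun t ht => ?_) ?_
  · simp only [Free, Config, List.mem_cons, List.not_mem_nil, or_false, Apart]
    exact ⟨⟨by omega, by omega, fun z => by omega⟩, fun z => by omega⟩
  refine Config.step (by omega) (-1) [0, 2] [-3, -2] [0, 2] [-3, -1] (fun t ht => ?_) ?_
  · simp only [Free, Config, List.mem_cons, List.not_mem_nil, or_false, Apart]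
    exact ⟨⟨by omega, by omega, fun z => by omega⟩, fun z => by omega⟩
  refine Config.top (by omega) (-1) (2) (-2) [0, 2] [-3, -1] (by ring) fun t ht s hs => ?_
  simp only [Free, Config, List.mem_cons, List.not_mem_nil, or_false, Apart]
  exact ⟨⟨by omega, by omega, fun z => by omega⟩, ⟨by omega, by omega, fun z => by omega⟩,
    by omega, by omega⟩

theorem bad_five_zero : Bad 5 (Config [0, 1, 2] [-5, -4, -3]) := by
  refine Config.step (by omega) (-2) [0, 1, 2] [-5, -4, -3] [0, 1, 2] [-5, -4, -2] (fun t ht => ?_)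
      ?_
  · simp only [Free, Config, List.mem_cons, List.not_mem_nil, or_false, Apart]
    exact ⟨⟨by omega, by omega, fun z => by omega⟩, fun z => by omega⟩
  refine Config.step (by omega) (-3) [0, 1, 2] [-5, -4, -2] [0, 1, 2] [-5, -3, -2] (fun t ht => ?_)
      ?_
  · simp only [Free, Config, List.mem_cons, List.not_mem_nil, or_false, Apart]
    exact ⟨⟨by omega, by omega, fun z => by omega⟩, fun z => by omega⟩
  refine Config.step (by omega) (-4) [0, 1, 2] [-5, -3, -2] [0, 1, 2] [-4, -3, -2] (fun t ht => ?_)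
      ?_
  · simp only [Free, Config, List.mem_cons, List.not_mem_nil, or_false, Apart]
    exact ⟨⟨by omega, by omega, fun z => by omega⟩, fun z => by omega⟩
  refine Config.step (by omega) (-1) [0, 1, 2] [-4, -3, -2] [0, 1, 2] [-4, -3, -1] (fun t ht => ?_)
      ?_
  · simp only [Free, Config, List.mem_cons, List.not_mem_nil, or_false, Apart]
    exact ⟨⟨by omega, by omega, fun z => by omega⟩, fun z => by omega⟩
  refine Config.step (by omega) (0) [0, 1, 2] [-4, -3, -1] [1, 2] [-4, -3] (fun t ht => ?_) ?_
  · simp only [Free, Config, List.mem_cons, List.not_mem_nil, or_false, Apart]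
    exact ⟨⟨by omega, by omega, fun z => by omega⟩, fun z => by omega⟩
  exact bad_five_aux

theorem bad_five_one : Bad 5 (Config [1, 2, 3] [-4, -3, -2]) := by
  refine Config.step (by omega) (1) [1, 2, 3] [-4, -3, -2] [0, 2, 3] [-4, -3, -2] (fun t ht => ?_)
      ?_
  · simp only [Free, Config, List.mem_cons, List.not_mem_nil, or_false, Apart]
    exact ⟨⟨by omega, by omega, fun z => by omega⟩, fun z => by omega⟩
  refine Config.step (by omega) (2) [0, 2, 3] [-4, -3, -2] [0, 1, 3] [-4, -3, -2] (fun t ht => ?_)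
      ?_
  · simp only [Free, Config, List.mem_cons, List.not_mem_nil, or_false, Apart]
    exact ⟨⟨by omega, by omega, fun z => by omega⟩, fun z => by omega⟩
  refine Config.step (by omega) (3) [0, 1, 3] [-4, -3, -2] [0, 1, 2] [-4, -3, -2] (fun t ht => ?_)
      ?_
  · simp only [Free, Config, List.mem_cons, List.not_mem_nil, or_false, Apart]
    exact ⟨⟨by omega, by omega, fun z => by omega⟩, fun z => by omega⟩
  refine Config.step (by omega) (-1) [0, 1, 2] [-4, -3, -2] [0, 1, 2] [-4, -3, -1] (fun t ht => ?_)
      ?_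
  · simp only [Free, Config, List.mem_cons, List.not_mem_nil, or_false, Apart]
    exact ⟨⟨by omega, by omega, fun z => by omega⟩, fun z => by omega⟩
  refine Config.step (by omega) (0) [0, 1, 2] [-4, -3, -1] [1, 2] [-4, -3] (fun t ht => ?_) ?_
  · simp only [Free, Config, List.mem_cons, List.not_mem_nil, or_false, Apart]
    exact ⟨⟨by omega, by omega, fun z => by omega⟩, fun z => by omega⟩
  exact bad_five_aux

end RowFun

/-! ### Every two- and three-particle shape is obstructed -/

namespace RowFun

variable {p : ℤ} {U V : List ℤ}

theorem bad_two_of_pred (hp : 5 ≤ p) {u : ℤ} (hu : 0 ≤ u) (hu' : u < p) :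
    Bad p (Config [u, u + p - 1] [u - p, u - 1 - p]) := by
  by_cases h0 : u = 0
  · subst h0
    simpa using bad_two_pred_zero hp
  by_cases h1 : u = 1
  · subst h1
    simpa using bad_two_pred_one hp
  by_cases h2 : u = p - 1
  · subst h2
    have := bad_two_pred_last hp (p - 2).toNat (by omega)
    rw [Int.toNat_of_nonneg (by omega)] at this
    rwa [show p - 1 + p - 1 = p + (p - 2) by ring, show p - 1 - p = -1 by ring,
      show p - 1 - 1 - p = -2 by ring]
  · exact bad_two_pred hp (by omega) (by omega)

theorem bad_two_of_succ (hp : 5 ≤ p) {u : ℤ} (hu : 0 ≤ u) (hu' : u < p - 1) :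
    Bad p (Config [u, u + p + 1] [u - p, u + 1 - p]) := by
  by_cases h0 : u = 0
  · subst h0
    simpa using bad_two_succ_zero hp
  by_cases h2 : u = p - 2
  · subst h2
    have := bad_two_slide hp (p - 2).toNat (by omega)
    rw [Int.toNat_of_nonneg (by omega)] at this
    rwa [show p - 2 + p + 1 = 2 * p - 1 by ring, show p - 2 - p = -2 by ring,
      show p - 2 + 1 - p = -1 by ring]
  · exact bad_two_succ hp (by omega) (by omega)

/-- If the residues of `u` and `w` are not adjacent, one of the two hooks obstructs by itself, apart
from two extreme configurations. The adjacent cases `w = u + 1` and `w = u - 1` are conjugate to `w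
= u + p - 1` and `w = u + p + 1`. -/
theorem bad_two (hp : 5 ≤ p) {u w : ℤ} (hu : 0 ≤ u) (hu' : u < p) (hw : 0 ≤ w) (hw' : w < 2 * p)
    (h1 : w ≠ u) (h2 : w ≠ u + p) : Bad p (Config [u, w] [u - p, w - 2 * p]) := by
  by_cases h3 : w = u + p + 1
  · subst h3
    rw [show u + p + 1 - 2 * p = u + 1 - p by ring]
    exact bad_two_of_succ hp hu (by omega)
  by_cases h4 : w = u + p - 1
  · subst h4
    rw [show u + p - 1 - 2 * p = u - 1 - p by ring]
    exact bad_two_of_pred hp hu (by omega)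
  by_cases h5 : w = u + 1
  · subst h5
    refine Config.conj (by simp; omega) (by simp; omega) ?_
    simp only [List.map_cons, List.map_nil]
    have := bad_two_of_pred hp (u := p - 1 - u) (by omega) (by omega)
    convert this using 3 <;> ring_nf
  by_cases h6 : w = u - 1
  · subst h6
    refine Config.conj (by simp; omega) (by simp; omega) ?_
    simp only [List.map_cons, List.map_nil]
    have := bad_two_of_succ hp (u := p - 1 - u) (by omega) (by omega)
    convert this using 3 <;> ring_nf
  by_cases h7 : 0 < u ∧ u < p - 1
  · exact bad_two_of_apart hp h7.1 h7.2 hw hw' ⟨h1, h2, h5, h6, h3, h4⟩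
  by_cases h8 : u = 0 ∧ w = 2 * p - 1
  · rw [h8.1, h8.2, zero_sub, show 2 * p - 1 - 2 * p = -1 by ring]
    exact bad_two_outer hp
  by_cases h9 : u = p - 1 ∧ w = 0
  · rw [h9.1, h9.2, zero_sub, show p - 1 - p = -1 by ring]
    exact bad_two_inner hp
  · exact bad_two_of_apart' hp (by omega) (by omega) (by omega) ⟨h1, h2, h5, h6, h3, h4⟩

theorem bad_three_of_pair_zero (hp : 5 ≤ p) {i : ℤ} (hi : 1 < i) (hi' : i < p - 1) :
    Bad p (Config [0, i, i + 1] [-p, i - p, i + 1 - p]) := by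
  have := bad_three_slide hp hi hi' (p - 2 - i).toNat (by omega)
  rwa [Int.toNat_of_nonneg (by omega), show -1 - (p - 2 - i) = i + 1 - p by ring] at this

theorem Config.congr {U' V' : List ℤ} (hU : ∀ z, z ∈ U ↔ z ∈ U') (hV : ∀ z, z ∈ V ↔ z ∈ V')
    (h : Bad p (Config U V)) : Bad p (Config U' V') :=
  h.congr fun z => by simp only [Config, hU, hV]

theorem bad_three_of_consec (hp : p = 5 ∨ 7 ≤ p) {i : ℤ} (hi : 0 ≤ i) (hi' : i < p - 2) :
    Bad p (Config [i, i + 1, i + 2] [i - p, i + 1 - p, i + 2 - p]) := by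
  have hz (hp : p = 5 ∨ 7 ≤ p) : Bad p (Config [0, 1, 2] [-p, 1 - p, 2 - p]) := by
    rcases hp with rfl | hp
    · exact bad_five_zero
    · exact bad_three_consec_zero hp
  by_cases h0 : i = 0
  · subst h0
    simpa using hz hp
  by_cases h3 : i = p - 3
  · subst h3
    refine Config.conj (by simp; omega) (by simp; omega) ?_
    refine Config.congr (fun z => ?_) (fun z => ?_) (hz hp) <;>
      simp only [List.map_cons, List.map_nil, List.mem_cons, List.not_mem_nil, or_false] <;> omega
  by_cases h1 : i = 1
  · subst h1
    rcases hp with rfl | hp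
    · simpa using bad_five_one
    · simpa using bad_three_consec_one hp
  by_cases h2 : i = 2
  · subst h2
    simpa using bad_three_consec_two (p := p) (by omega)
  exact bad_three_consec (by omega) (by omega) (by omega)

/-- A particle that has no neighbour and is not at an end of the range obstructs directly. What is
left is an adjacent pair with the third particle at the far end, or three consecutive particles. -/
theorem bad_three (hp : p = 5 ∨ 7 ≤ p) {a b c : ℤ} (ha : 0 ≤ a) (hab : a < b) (hbc : b < c)
    (hc : c < p) : Bad p (Config [a, b, c] [a - p, b - p, c - p]) := by
  have hp5 : 5 ≤ p := by omega
  by_cases hb : b ≠ a + 1 ∧ c ≠ b + 1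
  · refine Config.congr (fun z => ?_) (fun z => ?_) (bad_three_of_apart hp5 (a := b) (b := a)
      (c := c) (by omega) (by omega) (by omega) (by omega) (by omega) (by omega) (by omega)) <;>
    simp only [List.mem_cons, List.not_mem_nil] <;> tauto
  by_cases hb' : b ≠ a + 1 ∧ 0 < a
  · exact bad_three_of_apart hp5 (by omega) (by omega) (by omega) (by omega) (by omega) (by omega)
      (by omega)
  by_cases hc' : c ≠ b + 1 ∧ c < p - 1
  · refine Config.congr (fun z => ?_) (fun z => ?_) (bad_three_of_apart hp5 (a := c) (b := a)
      (c := b) (by omega) (by omega) (by omega) (by omega) (by omega) (by omega) (by omega)) <;>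
    simp only [List.mem_cons, List.not_mem_nil] <;> tauto
  by_cases h1 : b = a + 1
  · subst h1
    by_cases h2 : c = a + 2
    · subst h2
      exact bad_three_of_consec hp ha (by omega)
    · obtain rfl : c = p - 1 := by omega
      refine Config.conj (by simp; omega) (by simp; omega) ?_
      refine Config.congr (fun z => ?_) (fun z => ?_)
        (bad_three_of_pair_zero hp5 (i := p - 2 - a) (by omega) (by omega)) <;>
        simp only [List.map_cons, List.map_nil, List.mem_cons, List.not_mem_nil, or_false] <;> omega
  · obtain rfl : a = 0 := by omega
    obtain rfl : c = b + 1 := by omega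
    simpa using bad_three_of_pair_zero hp5 (i := b) (by omega) (by omega)

end RowFun

namespace RowFun

open Finset

/-! ### Rim hooks meet every residue class once -/

section RimHook

variable {p : ℕ}

/-- The content of a node. -/
def nodeContent (c : ℕ × ℕ) : ℤ := (c.2 : ℤ) - c.1

/-- Of two nodes on one diagonal, the upper one has its diagonal successor in the diagram, so it is
not on the rim. -/
theorem nodeContent_injOn_rim (lam : YoungDiagram) : Set.InjOn nodeContent lam.rim := by
  have key (a b : ℕ × ℕ) (ha : a ∈ lam.rim) (hb : b ∈ lam.rim)
      (h : nodeContent a = nodeContent b) : b.1 ≤ a.1 := by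
    by_contra! h1
    rw [YoungDiagram.rim, mem_filter] at ha hb
    refine ha.2 (lam.up_left_mem (i2 := b.1) (j2 := b.2) h1 ?_ hb.1)
    simp only [nodeContent] at h
    omega
  intro a ha b hb h
  have h1 := key a b ha hb h
  have h2 := key b a hb ha h.symm
  simp only [nodeContent] at h
  exact Prod.ext (by omega) (by omega)

theorem exists_nodeContent_eq {h : Finset (ℕ × ℕ)} {a b : ℕ × ℕ}
    (hab : Relation.ReflTransGen (fun x y => x ∈ h ∧ y ∈ h ∧ NodeAdj x y) a b) (ha : a ∈ h)
    {z : ℤ} (h1 : nodeContent a ≤ z) (h2 : z ≤ nodeContent b) : ∃ x ∈ h, nodeContent x = z := by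
  induction hab with
  | refl => exact ⟨a, ha, by omega⟩
  | @tail b c _ hbc ih =>
    by_cases hz : z ≤ nodeContent b
    · exact ih hz
    · refine ⟨c, hbc.2.1, ?_⟩
      have := hbc.2.2
      simp only [NodeAdj, nodeContent] at this hz h2 ⊢
      omega

theorem residue_injOn_of_connected {lam : YoungDiagram} {h : Finset (ℕ × ℕ)} (hr : h ⊆ lam.rim)
    (hc : h.card = p) (hcon : NodesConnected h) :
    Set.InjOn (fun c => (nodeContent c : ZMod p)) h := by
  have hinj : Set.InjOn nodeContent h := (nodeContent_injOn_rim lam).mono (by exact_mod_cast hr)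
  have key (a b : ℕ × ℕ) (ha : a ∈ h) (hb : b ∈ h)
      (hab : (nodeContent a : ZMod p) = nodeContent b) (hlt : nodeContent a < nodeContent b) :
      False := by
    have hd : (p : ℤ) ∣ nodeContent b - nodeContent a :=
      (ZMod.intCast_eq_intCast_iff_dvd_sub _ _ _).mp hab
    have hle := Int.le_of_dvd (by omega) hd
    -- Contents change by one along a path, so all values in between occur. Endpoints at least `p`
    -- apart would give more than `p` distinct contents.
    have hsub : Icc (nodeContent a) (nodeContent b) ⊆ h.image nodeContent := by
      intro z hz
      rw [mem_Icc] at hz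
      obtain ⟨x, hx, rfl⟩ := exists_nodeContent_eq (hcon a ha b hb) ha hz.1 hz.2
      exact mem_image_of_mem _ hx
    have := card_le_card hsub
    rw [card_image_of_injOn hinj, hc, Int.card_Icc] at this
    omega
  intro a ha b hb hab
  rcases lt_trichotomy (nodeContent a) (nodeContent b) with h1 | h1 | h1
  · exact (key a b ha hb hab h1).elim
  · exact hinj ha hb h1
  · exact (key b a hb ha hab.symm h1).elim

/-- The number of nodes with content in a given residue class. -/
def residueCount (p : ℕ) (lam : YoungDiagram) (r : ZMod p) : ℕ :=
  #{c ∈ lam.cells | (nodeContent c : ZMod p) = r}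

theorem residueCount_of_removesRimHook (hp : 0 < p) {lam mu : YoungDiagram}
    (h : RemovesRimHook p lam mu) (r : ZMod p) :
    residueCount p lam r = residueCount p mu r + 1 := by
  have : NeZero p := ⟨hp.ne'⟩
  obtain ⟨h, hr, hc, hcon, hmu⟩ := h
  have hinj := residue_injOn_of_connected hr hc hcon
  have himg : h.image (fun c => (nodeContent c : ZMod p)) = univ := by
    rw [← card_eq_iff_eq_univ, card_image_of_injOn hinj, hc, ZMod.card]
  have h1 : #{c ∈ h | (nodeContent c : ZMod p) = r} = 1 := by
    obtain ⟨x, hx, rfl⟩ := mem_image.mp (himg ▸ mem_univ r)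
    rw [card_eq_one]
    refine ⟨x, ?_⟩
    ext y
    rw [mem_filter, mem_singleton]
    constructor
    · rintro ⟨hy, hxy⟩
      exact hinj hy hx hxy
    · rintro rfl
      exact ⟨hx, rfl⟩
  have hsub : h ⊆ lam.cells := hr.trans (filter_subset _ _)
  rw [residueCount, residueCount, hmu, ← h1, ← card_union_of_disjoint, ← filter_union,
    sdiff_union_of_subset hsub]
  exact disjoint_filter_filter sdiff_disjoint

theorem residueCount_eq_of_isPCore (hp : 0 < p) {lam : YoungDiagram} (h : IsPCore p lam ⊥)
    (r s : ZMod p) : residueCount p lam r = residueCount p lam s := by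
  have h1 := h.1
  induction h1 using Relation.ReflTransGen.head_induction_on with
  | refl => simp [residueCount]
  | head h2 _ ih =>
    rw [residueCount_of_removesRimHook hp h2, residueCount_of_removesRimHook hp h2, ih ⟨‹_›, h.2⟩]

end RimHook

/-! ### Row counts, and beads by residue class -/

section Rows

variable {M : Type*} [AddCommMonoid M]

theorem sum_cells (lam : YoungDiagram) (f : ℕ × ℕ → M) :
    ∑ c ∈ lam.cells, f c =
      ∑ i ∈ range (lam.colLen 0), ∑ j ∈ range (lam.rowLen i), f (i, j) := by
  rw [sum_sigma']
  refine (sum_bij' (fun x _ => (x.1, x.2)) (fun c _ => ⟨c.1, c.2⟩) ?_ ?_ ?_ ?_ ?_).symm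
  · intro x hx
    rw [mem_sigma, mem_range, mem_range] at hx
    exact (YoungDiagram.mem_cells _).mpr (YoungDiagram.mem_iff_lt_rowLen.mpr hx.2)
  · intro c hc
    rw [YoungDiagram.mem_cells] at hc
    rw [mem_sigma, mem_range, mem_range]
    exact ⟨YoungDiagram.mem_iff_lt_colLen.mp (lam.up_left_mem le_rfl (Nat.zero_le c.2) hc),
      YoungDiagram.mem_iff_lt_rowLen.mp hc⟩
  all_goals intros; rfl

theorem rowLen_eq_zero {lam : YoungDiagram} {i : ℕ} : lam.rowLen i = 0 ↔ lam.colLen 0 ≤ i := by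
  rw [← not_lt, ← YoungDiagram.mem_iff_lt_colLen, YoungDiagram.mem_iff_lt_rowLen]
  omega

theorem card_eq_sum_rowLen (lam : YoungDiagram) :
    lam.card = ∑ i ∈ range (lam.colLen 0), lam.rowLen i := by
  rw [YoungDiagram.card, card_eq_sum_ones, sum_cells]
  simp

theorem rowLens_eq_singleton {lam : YoungDiagram} {n : ℕ} (hn : 0 < n) (hc : lam.card = n) :
    lam.rowLens = [n] ↔ lam.rowLen 0 = n := by
  have h0 := card_eq_sum_rowLen lam
  constructor
  · intro h
    have h1 : lam.colLen 0 = 1 := by rw [← YoungDiagram.length_rowLens, h]; rfl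
    rw [h1, sum_range_one] at h0
    omega
  · intro h
    have h1 : lam.colLen 0 = 1 := by
      have h2 : ¬ lam.colLen 0 ≤ 0 := by rw [← rowLen_eq_zero]; omega
      have h3 : lam.colLen 0 ≤ 1 := by
        rw [← rowLen_eq_zero]
        by_contra h4
        have h5 : 1 < lam.colLen 0 := by rw [← not_le, ← rowLen_eq_zero]; exact h4
        have h6 : ∑ i ∈ range 2, lam.rowLen i ≤ ∑ i ∈ range (lam.colLen 0), lam.rowLen i :=
          sum_le_sum_of_subset (range_subset_range.mpr h5)
        rw [sum_range_succ, sum_range_one] at h6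
        omega
      omega
    rw [YoungDiagram.rowLens, h1]
    simp [h]

theorem rowLens_eq_replicate {lam : YoungDiagram} {n : ℕ} (hn : 0 < n) (hc : lam.card = n) :
    lam.rowLens = List.replicate n 1 ↔ lam.rowLen 0 = 1 := by
  have h0 := card_eq_sum_rowLen lam
  rw [List.eq_replicate_iff]
  constructor
  · rintro ⟨h1, h2⟩
    refine h2 _ (List.mem_map.mpr ⟨0, ?_, rfl⟩)
    rw [List.mem_range, ← YoungDiagram.length_rowLens, h1]
    exact hn
  · intro h
    have h2 (i) (hi : i < lam.colLen 0) : lam.rowLen i = 1 := by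
      have h3 := lam.rowLen_anti 0 i (Nat.zero_le i)
      have h4 := rowLen_eq_zero.not.mpr (not_le.mpr hi)
      omega
    rw [sum_congr rfl fun i hi => h2 i (mem_range.mp hi), sum_const, card_range, smul_eq_mul,
      mul_one] at h0
    refine ⟨by rw [YoungDiagram.length_rowLens]; omega, fun b hb => ?_⟩
    obtain ⟨i, hi, rfl⟩ := List.mem_map.mp hb
    exact h2 i (List.mem_range.mp hi)

/-- Along a row, nodes of residue `r + 1` follow nodes of residue `r`, so the counts differ only at
the ends: the position before the first node and the content of the last node. -/
theorem row_residue (p m i : ℕ) (r : ZMod p) :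
    (∑ j ∈ range m, if (((j : ℤ) - i : ℤ) : ZMod p) = r then (1 : ℤ) else 0) +
      (if ((-i - 1 : ℤ) : ZMod p) = r then 1 else 0) =
    (∑ j ∈ range m, if (((j : ℤ) - i : ℤ) : ZMod p) = r + 1 then (1 : ℤ) else 0) +
      (if ((m - i - 1 : ℤ) : ZMod p) = r then 1 else 0) := by
  induction m with
  | zero => simp
  | succ m ih =>
    rw [sum_range_succ, sum_range_succ]
    have h1 : (((m : ℤ) - i : ℤ) : ZMod p) = r + 1 ↔ ((m - i - 1 : ℤ) : ZMod p) = r := by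
      push_cast
      constructor <;> intro h <;> linear_combination h
    have h2 : ((m + 1 : ℕ) - i - 1 : ℤ) = m - i := by
      push_cast
      ring
    rw [if_congr h1 rfl rfl, h2]
    linarith

/-- An empty core makes all residue counts equal. Summing `row_residue` over the rows then leaves
only the end terms: beads of `lam` against beads of the empty partition. -/
theorem card_bead_residue {p : ℕ} (hp : 0 < p) {lam : YoungDiagram} (h : IsPCore p lam ⊥)
    (r : ZMod p) :
    #{i ∈ range (lam.colLen 0) | (bead lam.rowLen i : ZMod p) = r} =
      #{i ∈ range (lam.colLen 0) | ((-((i : ℕ) : ℤ) - 1 : ℤ) : ZMod p) = r} := by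
  have h1 (r : ZMod p) : (residueCount p lam r : ℤ) = ∑ i ∈ range (lam.colLen 0),
      ∑ j ∈ range (lam.rowLen i), if (((j : ℤ) - i : ℤ) : ZMod p) = r then (1 : ℤ) else 0 := by
    rw [residueCount, card_filter, sum_cells]
    simp only [nodeContent]
    push_cast
    rfl
  have h2 := residueCount_eq_of_isPCore hp h r (r + 1)
  rw [← Nat.cast_inj (R := ℤ), h1, h1] at h2
  have h3 := sum_congr rfl fun i (_ : i ∈ range (lam.colLen 0)) => row_residue p (lam.rowLen i) i r
  rw [sum_add_distrib, sum_add_distrib, h2, add_right_inj] at h3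
  rw [← Nat.cast_inj (R := ℤ), card_filter, card_filter]
  push_cast
  simp only [bead]
  push_cast at h3 ⊢
  exact h3.symm

end Rows

/-! ### Classification of the configurations of weight three -/

section Balanced

/-- Two finite sets of integers have the same number of elements in each residue class. -/
def Balanced (p : ℕ) (U V : Finset ℤ) : Prop :=
  ∀ r : ZMod p, #{u ∈ U | ((u : ℤ) : ZMod p) = r} = #{v ∈ V | ((v : ℤ) : ZMod p) = r}

theorem Balanced.card_eq {p : ℕ} (hp : 0 < p) {U V : Finset ℤ} (h : Balanced p U V) :
    #U = #V := by
  have : NeZero p := ⟨hp.ne'⟩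
  rw [card_eq_sum_card_fiberwise (f := fun u : ℤ => ((u : ℤ) : ZMod p)) (t := univ) (by simp),
    card_eq_sum_card_fiberwise (s := V) (f := fun u : ℤ => ((u : ℤ) : ZMod p)) (t := univ)
      (by simp)]
  exact sum_congr rfl fun r _ => h r

theorem card_le_sum_sub_sum {U V : Finset ℤ}
    (hU : ∀ u ∈ U, 0 ≤ u) (hV : ∀ v ∈ V, v < 0) : (#V : ℤ) ≤ ∑ u ∈ U, u - ∑ v ∈ V, v := by
  have h1 : 0 ≤ ∑ u ∈ U, u := sum_nonneg hU
  have h2 : ∑ v ∈ V, v ≤ ∑ v ∈ V, (-1) := sum_le_sum fun v hv => by have := hV v hv; omega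
  rw [sum_const, smul_neg, nsmul_one] at h2
  linarith

theorem Balanced.eq_empty {p : ℕ} (hp : 0 < p) {U V : Finset ℤ} (h : Balanced p U V)
    (hU : ∀ u ∈ U, 0 ≤ u) (hV : ∀ v ∈ V, v < 0) (h0 : ∑ u ∈ U, u - ∑ v ∈ V, v = 0) :
    U = ∅ ∧ V = ∅ := by
  have h1 := card_le_sum_sub_sum hU hV
  have h2 := h.card_eq hp
  rw [h0] at h1
  have h3 : #V = 0 := by omega
  exact ⟨card_eq_zero.mp (by omega), card_eq_zero.mp h3⟩

/-- Balance supplies a hole in the class of any chosen particle. Their distance is a positive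
multiple of `p`, and the remaining weight cannot be negative, which bounds it by `m`. -/
theorem Balanced.exists_pair {p : ℕ} (hp : 0 < p) {U V : Finset ℤ} (h : Balanced p U V)
    (hU : ∀ u ∈ U, 0 ≤ u) (hV : ∀ v ∈ V, v < 0) {m : ℤ} (hm : 0 < m)
    (h0 : ∑ u ∈ U, u - ∑ v ∈ V, v = p * m) :
    ∃ u ∈ U, ∃ v ∈ V, ∃ k : ℤ, u - v = p * k ∧ 0 < k ∧ k ≤ m ∧ Balanced p (U.erase u) (V.erase v) ∧
      ∑ u ∈ U.erase u, u - ∑ v ∈ V.erase v, v = p * (m - k) := by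
  have hpz : (0 : ℤ) < p := by exact_mod_cast hp
  have hne : U.Nonempty := by
    rw [nonempty_iff_ne_empty]
    rintro rfl
    have := h.card_eq hp
    rw [card_empty, eq_comm, card_eq_zero] at this
    subst this
    have := mul_pos hpz hm
    simp at h0
    omega
  obtain ⟨u, hu⟩ := hne
  have h1 : 0 < #{v ∈ V | ((v : ℤ) : ZMod p) = u} := by
    rw [← h, card_pos]
    exact ⟨u, mem_filter.mpr ⟨hu, rfl⟩⟩
  obtain ⟨v, hv⟩ := card_pos.mp h1
  rw [mem_filter] at hv
  obtain ⟨k, hk⟩ := (ZMod.intCast_eq_intCast_iff_dvd_sub _ _ _).mp hv.2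
  have hb : Balanced p (U.erase u) (V.erase v) := by
    intro r
    rw [filter_erase, filter_erase]
    by_cases hr : ((u : ℤ) : ZMod p) = r
    · rw [card_erase_of_mem (mem_filter.mpr ⟨hu, hr⟩),
        card_erase_of_mem (mem_filter.mpr ⟨hv.1, hv.2.trans hr⟩), h]
    · have hu' : u ∉ {u ∈ U | ((u : ℤ) : ZMod p) = r} := fun h => hr (mem_filter.mp h).2
      have hv' : v ∉ {v ∈ V | ((v : ℤ) : ZMod p) = r} := fun h =>
        hr (hv.2.symm.trans (mem_filter.mp h).2)
      rw [erase_eq_of_notMem hu', erase_eq_of_notMem hv', h]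
  have hs : ∑ u ∈ U.erase u, u - ∑ v ∈ V.erase v, v = p * (m - k) := by
    have h2 := add_sum_erase U (fun u => u) hu
    have h3 := add_sum_erase V (fun v => v) hv.1
    rw [mul_sub, ← hk, ← h0]
    linarith
  have hU' : ∀ x ∈ U.erase u, 0 ≤ x := fun x hx => hU x (mem_of_mem_erase hx)
  have hV' : ∀ x ∈ V.erase v, x < 0 := fun x hx => hV x (mem_of_mem_erase hx)
  have h2 := card_le_sum_sub_sum hU' hV'
  have h3 := hU u hu
  have h4 := hV v hv.1
  refine ⟨u, hu, v, hv.1, k, hk, ?_, ?_, hb, hs⟩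
  · by_contra! h5
    nlinarith
  · by_contra! h5
    rw [hs] at h2
    nlinarith

/-- The particles and holes of a bead configuration of weight three with empty core. -/
inductive Shape (p : ℤ) : Finset ℤ → Finset ℤ → Prop
  | one (u : ℤ) (h0 : 0 ≤ u) (h1 : u < 3 * p) : Shape p {u} {u - 3 * p}
  | two (u w : ℤ) (h0 : 0 ≤ u) (h1 : u < p) (h2 : 0 ≤ w) (h3 : w < 2 * p) (h4 : w ≠ u)
      (h5 : w ≠ u + p) : Shape p {u, w} {u - p, w - 2 * p}
  | three (a b c : ℤ) (h0 : 0 ≤ a) (h1 : a < b) (h2 : b < c) (h3 : c < p) :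
      Shape p {a, b, c} {a - p, b - p, c - p}

theorem shape_three {p a b c : ℤ} (ha : 0 ≤ a) (hb : 0 ≤ b) (hc : 0 ≤ c) (ha' : a < p)
    (hb' : b < p) (hc' : c < p) (hab : a ≠ b) (hac : a ≠ c) (hbc : b ≠ c) :
    Shape p {a, b, c} {a - p, b - p, c - p} := by
  have key (x y z : ℤ) (hx : 0 ≤ x) (hxy : x < y) (hyz : y < z) (hz : z < p)
      (h : ∀ t : ℤ, (t = x ∨ t = y ∨ t = z) ↔ (t = a ∨ t = b ∨ t = c)) :
      Shape p {a, b, c} {a - p, b - p, c - p} := by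
    have h1 := Shape.three (p := p) x y z hx hxy hyz hz
    have e1 : ({x, y, z} : Finset ℤ) = {a, b, c} := by
      ext t
      simpa using h t
    have e2 : ({x - p, y - p, z - p} : Finset ℤ) = {a - p, b - p, c - p} := by
      ext t
      simpa [eq_sub_iff_add_eq] using h (t + p)
    rwa [e1, e2] at h1
  rcases lt_or_gt_of_ne hab with h1 | h1 <;> rcases lt_or_gt_of_ne hac with h2 | h2 <;>
    rcases lt_or_gt_of_ne hbc with h3 | h3
  · exact key a b c ha h1 h3 hc' fun t => by tauto
  · exact key a c b ha h2 h3 hb' fun t => by tauto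
  · omega
  · exact key c a b hc h2 h1 hb' fun t => by tauto
  · exact key b a c hb h1 h2 hc' fun t => by tauto
  · omega
  · exact key b c a hb h3 h2 ha' fun t => by tauto
  · exact key c b a hc h3 h1 ha' fun t => by tauto

/-- Repeated pairing partitions the weight 3 as `3`, `2 + 1` or `1 + 1 + 1`, giving the three
families. -/
theorem Balanced.shape {p : ℕ} (hp : 0 < p) {U V : Finset ℤ} (h : Balanced p U V)
    (hU : ∀ u ∈ U, 0 ≤ u) (hV : ∀ v ∈ V, v < 0) (h0 : ∑ u ∈ U, u - ∑ v ∈ V, v = p * 3) :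
    Shape p U V := by
  obtain ⟨u, hu, v, hv, k, hk, hk0, hk3, hb, hs⟩ := h.exists_pair hp hU hV (by norm_num) h0
  have hU' : ∀ x ∈ U.erase u, 0 ≤ x := fun x hx => hU x (mem_of_mem_erase hx)
  have hV' : ∀ x ∈ V.erase v, x < 0 := fun x hx => hV x (mem_of_mem_erase hx)
  have hu0 := hU u hu
  have hv0 := hV v hv
  by_cases hk' : k = 3
  · subst hk'
    obtain ⟨e1, e2⟩ := hb.eq_empty hp hU' hV' (by rw [hs]; ring)
    have f1 : U = {u} := by rw [← insert_erase hu, e1]; rfl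
    have f2 : V = {u - 3 * p} := by
      rw [← insert_erase hv, e2, show u - 3 * (p : ℤ) = v by linarith]; rfl
    rw [f1, f2]
    exact Shape.one u hu0 (by linarith)
  obtain ⟨u', hu', v', hv', k', hk'', hk'0, hk'm, hb', hs'⟩ :=
    hb.exists_pair hp hU' hV' (show 0 < 3 - k by omega) hs
  have hU'' : ∀ x ∈ (U.erase u).erase u', 0 ≤ x := fun x hx => hU' x (mem_of_mem_erase hx)
  have hV'' : ∀ x ∈ (V.erase v).erase v', x < 0 := fun x hx => hV' x (mem_of_mem_erase hx)
  have hu'0 := hU' u' hu'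
  have hv'0 := hV' v' hv'
  have hu'u : u' ≠ u := ne_of_mem_erase hu'
  have hv'v : v' ≠ v := ne_of_mem_erase hv'
  by_cases hkk : k + k' = 3
  · obtain ⟨e1, e2⟩ := hb'.eq_empty hp hU'' hV'' (by rw [hs', show 3 - k - k' = 0 by omega]; ring)
    have f1 : U = {u, u'} := by rw [← insert_erase hu, ← insert_erase hu', e1]; rfl
    have f2 : V = {v, v'} := by rw [← insert_erase hv, ← insert_erase hv', e2]; rfl
    have : k = 1 ∧ k' = 2 ∨ k = 2 ∧ k' = 1 := by omega
    rcases this with ⟨rfl, rfl⟩ | ⟨rfl, rfl⟩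
    · have h1 := Shape.two (p := p) u u' hu0 (by linarith) hu'0 (by linarith) hu'u
        (fun h => hv'v (by linarith))
      rwa [f1, f2, show v = u - p by linarith, show v' = u' - 2 * p by linarith]
    · have h1 := Shape.two (p := p) u' u hu'0 (by linarith) hu0 (by linarith) hu'u.symm
        (fun h => hv'v (by linarith))
      rwa [f1, f2, show v' = u' - p by linarith, show v = u - 2 * p by linarith, pair_comm u u',
        pair_comm (u - 2 * p) (u' - (p : ℤ))]
  · obtain rfl : k = 1 := by omega
    obtain rfl : k' = 1 := by omega
    obtain ⟨w, hw, z, hz, k'', hkw, hkw0, hkwm, hbw, hsw⟩ :=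
      hb'.exists_pair hp hU'' hV'' (by norm_num) hs'
    obtain rfl : k'' = 1 := by omega
    obtain ⟨e1, e2⟩ := hbw.eq_empty hp (fun x hx => hU'' x (mem_of_mem_erase hx))
      (fun x hx => hV'' x (mem_of_mem_erase hx)) (by rw [hsw]; ring)
    have f1 : U = {u, u', w} := by
      rw [← insert_erase hu, ← insert_erase hu', ← insert_erase hw, e1]; rfl
    have f2 : V = {v, v', z} := by
      rw [← insert_erase hv, ← insert_erase hv', ← insert_erase hz, e2]; rfl
    have hw0 := hU'' w hw
    have hz0 := hV'' z hz
    have h1 : w ≠ u' := ne_of_mem_erase hw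
    have h2 : w ≠ u := ne_of_mem_erase (mem_of_mem_erase hw)
    rw [f1, f2, show v = u - p by linarith, show v' = u' - p by linarith,
      show z = w - p by linarith]
    exact shape_three hu0 hu'0 hw0 (by linarith) (by linarith) (by linarith) hu'u.symm h2.symm
      h1.symm

end Balanced

/-- Compare the beads `B` of the nonempty rows with the beads `A` of as many empty rows. The
differences are the particles and the holes, and the two sums of positions differ by the size of the
diagram. -/
theorem exists_shape {p : ℕ} (hp : 0 < p) {lam : YoungDiagram} (hcard : lam.card = 3 * p)
    (h : IsPCore p lam ⊥) :
    ∃ U V, Shape p U V ∧ ∀ z, (∃ j, bead lam.rowLen j = z) ↔ (z < 0 ∧ z ∉ V) ∨ z ∈ U := by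
  set M := lam.colLen 0 with hM
  have hl : Antitone lam.rowLen := fun i j => lam.rowLen_anti i j
  have hinj := (bead_strictAnti hl).injective
  set B := (range M).image (bead lam.rowLen) with hB
  set A := (range M).image (fun i : ℕ => -(i : ℤ) - 1) with hA
  have hinjA : Function.Injective fun i : ℕ => -(i : ℤ) - 1 := fun i j h => by
    simp only at h
    omega
  have hAmem (z : ℤ) : z ∈ A ↔ z < 0 ∧ -M ≤ z := by
    rw [hA, mem_image]
    constructor
    · rintro ⟨i, hi, rfl⟩
      rw [mem_range] at hi
      omega
    · intro hz
      exact ⟨(-z - 1).toNat, by rw [mem_range]; omega, by omega⟩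
  have hBlow (z) (hz : z ∈ B) : -(M : ℤ) ≤ z := by
    obtain ⟨i, hi, rfl⟩ := mem_image.mp hz
    rw [mem_range] at hi
    simp only [bead]
    omega
  have hX (z : ℤ) : (∃ j, bead lam.rowLen j = z) ↔ z ∈ B ∨ z < -M := by
    constructor
    · rintro ⟨j, rfl⟩
      by_cases hj : j < M
      · exact Or.inl (mem_image_of_mem _ (mem_range.mpr hj))
      · right
        have := (rowLen_eq_zero (lam := lam)).mpr (not_lt.mp hj)
        simp only [bead]
        omega
    · rintro (hz | hz)
      · obtain ⟨i, -, rfl⟩ := mem_image.mp hz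
        exact ⟨i, rfl⟩
      · refine ⟨(-z - 1).toNat, ?_⟩
        have := (rowLen_eq_zero (lam := lam)).mpr (show lam.colLen 0 ≤ (-z - 1).toNat by omega)
        simp only [bead]
        omega
  have hbal : Balanced p (B \ A) (A \ B) := by
    intro r
    have h1 : #{b ∈ B | ((b : ℤ) : ZMod p) = r} = #{a ∈ A | ((a : ℤ) : ZMod p) = r} := by
      rw [hB, hA, filter_image, filter_image, card_image_of_injective _ hinj,
        card_image_of_injective _ hinjA]
      exact card_bead_residue hp h r
    have h2 (S T : Finset ℤ) :
        #{x ∈ S \ T | ((x : ℤ) : ZMod p) = r} + #{x ∈ S ∩ T | ((x : ℤ) : ZMod p) = r} =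
        #{x ∈ S | ((x : ℤ) : ZMod p) = r} := by
      rw [← card_union_of_disjoint, ← filter_union, sdiff_union_inter]
      exact disjoint_filter_filter (disjoint_sdiff_inter S T)
    have h3 := h2 B A
    have h4 := h2 A B
    rw [inter_comm] at h4
    omega
  have hsum : ∑ u ∈ B \ A, u - ∑ v ∈ A \ B, v = p * 3 := by
    have h1 : ∑ b ∈ B, b - ∑ a ∈ A, a = p * 3 := by
      rw [hB, hA, sum_image hinj.injOn, sum_image hinjA.injOn, ← sum_sub_distrib]
      have h2 := card_eq_sum_rowLen lam
      rw [hcard, ← Nat.cast_inj (R := ℤ)] at h2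
      push_cast at h2
      rw [mul_comm, h2]
      refine sum_congr rfl fun i _ => ?_
      simp only [bead]
      ring
    have h2 := sum_inter_add_sum_sdiff B A (fun x => x)
    have h3 := sum_inter_add_sum_sdiff A B (fun x => x)
    rw [inter_comm] at h3
    linarith
  refine ⟨B \ A, A \ B, hbal.shape hp ?_ ?_ hsum, fun z => ?_⟩
  · intro u hu
    rw [mem_sdiff, hAmem] at hu
    have := hBlow u hu.1
    omega
  · intro v hv
    rw [mem_sdiff, hAmem] at hv
    exact hv.1.1
  · rw [hX, mem_sdiff, mem_sdiff, hAmem]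
    have := hBlow z
    by_cases hz : z ∈ B
    · simp only [hz, true_or, not_true, and_false, not_false_eq_true, and_true, true_and, true_iff]
      omega
    · simp only [hz, false_or, not_false_eq_true, and_true, false_and, or_false]
      omega

end RowFun

namespace RowFun

open Finset

/-! ### Hook lengths from beads, and the JM condition -/

section HookLengths

variable {lam : YoungDiagram}

/-- Vacancies play the role for columns that beads play for rows. The column of `v` has index `v +
i0`, where `i0` is the number of beads above `v` and hence the length of the column. -/
theorem exists_column_of_vacant {v : ℤ} (hv : ¬ ∃ i, bead lam.rowLen i = v) :
    ∃ j, ∀ i, ((i, j) ∈ lam ↔ v < bead lam.rowLen i) ∧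
      ((i, j) ∈ lam → (lam.hookLength i j : ℤ) = bead lam.rowLen i - v) := by
  have hl : Antitone lam.rowLen := fun i j => lam.rowLen_anti i j
  have hex : ∃ i, bead lam.rowLen i < v := by
    refine ⟨lam.colLen 0 + (-v).toNat, ?_⟩
    have := (rowLen_eq_zero (lam := lam)).mpr (Nat.le_add_right (lam.colLen 0) (-v).toNat)
    rw [bead, this]
    omega
  obtain ⟨i0, h1, h2⟩ : ∃ i0, bead lam.rowLen i0 < v ∧ ∀ i < i0, v < bead lam.rowLen i := by
    classical
    refine ⟨Nat.find hex, Nat.find_spec hex, fun i hi => ?_⟩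
    have := Nat.find_min hex hi
    exact lt_of_le_of_ne (not_lt.mp this) fun h => hv ⟨i, h.symm⟩
  have h3 (i) : v < bead lam.rowLen i ↔ i < i0 := by
    refine ⟨fun h => ?_, h2 i⟩
    by_contra! h4
    have := (bead_strictAnti hl).antitone h4
    omega
  have hj : ((v + i0).toNat : ℤ) = v + i0 := by
    rw [bead] at h1
    omega
  have h4 (i) : (i, (v + i0).toNat) ∈ lam ↔ i < i0 := by
    rw [YoungDiagram.mem_iff_lt_rowLen]
    constructor
    · intro h
      by_contra! h4
      have := hl h4
      rw [bead] at h1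
      omega
    · intro h
      obtain ⟨k, rfl⟩ : ∃ k, i0 = k + 1 := ⟨i0 - 1, by omega⟩
      have h5 := h2 k (Nat.lt_succ_self k)
      have := hl (Nat.le_of_lt_succ h)
      rw [bead] at h5
      omega
  have h5 : lam.colLen (v + i0).toNat = i0 := by
    have h6 (i) : i < lam.colLen (v + i0).toNat ↔ i < i0 := by
      rw [← YoungDiagram.mem_iff_lt_colLen, h4]
    have h7 := h6 i0
    have h8 := h6 (lam.colLen (v + i0).toNat)
    omega
  refine ⟨(v + i0).toNat, fun i => ⟨by rw [h4, h3], fun h => ?_⟩⟩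
  rw [YoungDiagram.hookLength, h5, bead]
  have h6 := (h4 i).mp h
  have h7 := YoungDiagram.mem_iff_lt_rowLen.mp h
  omega

/-- The hook of `u` over `v` is divisible by `p`, while the row of `u` and the column of `v` each
contain a hook that is not. -/
theorem not_isJM {p : ℕ} (hp : p.Prime) {u u' v v' : ℤ} (hu : ∃ i, bead lam.rowLen i = u)
    (hu' : ∃ i, bead lam.rowLen i = u') (hv : ¬ ∃ i, bead lam.rowLen i = v)
    (hv' : ¬ ∃ i, bead lam.rowLen i = v') (h1 : v < u) (h2 : v' < u) (h3 : v < u')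
    (hd : (p : ℤ) ∣ u - v) (hd' : ¬ (p : ℤ) ∣ u - v') (hd'' : ¬ (p : ℤ) ∣ u' - v) :
    ¬ lam.IsJM p := by
  have : Fact p.Prime := ⟨hp⟩
  obtain ⟨i, rfl⟩ := hu
  obtain ⟨i', rfl⟩ := hu'
  obtain ⟨j, hj⟩ := exists_column_of_vacant hv
  obtain ⟨j', hj'⟩ := exists_column_of_vacant hv'
  have m1 := (hj i).1.mpr h1
  have m2 := (hj' i).1.mpr h2
  have m3 := (hj i').1.mpr h3
  have e1 := (hj i).2 m1
  have e2 := (hj' i).2 m2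
  have e3 := (hj i').2 m3
  rw [← e1, Int.natCast_dvd_natCast] at hd
  rw [← e2, Int.natCast_dvd_natCast] at hd'
  rw [← e3, Int.natCast_dvd_natCast] at hd''
  have p1 : 1 ≤ lam.powerEntry p i j :=
    one_le_padicValNat_of_dvd (by rw [YoungDiagram.hookLength]; omega) hd
  have p2 : lam.powerEntry p i j' = 0 := padicValNat.eq_zero_of_not_dvd hd'
  have p3 : lam.powerEntry p i' j = 0 := padicValNat.eq_zero_of_not_dvd hd''
  intro h
  rcases h i j m1 p1 with h | h
  · have := h j' m2
    omega
  · have := h i' m3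
    omega

theorem isJM_of_rowLen_zero_eq_card {p : ℕ} (h : lam.rowLen 0 = lam.card) : lam.IsJM p := by
  intro i j hij _
  right
  intro i' hi'
  have h0 (i) (h1 : (i, j) ∈ lam) : i = 0 := by
    by_contra h2
    have h3 := (lam.up_left_mem (Nat.zero_le 1) (Nat.zero_le j) (lam.up_left_mem
      (show 1 ≤ i by omega) le_rfl h1))
    have h4 : 1 < lam.colLen 0 := YoungDiagram.mem_iff_lt_colLen.mp
      (lam.up_left_mem (show 1 ≤ i by omega) (Nat.zero_le j) h1)
    have h5 := card_eq_sum_rowLen lam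
    have h6 : ∑ i ∈ range 2, lam.rowLen i ≤ ∑ i ∈ range (lam.colLen 0), lam.rowLen i :=
      sum_le_sum_of_subset (range_subset_range.mpr h4)
    rw [sum_range_succ, sum_range_one] at h6
    have h7 := rowLen_eq_zero.not.mpr (not_le.mpr h4)
    omega
  rw [h0 i hij, h0 i' hi']

theorem isJM_of_rowLen_zero_eq_one {p : ℕ} (h : lam.rowLen 0 = 1) : lam.IsJM p := by
  intro i j hij _
  left
  intro j' hj'
  have h0 (j) (h1 : (i, j) ∈ lam) : j = 0 := by
    have := YoungDiagram.mem_iff_lt_rowLen.mp h1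
    have := lam.rowLen_anti 0 i (Nat.zero_le i)
    omega
  rw [h0 j hij, h0 j' hj']

end HookLengths

theorem Shape.bad {p : ℤ} (hp : p = 5 ∨ 7 ≤ p) {U V : Finset ℤ} (h : Shape p U V) {X : ℤ → Prop}
    (hX : ∀ z, X z ↔ (z < 0 ∧ z ∉ V) ∨ z ∈ U) (h0 : U ≠ {0}) (h1 : U ≠ {3 * p - 1}) :
    Bad p X := by
  have hp5 : 5 ≤ p := by omega
  cases h with
  | one u hu hu' =>
    have h2 : u ≠ 0 := fun h => h0 (by rw [h])
    have h3 : u ≠ 3 * p - 1 := fun h => h1 (by rw [h])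
    exact (bad_one hp5 (u := u) (by omega) (by omega)).congr fun z => by simp [hX, Config]
  | two u w hu hu' hw hw' h2 h3 =>
    exact (bad_two hp5 hu hu' hw hw' h2 h3).congr fun z => by simp [hX, Config]
  | three a b c ha hab hbc hc =>
    exact (bad_three hp ha hab hbc hc).congr fun z => by simp [hX, Config]

theorem Shape.not_isJM {p : ℕ} (hp : p.Prime) (hp5 : 5 ≤ p) {lam : YoungDiagram} {U V : Finset ℤ}
    (h : Shape p U V) (hX : ∀ z, (∃ j, bead lam.rowLen j = z) ↔ (z < 0 ∧ z ∉ V) ∨ z ∈ U)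
    (h0 : U ≠ {0}) (h1 : U ≠ {(3 * p - 1 : ℤ)}) : ¬ lam.IsJM p := by
  have hd (a : ℤ) (h1 : Apart p a) (h2 : a ≠ 0) : ¬ (p : ℤ) ∣ a := fun h =>
    h2 (h1.eq_zero (by omega) h)
  cases h with
  | one u hu hu' =>
    have h2 : u ≠ 0 := fun h => h0 (by rw [h])
    have h3 : u ≠ 3 * p - 1 := fun h => h1 (by rw [h])
    refine RowFun.not_isJM hp (u := u) (v := u - 3 * p) (u' := u - 3 * p + 1) (v' := u - 1) ?_ ?_ ?_
      ?_ (by omega) (by omega) (by omega) ⟨3, by ring⟩ (hd _ ?_ (by omega)) (hd _ ?_ (by omega))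
    all_goals simp only [hX, Finset.mem_singleton, Apart, or_true, not_true, and_false, false_or]
    all_goals omega
  | two u w hu hu' hw hw' h2 h3 =>
    -- The second particle and its hole lie in another residue class, so both mixed hooks are prime
    -- to `p`.
    refine RowFun.not_isJM hp (u := u) (v := u - p) (u' := w) (v' := w - 2 * p) ?_ ?_ ?_
      ?_ (by omega) (by omega) (by omega) ⟨1, by ring⟩ (hd _ ?_ (by omega)) (hd _ ?_ (by omega))
    all_goals simp only [hX, Finset.mem_singleton, Finset.mem_insert, Apart, true_or, or_true,
      not_true, and_false, false_or]
    all_goals omega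
  | three a b c ha hab hbc hc =>
    refine RowFun.not_isJM hp (u := a) (v := a - p) (u' := b) (v' := b - p) ?_ ?_ ?_
      ?_ (by omega) (by omega) (by omega) ⟨1, by ring⟩ (hd _ ?_ (by omega)) (hd _ ?_ (by omega))
    all_goals simp only [hX, Finset.mem_singleton, Finset.mem_insert, Apart, true_or, or_true,
      not_true, and_false, false_or]
    all_goals omega

theorem rowLen_zero_of_shape {lam : YoungDiagram} {U V : Finset ℤ} {u : ℤ} (hu : 0 ≤ u)
    (hX : ∀ z, (∃ j, bead lam.rowLen j = z) ↔ (z < 0 ∧ z ∉ V) ∨ z ∈ U) (hU : U = {u}) :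
    (lam.rowLen 0 : ℤ) = u + 1 := by
  have hl : Antitone lam.rowLen := fun i j => lam.rowLen_anti i j
  subst hU
  have h1 := (hX _).mp ⟨0, rfl⟩
  obtain ⟨j, hj⟩ := (hX u).mpr (Or.inr (Finset.mem_singleton_self u))
  have h2 := (bead_strictAnti hl).antitone (Nat.zero_le j)
  rw [Finset.mem_singleton] at h1
  rw [hj] at h2
  simp only [bead] at h1 h2
  omega

theorem bad_and_not_isJM {p : ℕ} (hp : p.Prime) (hp5 : 5 ≤ p) {lam : YoungDiagram}
    (hcard : lam.card = 3 * p) (hcore : IsPCore p lam ⊥) (h0 : lam.rowLen 0 ≠ 1)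
    (h1 : lam.rowLen 0 ≠ 3 * p) :
    Bad p (fun z => ∃ j, bead lam.rowLen j = z) ∧ ¬ lam.IsJM p := by
  obtain ⟨U, V, hs, hX⟩ := exists_shape hp.pos hcard hcore
  have h2 : U ≠ {0} := fun h => h0 (by have := rowLen_zero_of_shape le_rfl hX h; omega)
  have h3 : U ≠ {(3 * p - 1 : ℤ)} := fun h =>
    h1 (by have := rowLen_zero_of_shape (by omega) hX h; omega)
  -- The chains of moves cover `5` and everything from `7` on.
  have h6 : p ≠ 6 := by
    rintro rfl
    exact absurd hp (by norm_num)
  exact ⟨hs.bad (by omega) hX h2 h3, hs.not_isJM hp hp5 hX h2 h3⟩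

theorem isJM_iff {p : ℕ} (hp : p.Prime) (hp5 : 5 ≤ p) {lam : YoungDiagram}
    (hcard : lam.card = 3 * p) (hcore : IsPCore p lam ⊥) :
    lam.IsJM p ↔ lam.rowLen 0 = 3 * p ∨ lam.rowLen 0 = 1 := by
  constructor
  · intro h
    by_contra! h1
    exact (bad_and_not_isJM hp hp5 hcard hcore h1.2 h1.1).2 h
  · rintro (h | h)
    · exact isJM_of_rowLen_zero_eq_card (h.trans hcard.symm)
    · exact isJM_of_rowLen_zero_eq_one h

end RowFun

namespace RowFun

open Module

/-! ### Self-duality from density and traces -/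

section Density

variable {F G V : Type*} [Field F] [Group G] [AddCommGroup V] [Module F V] [FiniteDimensional F V]
  (ρ : Representation F G V)

/-- When the commutant consists of scalars, every linear map commutes with it, and Jacobson density
realizes that map on a finite basis. -/
theorem asAlgebraHom_surjective [IsSimpleModule (MonoidAlgebra F G) ρ.asModule]
    (hend : ∀ φ : V →ₗ[F] V, (∀ g x, φ (ρ g x) = ρ g (φ x)) → ∃ c : F, ∀ x, φ x = c • x) :
    Function.Surjective ρ.asAlgebraHom := by
  classical
  intro f
  let f' : End (End (MonoidAlgebra F G) ρ.asModule) ρ.asModule :=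
    { toFun := fun x => ρ.asModuleEquiv.symm (f (ρ.asModuleEquiv x))
      map_add' := fun x y => by simp
      map_smul' := fun φ x => by
        obtain ⟨c, hc⟩ := hend (ρ.asModuleEquiv.toLinearMap ∘ₗ (φ.restrictScalars F) ∘ₗ
          ρ.asModuleEquiv.symm.toLinearMap) fun g x => by
            simp only [LinearMap.comp_apply, LinearEquiv.coe_coe, LinearMap.coe_restrictScalars]
            rw [ρ.asModuleEquiv_symm_map_rho, map_smul, ρ.asModuleEquiv_map_smul,
              ρ.asAlgebraHom_of]
        have hc' (y : ρ.asModule) : φ y = c • y := by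
          simpa using congrArg ρ.asModuleEquiv.symm (hc (ρ.asModuleEquiv y))
        change ρ.asModuleEquiv.symm (f (ρ.asModuleEquiv (φ x))) =
          φ (ρ.asModuleEquiv.symm (f (ρ.asModuleEquiv x)))
        rw [hc', hc', map_smul, map_smul, map_smul] }
  let b := finBasis F V
  obtain ⟨a, ha⟩ := jacobson_density f'
    (Finset.univ.image fun i => ρ.asModuleEquiv.symm (b i))
  refine ⟨a, b.ext fun i => ?_⟩
  have h := ha _ (Finset.mem_image_of_mem _ (Finset.mem_univ i))
  have h2 := congrArg ρ.asModuleEquiv h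
  rw [ρ.asModuleEquiv_map_smul] at h2
  simpa [f'] using h2.symm

theorem trace_dual_asAlgebraHom (htr : ∀ g, LinearMap.trace F V (ρ g⁻¹) = LinearMap.trace F V (ρ g))
    (a : MonoidAlgebra F G) :
    LinearMap.trace F (Dual F V) (ρ.dual.asAlgebraHom a) =
      LinearMap.trace F V (ρ.asAlgebraHom a) := by
  induction a using MonoidAlgebra.induction_on with
  | of g =>
    rw [ρ.dual.asAlgebraHom_of, ρ.asAlgebraHom_of, ← htr g, Representation.dual_apply]
    exact LinearMap.trace_transpose' _
  | add a b ha hb => rw [map_add, map_add, map_add, map_add, ha, hb]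
  | smul c a ha => rw [map_smul, map_smul, map_smul, map_smul, ha]

theorem dual_asAlgebraHom_surjective (h : Function.Surjective ρ.asAlgebraHom) :
    Function.Surjective ρ.dual.asAlgebraHom := by
  have key (a : MonoidAlgebra F G) :
      ∃ b, ρ.dual.asAlgebraHom b = Dual.transpose (R := F) (ρ.asAlgebraHom a) := by
    induction a using MonoidAlgebra.induction_on with
    | of g =>
      refine ⟨MonoidAlgebra.of F G g⁻¹, ?_⟩
      rw [ρ.dual.asAlgebraHom_of, ρ.asAlgebraHom_of, Representation.dual_apply, inv_inv]
    | add a b ha hb =>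
      obtain ⟨a', ha⟩ := ha
      obtain ⟨b', hb⟩ := hb
      exact ⟨a' + b', by rw [map_add, map_add, map_add, ha, hb]⟩
    | smul c a ha =>
      obtain ⟨a', ha⟩ := ha
      exact ⟨c • a', by rw [map_smul, map_smul, map_smul, ha]⟩
  intro f
  obtain ⟨g, hg⟩ : ∃ g : V →ₗ[F] V, Dual.transpose (R := F) g = f := by
    let e := evalEquiv F V
    refine ⟨e.symm.toLinearMap ∘ₗ Dual.transpose (R := F) f ∘ₗ e.toLinearMap, ?_⟩
    ext φ x
    simp [e, Dual.transpose_apply]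
  obtain ⟨a, rfl⟩ := h g
  obtain ⟨b, hb⟩ := key a
  exact ⟨b, hb.trans hg⟩

theorem eq_zero_of_trace_mul {f : V →ₗ[F] V}
    (h : ∀ g : V →ₗ[F] V, LinearMap.trace F V (f * g) = 0) :
    f = 0 := by
  ext x
  by_contra hx
  obtain ⟨φ, hφ⟩ : ∃ φ : Dual F V, φ (f x) ≠ 0 := by
    by_contra! h1
    exact hx ((forall_dual_apply_eq_zero_iff F (f x)).mp h1)
  have h1 := h (φ.smulRight x)
  have h2 : f * φ.smulRight x = φ.smulRight (f x) := by
    ext y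
    simp
  rw [h2, LinearMap.trace_smulRight] at h1
  exact hφ h1

/-- A representation that generates all endomorphisms and in which every element has the same
trace as its inverse carries an invariant nondegenerate bilinear form. -/
theorem exists_invariant_form [Nontrivial V] (h : Function.Surjective ρ.asAlgebraHom)
    (htr : ∀ g, LinearMap.trace F V (ρ g⁻¹) = LinearMap.trace F V (ρ g)) :
    ∃ B : V →ₗ[F] V →ₗ[F] F, (∀ g x y, B (ρ g x) (ρ g y) = B x y) ∧ Function.Injective B := by
  -- Products of the dual image of `a` with dual operators have the same traces as products in `V`,
  -- namely zero, and the trace form on endomorphisms is nondegenerate.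
  have hker (a) (ha : ρ.asAlgebraHom a = 0) : ρ.dual.asAlgebraHom a = 0 := by
    refine eq_zero_of_trace_mul fun g => ?_
    obtain ⟨b, rfl⟩ := dual_asAlgebraHom_surjective ρ h g
    rw [← map_mul, trace_dual_asAlgebraHom ρ htr, map_mul, ha, zero_mul, map_zero]
  obtain ⟨s, hs⟩ := ρ.asAlgebraHom.toLinearMap.exists_rightInverse_of_surjective
    (LinearMap.range_eq_top.mpr h)
  -- By `hker` the dual action factors through the endomorphisms of `V`; this is the induced
  -- multiplicative map.
  let θ : (V →ₗ[F] V) →ₗ[F] (Dual F V →ₗ[F] Dual F V) := ρ.dual.asAlgebraHom.toLinearMap ∘ₗ s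
  have hθ (a) : θ (ρ.asAlgebraHom a) = ρ.dual.asAlgebraHom a := by
    rw [← sub_eq_zero]
    change ρ.dual.asAlgebraHom (s (ρ.asAlgebraHom a)) - ρ.dual.asAlgebraHom a = 0
    refine (map_sub ρ.dual.asAlgebraHom _ _).symm.trans (hker _ ?_)
    rw [map_sub, sub_eq_zero]
    exact LinearMap.congr_fun hs (ρ.asAlgebraHom a)
  have hmul (f g : V →ₗ[F] V) : θ (f * g) = θ f * θ g := by
    obtain ⟨a, rfl⟩ := h f
    obtain ⟨b, rfl⟩ := h g
    rw [← map_mul, hθ, hθ, hθ, map_mul]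
  obtain ⟨v0, hv0⟩ := exists_ne (0 : V)
  obtain ⟨φ, hφ⟩ : ∃ φ : Dual F V, φ v0 ≠ 0 := by
    by_contra! h1
    exact hv0 ((forall_dual_apply_eq_zero_iff F v0).mp h1)
  have hθ0 : θ (φ.smulRight v0) ≠ 0 := by
    intro h1
    obtain ⟨a, ha⟩ := h (φ.smulRight v0)
    rw [← ha, hθ] at h1
    have h2 := trace_dual_asAlgebraHom ρ htr a
    rw [h1, map_zero, ha, LinearMap.trace_smulRight] at h2
    exact hφ h2.symm
  obtain ⟨ψ, hψ⟩ : ∃ ψ, θ (φ.smulRight v0) ψ ≠ 0 := by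
    by_contra! h1
    exact hθ0 (LinearMap.ext h1)
  -- The rank-one maps with fixed `φ` form a copy of `V` as a left ideal. Applying their images
  -- under `θ` to `ψ` gives an equivariant map to the dual, nonzero by the choice of `ψ`.
  let B : V →ₗ[F] V →ₗ[F] F :=
    { toFun := fun x => θ (φ.smulRight x) ψ
      map_add' := fun x y => by
        have : φ.smulRight (x + y) = φ.smulRight x + φ.smulRight y := by ext; simp
        rw [this, map_add, LinearMap.add_apply]
      map_smul' := fun c x => by
        have : φ.smulRight (c • x) = c • φ.smulRight x := by ext; simp [smul_comm c]
        rw [this, map_smul, LinearMap.smul_apply, RingHom.id_apply] }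
  have hB (f : V →ₗ[F] V) (x : V) : B (f x) = θ f (B x) := by
    have : φ.smulRight (f x) = f * φ.smulRight x := by ext; simp
    change θ (φ.smulRight (f x)) ψ = θ f (θ (φ.smulRight x) ψ)
    rw [this, hmul, Module.End.mul_apply]
  refine ⟨B, fun g x y => ?_, ?_⟩
  · rw [hB, ← ρ.asAlgebraHom_of g, hθ, ρ.dual.asAlgebraHom_of, ρ.asAlgebraHom_of,
      Representation.dual_apply, Dual.transpose_apply, LinearMap.comp_apply, ← Module.End.mul_apply,
      ← map_mul, inv_mul_cancel, map_one, Module.End.one_apply]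
  · rw [injective_iff_map_eq_zero]
    intro x hx
    by_contra hx0
    obtain ⟨χ, hχ⟩ : ∃ χ : Dual F V, χ x ≠ 0 := by
      by_contra! h1
      exact hx0 ((forall_dual_apply_eq_zero_iff F x).mp h1)
    have h1 : (χ.smulRight ((χ x)⁻¹ • v0) : V →ₗ[F] V) x = v0 := by
      simp [smul_smul, hχ]
    have h2 := hB (χ.smulRight ((χ x)⁻¹ • v0)) x
    rw [h1, hx, map_zero] at h2
    exact hψ h2

end Density

end RowFun

namespace RowFun

open Finset Equiv Module

/-! ### Endomorphisms of the Specht module are scalars -/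

section GarnirRep

variable {F : Type*} [Field F] {n : ℕ} {l : ℕ → ℕ}

/-- The representation of the symmetric group on `garnir F l n`. -/
def garnirRep (F : Type*) [Field F] (l : ℕ → ℕ) (n : ℕ) :
    Representation F (Perm (Fin n)) (garnir F l n) where
  toFun g := (permMap F g).restrict fun _ hx => permMap_mem g hx
  map_one' := rfl
  map_mul' g h := LinearMap.ext fun x => Subtype.ext (permMap_mul g h x.1)

theorem finiteDimensional_garnir {M : ℕ} (hM : ∀ i, M ≤ i → l i = 0) :
    FiniteDimensional F (garnir F l n) := by
  let f : garnir F l n →ₗ[F] ((Fin n → Fin M) → F) :=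
    { toFun := fun x r => x.1 fun a => r a
      map_add' := fun _ _ => rfl
      map_smul' := fun _ _ => rfl }
  refine Module.Finite.of_injective f ((injective_iff_map_eq_zero f).mpr fun x hx => ?_)
  refine Subtype.ext (funext fun r => ?_)
  by_contra hr
  have h1 (a) : r a < M := by
    by_contra! h2
    have h3 := content_eq x.2 hr (r a)
    rw [hM _ h2, card_eq_zero] at h3
    exact (Finset.eq_empty_iff_forall_notMem.mp h3) a (by simp)
  exact hr (congrFun hx fun a => ⟨r a, h1 a⟩)

theorem trace_garnirRep_inv (g : Perm (Fin n)) :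
    LinearMap.trace F (garnir F l n) (garnirRep F l n g⁻¹) =
      LinearMap.trace F (garnir F l n) (garnirRep F l n g) := by
  obtain ⟨h, hh⟩ := isConj_iff.mp
    (Perm.isConj_of_cycleType_eq (Perm.cycleType_inv g) : IsConj g⁻¹ g)
  conv_rhs => rw [← hh, map_mul, LinearMap.trace_mul_comm, ← map_mul, ← mul_assoc, inv_mul_cancel,
    one_mul]

theorem IsTableau.exists_perm {R C r c : Fin n → ℕ} (h : IsTableau l R C)
    (hlt : ∀ a, c a < l (r a)) (hinj : ∀ a b, r a = r b → c a = c b → a = b) :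
    ∃ σ : Perm (Fin n), r = R ∘ σ ∧ c = C ∘ σ := by
  choose f hf using fun a => h.surj (r a) (c a) (hlt a)
  have hf' : Function.Injective f := fun a b hab =>
    hinj a b (by rw [← (hf a).1, hab, (hf b).1]) (by rw [← (hf a).2, hab, (hf b).2])
  refine ⟨Equiv.ofBijective f (Finite.injective_iff_bijective.mp hf'), ?_, ?_⟩
  · exact funext fun a => (hf a).1.symm
  · exact funext fun a => (hf a).2.symm

theorem card_col_lt_le (hl : Antitone l) {R C r : Fin n → ℕ} (h : IsTableau l R C)
    (hr : ∀ a b, C a = C b → r a = r b → a = b) (j k : ℕ) :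
    #{a | C a = j ∧ r a < k} ≤ #{a | C a = j ∧ R a < k} := by
  by_cases hk : ∀ i < k, j < l i
  · have h1 : #{a | C a = j ∧ r a < k} ≤ k := by
      rw [← card_range k]
      refine card_le_card_of_injOn r (fun a ha => ?_) fun a ha b hb hab => ?_
      · simp only [coe_filter, mem_univ, true_and, Set.mem_ofPred_eq] at ha
        simpa using ha.2
      · simp only [coe_filter, mem_univ, true_and, Set.mem_ofPred_eq] at ha hb
        exact hr a b (ha.1.trans hb.1.symm) hab
    have h2 : k ≤ #{a | C a = j ∧ R a < k} := by
      have h3 : range k ⊆ image R {a | C a = j ∧ R a < k} := by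
        intro i hi
        obtain ⟨a, ha, ha'⟩ := h.surj i j (hk i (mem_range.mp hi))
        refine mem_image.mpr ⟨a, ?_, ha⟩
        simp [ha, ha', mem_range.mp hi]
      calc k = #(range k) := (card_range k).symm
        _ ≤ _ := card_le_card h3
        _ ≤ _ := card_image_le
    omega
  · push Not at hk
    obtain ⟨i, hi, hij⟩ := hk
    refine card_le_card fun a ha => ?_
    simp only [mem_filter, mem_univ, true_and] at ha ⊢
    refine ⟨ha.1, ?_⟩
    by_contra! h1
    have h2 := h.lt a
    have h3 := hl (hi.le.trans h1)
    omega

/-- A dominance count. In each column, at most as many letters lie above a given row for `r` as for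
`R`, and the totals over all columns agree. A letter placed too low would make the inequality strict
in its column. -/
theorem lt_of_injective_on_columns (hl : Antitone l) {R C r : Fin n → ℕ} (h : IsTableau l R C)
    (hc : ∀ i, #{a | r a = i} = l i) (hr : ∀ a b, C a = C b → r a = r b → a = b) (a : Fin n) :
    C a < l (r a) := by
  by_contra! h1
  have hsum (s : Fin n → ℕ) (hs : ∀ i, #{a | s a = i} = l i) (k : ℕ) :
      ∑ j ∈ image C univ, #{a | C a = j ∧ s a < k} = ∑ i ∈ range k, l i := by
    have h2 : #{a | s a < k} = ∑ i ∈ range k, l i := by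
      rw [card_eq_sum_card_fiberwise (f := s) (t := range k) (fun a ha => by simpa using ha)]
      refine sum_congr rfl fun i hi => ?_
      rw [← hs i, filter_filter]
      congr 1
      ext a
      simp only [mem_filter, mem_univ, true_and, and_iff_right_iff_imp]
      rintro rfl
      exact mem_range.mp hi
    rw [← h2, card_eq_sum_card_fiberwise (f := C) (t := image C univ)
      (fun a _ => by simp)]
    refine sum_congr rfl fun j _ => ?_
    rw [filter_filter]
    congr 1
    ext a
    simp [and_comm]
  have h2 : ∑ j ∈ image C univ, #{b | C b = j ∧ r b < r a} <
      ∑ j ∈ image C univ, #{b | C b = j ∧ R b < r a} := by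
    refine sum_lt_sum (fun j _ => card_col_lt_le hl h hr j _)
      ⟨C a, mem_image_of_mem _ (mem_univ a), ?_⟩
    refine card_lt_card ?_
    rw [ssubset_iff_of_subset]
    · refine ⟨a, ?_, by simp⟩
      simp only [mem_filter, mem_univ, true_and]
      by_contra! h3
      have h4 := h.lt a
      have h5 := hl h3
      omega
    · intro b hb
      simp only [mem_filter, mem_univ, true_and] at hb ⊢
      refine ⟨hb.1, ?_⟩
      by_contra! h3
      have h4 := h.lt b
      have h5 := hl h3
      omega
  rw [hsum r hc, hsum R h.card_row] at h2
  exact lt_irrefl _ h2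

theorem IsTableau.permMap_self {R C : Fin n → ℕ} {c : Perm (Fin n)} (hc : ∀ a, C (c a) = C a) :
    permMap F c (polyFun F R C) = ((Perm.sign c : ℤ) : F) • polyFun F R C := by
  funext r
  rw [permMap_apply, Pi.smul_apply, smul_eq_mul]
  exact polyFun_comp hc r

/-- Subtracting the multiple of the polytabloid leaves an antisymmetric `z` vanishing at `R`.
Antisymmetry confines its support to assignments that separate the letters of each column. These are
column permutations of `R`, where `z` equals `z R` up to sign. -/
theorem IsTableau.eq_smul_polyFun (h2 : (2 : F) ≠ 0) (hl : Antitone l) {R C : Fin n → ℕ}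
    (h : IsTableau l R C) {y : Fn F n} (hy : y ∈ garnir F l n)
    (hanti : ∀ c : Perm (Fin n), (∀ a, C (c a) = C a) →
      permMap F c y = ((Perm.sign c : ℤ) : F) • y) : y = y R • polyFun F R C := by
  have hz : y - y R • polyFun F R C ∈ garnir F l n :=
    sub_mem hy (Submodule.smul_mem _ _ (h.polyFun_mem h2 hl))
  rw [← sub_eq_zero]
  set z := y - y R • polyFun F R C with hzd
  have hz0 : z R = 0 := by
    rw [hzd, Pi.sub_apply, Pi.smul_apply, h.polyFun_self, smul_eq_mul, mul_one, sub_self]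
  have hza (c : Perm (Fin n)) (hc : ∀ a, C (c a) = C a) (r : Fin n → ℕ) :
      z (r ∘ c) = ((Perm.sign c : ℤ) : F) * z r := by
    have : permMap F c z = ((Perm.sign c : ℤ) : F) • z := by
      rw [hzd, map_sub, map_smul, hanti c hc, IsTableau.permMap_self hc, smul_sub, smul_comm]
    exact congrFun this r
  funext r
  by_contra hr
  have hinj (a b : Fin n) (hab : C a = C b) (hrab : r a = r b) : a = b := by
    by_contra hne
    have h3 := hza (swap a b) (fun c => by
      rcases eq_or_ne c a with rfl | hca
      · rw [swap_apply_left, hab]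
      rcases eq_or_ne c b with rfl | hcb
      · rw [swap_apply_right, hab]
      · rw [swap_apply_of_ne_of_ne hca hcb]) r
    have h4 : r ∘ swap a b = r := by
      funext c
      rw [Function.comp_apply]
      rcases eq_or_ne c a with rfl | hca
      · rw [swap_apply_left, hrab]
      rcases eq_or_ne c b with rfl | hcb
      · rw [swap_apply_right, hrab]
      · rw [swap_apply_of_ne_of_ne hca hcb]
    rw [h4, Perm.sign_swap hne] at h3
    have h5 : 2 * z r = 0 := by
      push_cast at h3
      linear_combination h3
    exact hr ((mul_eq_zero.mp h5).resolve_left h2)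
  obtain ⟨σ, hσ, hσ'⟩ := h.exists_perm (lt_of_injective_on_columns hl h (content_eq hz hr) hinj)
    fun a b h1 h2 => hinj a b h2 h1
  rw [hσ, hza σ (fun a => (congrFun hσ' a).symm) R, hz0, mul_zero] at hr
  exact hr rfl

theorem IsTableau.polySpan_le_span {R C : Fin n → ℕ} (h : IsTableau l R C) :
    polySpan F l n ≤ Submodule.span F (Set.range fun g => permMap F g (polyFun F R C)) := by
  refine Submodule.span_le.mpr ?_
  rintro _ ⟨R', C', h', rfl⟩
  obtain ⟨σ, rfl, rfl⟩ := h.exists_perm h'.lt h'.inj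
  refine Submodule.subset_span ⟨σ⁻¹, ?_⟩
  simp only [permMap_polyFun, inv_inv]

/-- The image of a polytabloid is again antisymmetric under its column group, hence a multiple of
it, and the polytabloid generates the module. -/
theorem exists_scalar_of_commute (h2 : (2 : F) ≠ 0) (hl : Antitone l) {M : ℕ}
    (hM : ∀ i, M ≤ i → l i = 0) {R C : Fin n → ℕ} (h : IsTableau l R C)
    (φ : garnir F l n →ₗ[F] garnir F l n)
    (hφ : ∀ g x, φ (garnirRep F l n g x) = garnirRep F l n g (φ x)) :
    ∃ c : F, ∀ x, φ x = c • x := by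
  have he := h.polyFun_mem (F := F) h2 hl
  set e : garnir F l n := ⟨polyFun F R C, he⟩ with hedef
  have h1 := h.eq_smul_polyFun h2 hl (φ e).2 fun c hc => by
    have h3 : garnirRep F l n c e = ((Perm.sign c : ℤ) : F) • e :=
      Subtype.ext (IsTableau.permMap_self hc)
    have h4 := hφ c e
    rw [h3, map_smul] at h4
    exact (congrArg Subtype.val h4).symm
  refine ⟨(φ e).1 R, fun x => ?_⟩
  set c := (φ e).1 R
  have h3 : φ e = c • e := Subtype.ext h1
  have h4 := h.polySpan_le_span (F := F) (garnir_le_polySpan h2 hl hM x.2)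
  have key (y : Fn F n)
      (hy : y ∈ Submodule.span F (Set.range fun g => permMap F g (polyFun F R C))) :
      ∃ hy' : y ∈ garnir F l n, φ ⟨y, hy'⟩ = c • ⟨y, hy'⟩ := by
    induction hy using Submodule.span_induction with
    | mem y hy =>
      obtain ⟨g, rfl⟩ := hy
      refine ⟨permMap_mem g he, ?_⟩
      have h5 := hφ g e
      rw [h3, map_smul] at h5
      exact h5
    | zero => exact ⟨zero_mem _, by
        rw [show (⟨0, zero_mem _⟩ : garnir F l n) = 0 from rfl, map_zero, smul_zero]⟩
    | add y z _ _ hy hz =>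
      obtain ⟨hy, hy'⟩ := hy
      obtain ⟨hz, hz'⟩ := hz
      refine ⟨add_mem hy hz, ?_⟩
      rw [show (⟨y + z, add_mem hy hz⟩ : garnir F l n) = ⟨y, hy⟩ + ⟨z, hz⟩ from rfl, map_add, hy',
        hz', smul_add]
    | smul a y _ hy =>
      obtain ⟨hy, hy'⟩ := hy
      refine ⟨Submodule.smul_mem _ a hy, ?_⟩
      rw [show (⟨a • y, Submodule.smul_mem _ a hy⟩ : garnir F l n) = a • ⟨y, hy⟩ from rfl,
        map_smul, hy', smul_comm]
  exact (key x.1 h4).2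

theorem exists_isForm_of_isSimpleModule (h2 : (2 : F) ≠ 0) (hl : Antitone l) {M : ℕ}
    (hM : ∀ i, M ≤ i → l i = 0) {R C : Fin n → ℕ} (h : IsTableau l R C)
    [IsSimpleModule (MonoidAlgebra F (Perm (Fin n))) (garnirRep F l n).asModule] :
    ∃ B : Fn F n →ₗ[F] Fn F n →ₗ[F] F, IsForm l B := by
  have := finiteDimensional_garnir (F := F) (n := n) hM
  have : Nontrivial (garnir F l n) := by
    refine ⟨⟨⟨polyFun F R C, h.polyFun_mem h2 hl⟩, 0, fun h0 => ?_⟩⟩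
    have h1 := congrFun (congrArg Subtype.val h0) R
    change polyFun F R C R = 0 at h1
    rw [h.polyFun_self] at h1
    exact one_ne_zero h1
  obtain ⟨B, hB, hB'⟩ := exists_invariant_form (garnirRep F l n)
    (asAlgebraHom_surjective _ (exists_scalar_of_commute h2 hl hM h)) trace_garnirRep_inv
  obtain ⟨π, hπ⟩ := (garnir F l n).subtype.exists_leftInverse_of_injective
    (LinearMap.ker_eq_bot.mpr Subtype.val_injective)
  have hπ' (x) (hx : x ∈ garnir F l n) : π x = ⟨x, hx⟩ := LinearMap.congr_fun hπ ⟨x, hx⟩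
  refine ⟨B.compl₁₂ π π, fun g x hx y hy => ?_, fun x hx h0 => ?_⟩
  · rw [LinearMap.compl₁₂_apply, LinearMap.compl₁₂_apply, hπ' x hx, hπ' y hy,
      hπ' _ (permMap_mem g hx), hπ' _ (permMap_mem g hy)]
    exact hB g ⟨x, hx⟩ ⟨y, hy⟩
  · have h1 : B ⟨x, hx⟩ = 0 := by
      ext y
      have := h0 y.1 y.2
      rwa [LinearMap.compl₁₂_apply, hπ' x hx, hπ' _ y.2] at this
    have h3 := hB' (h1.trans (map_zero B).symm)
    exact congrArg Subtype.val h3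

end GarnirRep

end RowFun

namespace RowFun

open Finset Equiv Module

/-! ### Identification with the Specht module of tabloids -/

section Link

variable {F : Type*} [Field F] {lam : YoungDiagram} {n : ℕ}

/-- The row assignment of a tabloid. -/
def tabloidRow : Tabloid lam n → Fin n → ℕ :=
  Quotient.lift Tableau.rowOf fun _ _ h => funext h

theorem tabloidRow_tabloid (t : Tableau lam n) : tabloidRow t.tabloid = t.rowOf := rfl

theorem tabloidRow_injective : Function.Injective (tabloidRow (lam := lam) (n := n)) := by
  rintro ⟨t⟩ ⟨u⟩ h
  exact Quotient.sound (congrFun h)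

theorem tabloidRow_smul (g : Perm (Fin n)) (T : Tabloid lam n) :
    tabloidRow (g • T) = tabloidRow T ∘ ⇑g⁻¹ := by
  obtain ⟨t⟩ := T
  rfl

/-- The function on row assignments that a combination of tabloids defines. -/
noncomputable def toFn (F : Type*) [Field F] (lam : YoungDiagram) (n : ℕ) :
    MonoidAlgebra F (Tabloid lam n) →ₗ[F] Fn F n where
  toFun x := Function.extend tabloidRow x.coeff 0
  map_add' x y := by
    funext r
    by_cases hr : ∃ T : Tabloid lam n, tabloidRow T = r
    · obtain ⟨T, rfl⟩ := hr
      simp [tabloidRow_injective.extend_apply]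
    · simp [Function.extend_apply' _ _ _ hr]
  map_smul' c x := by
    funext r
    by_cases hr : ∃ T : Tabloid lam n, tabloidRow T = r
    · obtain ⟨T, rfl⟩ := hr
      simp [tabloidRow_injective.extend_apply]
    · simp [Function.extend_apply' _ _ _ hr]

theorem toFn_tabloidRow (x : MonoidAlgebra F (Tabloid lam n)) (T : Tabloid lam n) :
    toFn F lam n x (tabloidRow T) = x.coeff T :=
  tabloidRow_injective.extend_apply _ _ _

theorem toFn_injective : Function.Injective (toFn F lam n) := by
  intro x y h
  ext T
  rw [← toFn_tabloidRow, h, toFn_tabloidRow]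

open Classical in
theorem toFn_single (T : Tabloid lam n) (c : F) (r : Fin n → ℕ) :
    toFn F lam n (MonoidAlgebra.single T c) r = if tabloidRow T = r then c else 0 := by
  by_cases hr : ∃ U : Tabloid lam n, tabloidRow U = r
  · obtain ⟨U, rfl⟩ := hr
    rw [toFn_tabloidRow, MonoidAlgebra.coeff_single, Finsupp.single_apply]
    exact if_congr tabloidRow_injective.eq_iff.symm rfl rfl
  · rw [if_neg fun h => hr ⟨T, h⟩]
    exact Function.extend_apply' _ _ _ hr

theorem toFn_ofMulAction (g : Perm (Fin n)) (x : MonoidAlgebra F (Tabloid lam n)) :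
    toFn F lam n (Representation.ofMulAction F (Perm (Fin n)) (Tabloid lam n) g x) =
      permMap F g (toFn F lam n x) := by
  classical
  induction x using MonoidAlgebra.induction_linear with
  | zero => simp
  | add x y hx hy => rw [map_add, map_add, map_add, map_add, hx, hy]
  | single T c =>
    funext r
    rw [Representation.ofMulAction_single, toFn_single, permMap_apply, toFn_single, tabloidRow_smul]
    refine if_congr ?_ rfl rfl
    constructor
    · rintro rfl
      funext a
      simp
    · intro h
      rw [h]
      funext a
      simp

theorem isTableau_of_tableau (t : Tableau lam n) : IsTableau lam.rowLen t.rowOf t.colOf where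
  inj a b h1 h2 := t.entry.symm.injective (Subtype.ext (Prod.ext h1 h2))
  lt a := YoungDiagram.mem_iff_lt_rowLen.mp ((t.entry.symm a).2)
  surj i j h := by
    refine ⟨t.entry ⟨(i, j), YoungDiagram.mem_iff_lt_rowLen.mpr h⟩, ?_, ?_⟩
    · simp [Tableau.rowOf]
    · simp [Tableau.colOf]

theorem exists_tableau {R C : Fin n → ℕ} (h : IsTableau lam.rowLen R C) :
    ∃ t : Tableau lam n, t.rowOf = R ∧ t.colOf = C := by
  let f : Fin n → lam.cells := fun a => ⟨(R a, C a), YoungDiagram.mem_iff_lt_rowLen.mpr (h.lt a)⟩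
  have hf : Function.Bijective f := by
    constructor
    · intro a b hab
      have := congrArg Subtype.val hab
      exact h.inj a b (congrArg Prod.fst this) (congrArg Prod.snd this)
    · rintro ⟨⟨i, j⟩, hij⟩
      obtain ⟨a, rfl, rfl⟩ := h.surj i j (YoungDiagram.mem_iff_lt_rowLen.mp hij)
      exact ⟨a, rfl⟩
  exact ⟨⟨(Equiv.ofBijective f hf).symm⟩, rfl, rfl⟩

theorem toFn_polytabloid (t : Tableau lam n) :
    toFn F lam n (Representation.asModuleEquiv _ (polytabloid F t)) =
      polyFun F t.rowOf t.colOf := by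
  classical
  funext r
  rw [polytabloid, LinearEquiv.apply_symm_apply, map_sum, Finset.sum_apply, polyFun, sum_filter]
  -- Acting by `s` on a tableau precomposes its row function with the inverse of `s`; the sign is
  -- unaffected.
  refine sum_equiv (Equiv.inv _) (by simp) fun s _ => ?_
  rw [toFn_single, ← ite_and, tabloidRow_tabloid]
  refine if_congr (and_congr ?_ ?_) ?_ rfl
  · constructor
    · exact fun h => t.colStab.inv_mem h
    · intro h
      have : s⁻¹ ∈ t.colStab := h
      exact inv_mem_iff.mp this
  · exact ⟨fun h a => congrFun h a, fun h => funext h⟩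
  · simp

/-- The map from the permutation module on tabloids to functions on row assignments. -/
noncomputable def moduleToFn (F : Type*) [Field F] (lam : YoungDiagram) (n : ℕ) :
    TabloidModule F lam n →ₗ[F] Fn F n :=
  (toFn F lam n).comp (Representation.asModuleEquiv _).toLinearMap

theorem moduleToFn_single_smul (g : Perm (Fin n)) (c : F) (x : TabloidModule F lam n) :
    moduleToFn F lam n ((MonoidAlgebra.single g c : MonoidAlgebra F (Perm (Fin n))) • x) =
      c • permMap F g (moduleToFn F lam n x) := by
  rw [moduleToFn, LinearMap.comp_apply, LinearEquiv.coe_coe, Representation.asModuleEquiv_map_smul,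
    Representation.asAlgebraHom_single, LinearMap.smul_apply, map_smul, toFn_ofMulAction]
  rfl

theorem moduleToFn_mem (h2 : (2 : F) ≠ 0) {x : TabloidModule F lam n}
    (hx : x ∈ spechtModule F lam n) : moduleToFn F lam n x ∈ garnir F lam.rowLen n := by
  have hl : Antitone lam.rowLen := fun i j => lam.rowLen_anti i j
  induction hx using Submodule.span_induction with
  | mem x hx =>
    obtain ⟨t, rfl⟩ := hx
    rw [moduleToFn, LinearMap.comp_apply, LinearEquiv.coe_coe, toFn_polytabloid]
    exact (isTableau_of_tableau t).polyFun_mem h2 hl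
  | zero => rw [map_zero]; exact zero_mem _
  | add x y _ _ hx hy => rw [map_add]; exact add_mem hx hy
  | smul a x _ hx =>
    induction a using MonoidAlgebra.induction_linear with
    | zero => rw [zero_smul, map_zero]; exact zero_mem _
    | add a b ha hb => rw [add_smul, map_add]; exact add_mem ha hb
    | single g c =>
      rw [moduleToFn_single_smul]
      exact Submodule.smul_mem _ _ (permMap_mem g hx)

theorem exists_of_mem_garnir (h2 : (2 : F) ≠ 0) {y : Fn F n} (hy : y ∈ garnir F lam.rowLen n) :
    ∃ x ∈ spechtModule F lam n, moduleToFn F lam n x = y := by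
  have hl : Antitone lam.rowLen := fun i j => lam.rowLen_anti i j
  have hy' := garnir_le_polySpan h2 hl (fun i hi => rowLen_eq_zero.mpr hi) hy
  clear hy
  induction hy' using Submodule.span_induction with
  | mem x hx =>
    obtain ⟨R, C, h, rfl⟩ := hx
    obtain ⟨t, rfl, rfl⟩ := exists_tableau h
    exact ⟨polytabloid F t, Submodule.subset_span ⟨t, rfl⟩, toFn_polytabloid t⟩
  | zero => exact ⟨0, zero_mem _, map_zero _⟩
  | add x y _ _ hx hy =>
    obtain ⟨x', hx, rfl⟩ := hx
    obtain ⟨y', hy, rfl⟩ := hy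
    exact ⟨x' + y', add_mem hx hy, map_add _ _ _⟩
  | smul c x _ hx =>
    obtain ⟨x', hx, rfl⟩ := hx
    refine ⟨c • x', ?_, map_smul _ _ _⟩
    rw [← one_smul (MonoidAlgebra F (Perm (Fin n))) x', ← smul_assoc]
    exact Submodule.smul_mem _ _ hx

/-- The Specht module is the module of the representation on `garnir`. -/
theorem nonempty_equiv_garnirRep (h2 : (2 : F) ≠ 0) :
    Nonempty (spechtModule F lam n ≃ₗ[MonoidAlgebra F (Perm (Fin n))]
      (garnirRep F lam.rowLen n).asModule) := by
  let f : spechtModule F lam n →ₗ[MonoidAlgebra F (Perm (Fin n))]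
      (garnirRep F lam.rowLen n).asModule :=
    { toFun := fun x => (garnirRep F lam.rowLen n).asModuleEquiv.symm
        ⟨moduleToFn F lam n x, moduleToFn_mem h2 x.2⟩
      map_add' := fun x y => by
        rw [← map_add]
        exact congrArg _ (Subtype.ext (map_add _ _ _))
      map_smul' := fun a x => by
        rw [RingHom.id_apply, LinearEquiv.symm_apply_eq, Representation.asModuleEquiv_map_smul,
          LinearEquiv.apply_symm_apply]
        refine Subtype.ext ?_
        change moduleToFn F lam n (a • x.1) = _
        induction a using MonoidAlgebra.induction_linear with
        | zero => rw [zero_smul, map_zero, map_zero]; rfl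
        | add a b ha hb => rw [add_smul, map_add, ha, hb, map_add]; rfl
        | single g c =>
          rw [moduleToFn_single_smul, Representation.asAlgebraHom_single]
          rfl }
  refine ⟨LinearEquiv.ofBijective f ⟨?_, ?_⟩⟩
  · intro x y h
    have h1 : moduleToFn F lam n x = moduleToFn F lam n y :=
      congrArg Subtype.val ((garnirRep F lam.rowLen n).asModuleEquiv.symm.injective h)
    exact Subtype.ext ((Representation.asModuleEquiv _).injective (toFn_injective h1))
  · intro y
    obtain ⟨x, hx, hxy⟩ := exists_of_mem_garnir h2 ((garnirRep F lam.rowLen n).asModuleEquiv y).2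
    refine ⟨⟨x, hx⟩, ?_⟩
    change (garnirRep F lam.rowLen n).asModuleEquiv.symm _ = y
    rw [LinearEquiv.symm_apply_eq]
    exact Subtype.ext hxy

end Link

end RowFun

namespace RowFun

open Finset Equiv Module

/-! ### Loewy length one, semisimplicity and simplicity -/

section Loewy

theorem loewyLength_eq_one_of_isSimpleModule {R M : Type*} [Ring R] [AddCommGroup M] [Module R M]
    [IsSimpleModule R M] : loewyLength R M = 1 := by
  have := IsSimpleModule.nontrivial R M
  have h0 : radicalSeries R M 0 ≠ ⊥ := top_ne_bot
  have h1 : radicalSeries R M 1 = ⊥ := by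
    have h2 : jacobson R (radicalSeries R M 0) = ⊥ := by
      refine jacobson_eq_bot_of_injective (radicalSeries R M 0).subtype Subtype.val_injective ?_
      exact IsSimpleModule.jacobson_eq_bot R M
    change (jacobson R (radicalSeries R M 0)).map (radicalSeries R M 0).subtype = ⊥
    rw [h2, Submodule.map_bot]
  refine le_antisymm (Nat.sInf_le h1) (Nat.one_le_iff_ne_zero.mpr fun h => ?_)
  rcases Nat.sInf_eq_zero.mp h with h2 | h2
  · exact h0 h2
  · exact (Set.eq_empty_iff_forall_notMem.mp h2) 1 h1

theorem jacobson_eq_bot_of_loewyLength_eq_one {R M : Type*} [Ring R] [AddCommGroup M] [Module R M]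
    (h : loewyLength R M = 1) : Nontrivial M ∧ jacobson R M = ⊥ := by
  have h1 : radicalSeries R M 1 = ⊥ := by
    -- The infimum of the empty set is `0`, so the value `1` must be attained.
    have h2 : {k | radicalSeries R M k = ⊥}.Nonempty := by
      by_contra h3
      rw [Set.not_nonempty_iff_eq_empty] at h3
      rw [loewyLength, h3, Nat.sInf_empty] at h
      exact zero_ne_one h
    have h3 := Nat.sInf_mem h2
    rwa [show sInf {k | radicalSeries R M k = ⊥} = 1 from h] at h3
  constructor
  · by_contra h2
    rw [not_nontrivial_iff_subsingleton] at h2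
    have h3 : loewyLength R M ≤ 0 := Nat.sInf_le (Subsingleton.elim _ _ : radicalSeries R M 0 = ⊥)
    omega
  · have h2 : jacobson R (radicalSeries R M 0) = ⊥ :=
      Submodule.map_injective_of_injective Subtype.val_injective
        (h1.trans (Submodule.map_bot _).symm)
    exact jacobson_eq_bot_of_injective (Submodule.topEquiv (R := R) (M := M)).symm.toLinearMap
      (Submodule.topEquiv (R := R) (M := M)).symm.injective h2

variable {F G V : Type*} [Field F] [Group G] [AddCommGroup V] [Module F V]
  (ρ : Representation F G V)

/-- Projection onto a submodule along a complement is an endomorphism, hence a scalar, so the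
submodule is zero or everything. -/
theorem isSimpleModule_of_isSemisimpleModule [Nontrivial V]
    [IsSemisimpleModule (MonoidAlgebra F G) ρ.asModule]
    (hend : ∀ φ : V →ₗ[F] V, (∀ g x, φ (ρ g x) = ρ g (φ x)) → ∃ c : F, ∀ x, φ x = c • x) :
    IsSimpleModule (MonoidAlgebra F G) ρ.asModule := by
  have : Nontrivial ρ.asModule := ρ.asModuleEquiv.toEquiv.nontrivial
  rw [isSimpleModule_iff]
  refine ⟨fun N => ?_⟩
  obtain ⟨N', h⟩ := exists_isCompl N
  set π := N.projection N' h
  obtain ⟨c, hc⟩ := hend (ρ.asModuleEquiv.toLinearMap ∘ₗ (π.restrictScalars F) ∘ₗ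
    ρ.asModuleEquiv.symm.toLinearMap) fun g x => by
      simp only [LinearMap.comp_apply, LinearEquiv.coe_coe, LinearMap.coe_restrictScalars]
      rw [ρ.asModuleEquiv_symm_map_rho, map_smul, ρ.asModuleEquiv_map_smul, ρ.asAlgebraHom_of]
  have hc' (y : ρ.asModule) : π y = c • y := by
    simpa using congrArg ρ.asModuleEquiv.symm (hc (ρ.asModuleEquiv y))
  by_cases h0 : c = 0
  · left
    refine (Submodule.eq_bot_iff _).mpr fun x hx => ?_
    have h1 : π x = x := Submodule.projection_apply_of_mem_left h hx
    rw [← h1, hc', h0, zero_smul]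
  · right
    refine Submodule.eq_top_iff'.mpr fun x => ?_
    have h1 := Submodule.projection_apply_mem h (c⁻¹ • x)
    change π (c⁻¹ • x) ∈ N at h1
    rwa [hc', smul_smul, mul_inv_cancel₀ h0, one_smul] at h1

theorem isSimpleModule_asModule_self (σ : Representation F G F) :
    IsSimpleModule (MonoidAlgebra F G) σ.asModule := by
  rw [isSimpleModule_iff_toSpanSingleton_surjective]
  refine ⟨inferInstanceAs (Nontrivial F), fun m hm y => ?_⟩
  refine ⟨MonoidAlgebra.single 1 (σ.asModuleEquiv y / σ.asModuleEquiv m), ?_⟩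
  have hm' : σ.asModuleEquiv m ≠ 0 := fun h => hm (σ.asModuleEquiv.map_eq_zero_iff.mp h)
  refine σ.asModuleEquiv.injective ?_
  rw [LinearMap.toSpanSingleton_apply, Representation.asModuleEquiv_map_smul,
    Representation.asAlgebraHom_single, map_one, LinearMap.smul_apply, Module.End.one_apply,
    smul_eq_mul, div_mul_cancel₀ _ hm']

end Loewy

/-! ### The one-row and one-column cases -/

section Line

variable {F : Type*} [Field F] {n : ℕ} {l : ℕ → ℕ}

/-- The translates of one polytabloid span the module; if they are all multiples of it, the module
is a line with the given character. -/
theorem nonempty_equiv_of_line (h2 : (2 : F) ≠ 0) (hl : Antitone l) {M : ℕ}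
    (hM : ∀ i, M ≤ i → l i = 0) {R C : Fin n → ℕ} (h : IsTableau l R C)
    (σ : Representation F (Perm (Fin n)) F)
    (hσ : ∀ g, permMap F g (polyFun F R C) = σ g 1 • polyFun F R C) :
    Nonempty ((garnirRep F l n).asModule ≃ₗ[MonoidAlgebra F (Perm (Fin n))] σ.asModule) := by
  have he := h.polyFun_mem (F := F) h2 hl
  set e : garnir F l n := ⟨polyFun F R C, he⟩ with hedef
  have hσ' (g : Perm (Fin n)) (c : F) : garnirRep F l n g (c • e) = σ g c • e := by
    have h3 : σ g c = c * σ g 1 := by rw [← smul_eq_mul, ← map_smul, smul_eq_mul, mul_one]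
    rw [map_smul, h3, mul_smul]
    congr 1
    exact Subtype.ext (hσ g)
  let f : σ.asModule →ₗ[MonoidAlgebra F (Perm (Fin n))] (garnirRep F l n).asModule :=
    { toFun := fun c => (garnirRep F l n).asModuleEquiv.symm (σ.asModuleEquiv c • e)
      map_add' := fun x y => by rw [map_add, add_smul, map_add]
      map_smul' := fun a x => by
        rw [RingHom.id_apply, LinearEquiv.symm_apply_eq, Representation.asModuleEquiv_map_smul,
          Representation.asModuleEquiv_map_smul, LinearEquiv.apply_symm_apply]
        induction a using MonoidAlgebra.induction_linear with
        | zero => rw [map_zero, map_zero, LinearMap.zero_apply, LinearMap.zero_apply, zero_smul]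
        | add a b ha hb =>
          rw [map_add, map_add, LinearMap.add_apply, LinearMap.add_apply, add_smul, ha, hb]
        | single g c =>
          rw [Representation.asAlgebraHom_single, Representation.asAlgebraHom_single,
            LinearMap.smul_apply, LinearMap.smul_apply, hσ', smul_assoc] }
  refine ⟨(LinearEquiv.ofBijective f ⟨?_, ?_⟩).symm⟩
  · rw [injective_iff_map_eq_zero]
    intro x hx
    have h3 : σ.asModuleEquiv x • e = 0 :=
      (garnirRep F l n).asModuleEquiv.symm.map_eq_zero_iff.mp hx
    have h4 := congrFun (congrArg Subtype.val h3) R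
    change σ.asModuleEquiv x * polyFun F R C R = 0 at h4
    rw [h.polyFun_self, mul_one] at h4
    exact σ.asModuleEquiv.map_eq_zero_iff.mp h4
  · intro y
    have h3 := h.polySpan_le_span (F := F)
      (garnir_le_polySpan h2 hl hM ((garnirRep F l n).asModuleEquiv y).2)
    have h4 : Submodule.span F (Set.range fun g => permMap F g (polyFun F R C)) ≤
        Submodule.span F {polyFun F R C} := by
      refine Submodule.span_le.mpr ?_
      rintro _ ⟨g, rfl⟩
      change permMap F g (polyFun F R C) ∈ _
      rw [hσ]
      exact Submodule.smul_mem _ _ (Submodule.mem_span_singleton_self _)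
    obtain ⟨c, hc⟩ := Submodule.mem_span_singleton.mp (h4 h3)
    refine ⟨σ.asModuleEquiv.symm c, ?_⟩
    change (garnirRep F l n).asModuleEquiv.symm _ = y
    rw [LinearEquiv.symm_apply_eq, LinearEquiv.apply_symm_apply]
    exact Subtype.ext hc

theorem nonempty_equiv_trivial (h2 : (2 : F) ≠ 0) (hl : Antitone l)
    (hM : ∀ i, 1 ≤ i → l i = 0) {R C : Fin n → ℕ} (h : IsTableau l R C) :
    Nonempty ((garnirRep F l n).asModule ≃ₗ[MonoidAlgebra F (Perm (Fin n))]
      (Representation.trivial F (Perm (Fin n)) F).asModule) := by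
  refine nonempty_equiv_of_line h2 hl hM h _ fun g => ?_
  rw [Representation.trivial_apply, one_smul]
  have h0 (r : Fin n → ℕ) (hr : polyFun F R C r ≠ 0) (a) : r a = 0 := by
    by_contra h1
    have h3 := content_eq (h.polyFun_mem h2 hl) hr (r a)
    rw [hM _ (Nat.one_le_iff_ne_zero.mpr h1), card_eq_zero] at h3
    exact (Finset.eq_empty_iff_forall_notMem.mp h3) a (by simp)
  funext r
  rw [permMap_apply]
  by_cases hr : ∀ a, r a = 0
  · congr 1
    funext a
    rw [Function.comp_apply, hr, hr]
  · push Not at hr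
    obtain ⟨a, ha⟩ := hr
    have h3 : polyFun F R C r = 0 := by
      by_contra h4
      exact ha (h0 r h4 a)
    rw [h3]
    by_contra h4
    have := h0 _ h4 (g.symm a)
    rw [Function.comp_apply, apply_symm_apply] at this
    exact ha this

theorem nonempty_equiv_sign (h2 : (2 : F) ≠ 0) (hl : Antitone l) {M : ℕ}
    (hM : ∀ i, M ≤ i → l i = 0) (h1 : l 0 = 1) {R C : Fin n → ℕ} (h : IsTableau l R C) :
    Nonempty ((garnirRep F l n).asModule ≃ₗ[MonoidAlgebra F (Perm (Fin n))]
      (signRepresentation F n).asModule) := by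
  refine nonempty_equiv_of_line h2 hl hM h _ fun g => ?_
  have h0 (a) : C a = 0 := by
    have h3 := h.lt a
    have h4 := hl (Nat.zero_le (R a))
    omega
  have h3 : signRepresentation F n g 1 = ((Perm.sign g : ℤ) : F) := mul_one _
  rw [h3]
  exact IsTableau.permMap_self fun a => by rw [h0, h0]

end Line

/-! ### Assembling the equivalences -/

section Main

variable {p : ℕ} {lam : YoungDiagram} {F : Type*} [Field F] [CharP F p]

theorem two_ne_zero_of_charP (hp5 : 5 ≤ p) : (2 : F) ≠ 0 := by
  intro h
  have h1 : ((2 : ℕ) : F) = 0 := by exact_mod_cast h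
  have := Nat.le_of_dvd two_pos ((CharP.cast_eq_zero_iff F p 2).mp h1)
  omega

theorem exists_isTableau_rowLen {n : ℕ} (hcard : lam.card = n) :
    ∃ R C : Fin n → ℕ, IsTableau lam.rowLen R C :=
  exists_isTableau (M := lam.colLen 0) n _ (fun i j => lam.rowLen_anti i j)
    (fun _ => rowLen_eq_zero.mpr) ((card_eq_sum_rowLen lam).symm.trans hcard)

theorem rowLen_of_isSimpleModule (hp : p.Prime) (hp5 : 5 ≤ p) (hcard : lam.card = 3 * p)
    (hcore : IsPCore p lam ⊥)
    [IsSimpleModule (MonoidAlgebra F (Perm (Fin (3 * p))))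
      (garnirRep F lam.rowLen (3 * p)).asModule] :
    lam.rowLen 0 = 3 * p ∨ lam.rowLen 0 = 1 := by
  by_contra! h
  have hl : Antitone lam.rowLen := fun i j => lam.rowLen_anti i j
  obtain ⟨R, C, ht⟩ := exists_isTableau_rowLen hcard
  obtain ⟨B, hB⟩ := exists_isForm_of_isSimpleModule (F := F) (two_ne_zero_of_charP hp5) hl
    (M := lam.colLen 0) (fun _ => rowLen_eq_zero.mpr) ht
  exact not_isForm_of_bad hp (by omega) (bad_and_not_isJM hp hp5 hcard hcore h.2 h.1).1 _ _ hl
    (M := lam.colLen 0) (fun _ => rowLen_eq_zero.mpr) ((card_eq_sum_rowLen lam).symm.trans hcard)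
    (fun _ => Iff.rfl) B hB

/-- A finite-dimensional module with zero radical is semisimple, and scalar endomorphisms upgrade
this to simple. -/
theorem isSimpleModule_of_loewyLength_eq_one {n : ℕ} (hp5 : 5 ≤ p) (hcard : lam.card = n)
    (h : loewyLength (MonoidAlgebra F (Perm (Fin n))) (spechtModule F lam n) = 1) :
    IsSimpleModule (MonoidAlgebra F (Perm (Fin n))) (garnirRep F lam.rowLen n).asModule := by
  have hl : Antitone lam.rowLen := fun i j => lam.rowLen_anti i j
  have h2 : (2 : F) ≠ 0 := two_ne_zero_of_charP hp5
  obtain ⟨e⟩ := nonempty_equiv_garnirRep (F := F) (lam := lam) (n := n) h2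
  obtain ⟨R, C, ht⟩ := exists_isTableau_rowLen hcard
  obtain ⟨hn, hj⟩ := jacobson_eq_bot_of_loewyLength_eq_one h
  have := finiteDimensional_garnir (F := F) (n := n) (l := lam.rowLen)
    (fun _ => rowLen_eq_zero.mpr)
  have : IsArtinian (MonoidAlgebra F (Perm (Fin n))) (garnirRep F lam.rowLen n).asModule :=
    isArtinian_of_tower F
      ((garnirRep F lam.rowLen n).asModuleEquiv.isArtinian_iff.mpr inferInstance)
  have : IsSemisimpleModule (MonoidAlgebra F (Perm (Fin n))) (garnirRep F lam.rowLen n).asModule :=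
    (IsArtinian.isSemisimpleModule_iff_jacobson _ _).mpr
      (jacobson_eq_bot_of_injective e.symm.toLinearMap e.symm.injective hj)
  have : Nontrivial (garnir F lam.rowLen n) :=
    (e.toEquiv.trans (garnirRep F lam.rowLen n).asModuleEquiv.toEquiv).symm.nontrivial
  exact isSimpleModule_of_isSemisimpleModule _
    (exists_scalar_of_commute h2 hl (fun _ => rowLen_eq_zero.mpr) ht)

end Main

end RowFun

theorem mainTheorem6 (p : ℕ) (hp : p.Prime) (hp5 : 5 ≤ p) (lam : YoungDiagram)
    (hcard : lam.card = 3 * p) (hcore : IsPCore p lam ⊥) :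
    (lam.IsJM p ↔ lam.rowLens = [3 * p] ∨ lam.rowLens = List.replicate (3 * p) 1) ∧
    ∀ (F : Type*) [Field F] [CharP F p],
      (IsSimpleModule (MonoidAlgebra F (Equiv.Perm (Fin (3 * p)))) (spechtModule F lam (3 * p)) ↔
        lam.rowLens = [3 * p] ∨ lam.rowLens = List.replicate (3 * p) 1) ∧
      (loewyLength (MonoidAlgebra F (Equiv.Perm (Fin (3 * p)))) (spechtModule F lam (3 * p)) = 1 ↔
        lam.rowLens = [3 * p] ∨ lam.rowLens = List.replicate (3 * p) 1) ∧
      (lam.rowLens = [3 * p] →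
        Nonempty (spechtModule F lam (3 * p)
          ≃ₗ[MonoidAlgebra F (Equiv.Perm (Fin (3 * p)))]
            (Representation.trivial F (Equiv.Perm (Fin (3 * p))) F).asModule)) ∧
      (lam.rowLens = List.replicate (3 * p) 1 →
        Nonempty (spechtModule F lam (3 * p)
          ≃ₗ[MonoidAlgebra F (Equiv.Perm (Fin (3 * p)))]
            (signRepresentation F (3 * p)).asModule)) := by
  have hn : 0 < 3 * p := by omega
  have hl : Antitone lam.rowLen := fun i j => lam.rowLen_anti i j
  have hM : ∀ i, lam.colLen 0 ≤ i → lam.rowLen i = 0 := fun _ => RowFun.rowLen_eq_zero.mpr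
  rw [RowFun.rowLens_eq_singleton hn hcard, RowFun.rowLens_eq_replicate hn hcard]
  refine ⟨RowFun.isJM_iff hp hp5 hcard hcore, fun F _ _ => ?_⟩
  have h2 : (2 : F) ≠ 0 := RowFun.two_ne_zero_of_charP hp5
  obtain ⟨e⟩ := RowFun.nonempty_equiv_garnirRep (F := F) (lam := lam) (n := 3 * p) h2
  obtain ⟨R, C, ht⟩ := RowFun.exists_isTableau_rowLen hcard
  have htriv (h : lam.rowLen 0 = 3 * p) : Nonempty (spechtModule F lam (3 * p)
      ≃ₗ[MonoidAlgebra F (Equiv.Perm (Fin (3 * p)))]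
        (Representation.trivial F (Equiv.Perm (Fin (3 * p))) F).asModule) := by
    have h1 : lam.colLen 0 = 1 := by
      rw [← YoungDiagram.length_rowLens, (RowFun.rowLens_eq_singleton hn hcard).mpr h,
        List.length_singleton]
    exact (RowFun.nonempty_equiv_trivial h2 hl (h1 ▸ hM) ht).map e.trans
  have hsign (h : lam.rowLen 0 = 1) : Nonempty (spechtModule F lam (3 * p)
      ≃ₗ[MonoidAlgebra F (Equiv.Perm (Fin (3 * p)))]
        (signRepresentation F (3 * p)).asModule) :=
    (RowFun.nonempty_equiv_sign h2 hl hM h ht).map e.trans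
  have hsimple (h : lam.rowLen 0 = 3 * p ∨ lam.rowLen 0 = 1) :
      IsSimpleModule (MonoidAlgebra F (Equiv.Perm (Fin (3 * p)))) (spechtModule F lam (3 * p)) := by
    rcases h with h | h
    · have := RowFun.isSimpleModule_asModule_self
        (Representation.trivial F (Equiv.Perm (Fin (3 * p))) F)
      obtain ⟨e'⟩ := htriv h
      exact IsSimpleModule.congr e'
    · have := RowFun.isSimpleModule_asModule_self (signRepresentation F (3 * p))
      obtain ⟨e'⟩ := hsign h
      exact IsSimpleModule.congr e'
  refine ⟨⟨fun h => ?_, hsimple⟩, ⟨fun h => ?_, fun h => ?_⟩, htriv, hsign⟩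
  · have : IsSimpleModule (MonoidAlgebra F (Equiv.Perm (Fin (3 * p))))
        (RowFun.garnirRep F lam.rowLen (3 * p)).asModule :=
      IsSimpleModule.congr (N := spechtModule F lam (3 * p)) e.symm
    exact RowFun.rowLen_of_isSimpleModule (F := F) hp hp5 hcard hcore
  · have := RowFun.isSimpleModule_of_loewyLength_eq_one (F := F) hp5 hcard h
    exact RowFun.rowLen_of_isSimpleModule (F := F) hp hp5 hcard hcore
  · have := hsimple h
    exact RowFun.loewyLength_eq_one_of_isSimpleModule
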